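/- **Setting.** Let $M$ be a smooth $n$-manifold, and let $\mathcal D\subset TM$ be open such that $\mathcal D\cap T_xM$ is non-empty and connected for every $x\in M$ (for example $\mathcal D=TM$, or, if $n\ge 2$, $TM$ without its zero section). A chart $(x^\mu)$ of $M$ induces coordinates $(x^\mu,y^a)$ on $TM$; $\dot\partial_a=\partial/\partial y^a$, and repeated indices (also the label $i$) are summed. An *EAP-space* consists of a smooth nonlinear connection on $\mathcal D$ with coefficients $N^a_\mu(x,y)$, so that $\delta_\mu=\partial_\mu-N^a_\mu\dot\partial_a$ is the horizontal basis, and of $n$ smooth vector fields $\lambda_i=\lambda_i^\alpha\delta_\alpha+\lambda_i^a\dot\partial_a$ on $\mathcal D$ whose horizontal parts, and whose vertical parts, are linearly independent at every point. Let $(\lambda_{i\alpha})$, $(\lambda_{ia})$ be the inverse matrices: $\lambda_i^\alpha\lambda_{i\beta}=\delta^\alpha_\beta$, $\lambda_i^a\lambda_{ib}=\delta^a_b$. Put $g_{\alpha\beta}=\lambda_{i\alpha}\lambda_{i\beta}$, $g_{ab}=\lambda_{ia}\lambda_{ib}$, with inverses $g^{\alpha\beta},g^{ab}$. The *canonical $d$-connection*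 has the coefficients $$\Gamma^\alpha_{\mu\nu}=\lambda_i^\alpha\delta_\nu\lambda_{i\mu},\quad \Gamma^a_{b\nu}=\lambda_i^a\delta_\nu\lambda_{ib},\quad C^\alpha_{\mu c}=\lambda_i^\alpha\dot\partial_c\lambda_{i\mu},\quad C^a_{bc}=\lambda_i^a\dot\partial_c\lambda_{ib}.$$ It is of *Cartan type* if $y^a{}_{|\mu}=-N^a_\mu+\Gamma^a_{b\mu}y^b=0$ and $y^a{}_{||c}=\delta^a_c+C^a_{bc}y^b=\delta^a_c$, and of *Berwald type* if $\dot\partial_bN^a_\mu=\Gamma^a_{b\mu}$ and $C^\alpha_{\mu c}=0$. The *natural metric $d$-connection* has the coefficients $$\overset{\circ}{\Gamma}{}^\alpha_{\mu\nu}=\tfrac12g^{\alpha\epsilon}(\delta_\mu g_{\epsilon\nu}+\delta_\nu g_{\epsilon\mu}-\delta_\epsilon g_{\mu\nu}),\quad \overset{\circ}{\Gamma}{}^a_{b\nu}=\dot\partial_bN^a_\nu+\tfrac12g^{ac}(\delta_\nu g_{bc}-g_{dc}\dot\partial_bN^d_\nu-g_{bd}\dot\partial_cN^d_\nu),$$ $$\overset{\circ}{C}{}^\alpha_{\mu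 c}=\tfrac12g^{\alpha\epsilon}\dot\partial_cg_{\mu\epsilon},\quad \overset{\circ}{C}{}^a_{bc}=\tfrac12g^{ad}(\dot\partial_bg_{dc}+\dot\partial_cg_{db}-\dot\partial_dg_{bc}).$$ The torsion of the EAP-space is $(\Lambda^\alpha_{\mu\nu},R^a_{\mu\nu},C^\alpha_{\mu c},P^a_{\mu c},T^a_{bc})$ with $\Lambda^\alpha_{\mu\nu}=\Gamma^\alpha_{\mu\nu}-\Gamma^\alpha_{\nu\mu}$, $R^a_{\mu\nu}=\delta_\nu N^a_\mu-\delta_\mu N^a_\nu$, $P^a_{\mu c}=\dot\partial_cN^a_\mu-\Gamma^a_{c\mu}$, $T^a_{bc}=C^a_{bc}-C^a_{cb}$; its contortion $(\gamma^\alpha_{\mu\nu},\gamma^a_{b\mu},\gamma^\alpha_{\mu c},\gamma^a_{bc})$ is the difference of the canonical and the natural metric coefficients. Put $\Omega^\alpha_{\mu\nu}=\gamma^\alpha_{\mu\nu}+\gamma^\alpha_{\nu\mu}$ and $C_\mu=\Lambda^\alpha_{\mu\alpha}$. Indices are lowered and raised with $g$; $|$ is the horizontal covariant derivative of the canonical $d$-connection.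 The *horizontal fundamental tensors* are $$\xi_{\mu\nu}=\gamma_{\mu\nu}{}^\alpha{}_{|\alpha},\ \gamma_{\mu\nu}=C_\alpha\gamma_{\mu\nu}{}^\alpha,\ \eta_{\mu\nu}=C_\beta\Lambda^\beta_{\mu\nu},\ \phi_{\mu\nu}=C_\beta\Omega^\beta_{\mu\nu},\ \chi_{\mu\nu}=\Lambda^\alpha_{\mu\nu|\alpha},\ \psi_{\mu\nu}=\Omega^\alpha_{\mu\nu|\alpha},$$ $$\epsilon_{\mu\nu}=C_{\mu|\nu}-C_{\nu|\mu},\ \theta_{\mu\nu}=C_{\mu|\nu}+C_{\nu|\mu},\ \kappa_{\mu\nu},\varpi_{\mu\nu}=\gamma^\beta_{\alpha\mu}\gamma^\alpha_{\nu\beta}\mp\gamma^\beta_{\mu\alpha}\gamma^\alpha_{\beta\nu},\ \sigma_{\mu\nu}=\gamma^\beta_{\alpha\mu}\gamma^\alpha_{\beta\nu},\ \omega_{\mu\nu}=\gamma^\beta_{\mu\alpha}\gamma^\alpha_{\nu\beta},\ \alpha_{\mu\nu}=C_\mu C_\nu .$$ Put $H_{\mu\nu}=\Lambda^\alpha_{\epsilon\mu}\Lambda^\epsilon_{\alpha\nu}-C_\mu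 C_\nu$, $H=g^{\mu\nu}H_{\mu\nu}$ and $\mathcal H=|\lambda|H$ with $|\lambda|=\det(\lambda_{i\beta})$. For a canonical $d$-connection of Berwald type, where the $\lambda_{i\mu}$ depend on $x$ only, the *horizontal field equations* are the Euler–Lagrange equations of $\mathcal H$ in the variables $\lambda_{j\beta}(x)$, $$\frac{\delta\mathcal H}{\delta\lambda_{j\beta}}:=\frac{\partial\mathcal H}{\partial\lambda_{j\beta}}-\frac{\partial}{\partial x^\gamma}\Big(\frac{\partial\mathcal H}{\partial\lambda_{j\beta,\gamma}}\Big)=0 .$$ Let $$E_{\mu\nu}:=g_{\mu\nu}H-2H_{\mu\nu}-2C_\mu C_\nu-2g_{\mu\nu}(C^\epsilon{}_{|\epsilon}-C^\epsilon C_\epsilon)-2C^\epsilon\Lambda_{\mu\epsilon\nu}+2C_{\nu|\mu}-2g^{\epsilon\alpha}\Lambda_{\mu\nu\alpha|\epsilon}.$$ The vertical analogues (basic covector $C_a=T^d_{ad}$, fundamental tensors, Lagrangian $\mathcal V=\det(\lambda_{ib})\,g^{ab}(T^d_{ea}T^e_{db}-C_aC_b)$, $E_{ab}$) are given by the same formulas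 with $\lambda_{ib},\lambda_i^a$, $\dot\partial_a$, $C^a_{bc}$, $T^a_{bc}$, $\gamma^a_{bc}$ in place of $\lambda_{i\mu},\lambda_i^\mu$, $\delta_\mu$, $\Gamma^\alpha_{\mu\nu}$, $\Lambda^\alpha_{\mu\nu}$, $\gamma^\alpha_{\mu\nu}$; the *vertical field equations* are $\frac{\delta\mathcal V}{\delta\lambda_{jb}}:=\frac{\partial\mathcal V}{\partial\lambda_{jb}}-\frac{\partial}{\partial y^e}\big(\frac{\partial\mathcal V}{\partial\lambda_{jb;e}}\big)=0$ (where $;e$ denotes $\dot\partial_e$), explicitly $E_{ab}=0$. A conventional *AP-space* is $M$ with $n$ smooth, everywhere linearly independent vector fields $\bar\lambda_i(x)$ on $M$. The same formulas with $\partial_\mu$ in place of $\delta_\mu$ define its metric, canonical and Levi-Civita connections, torsion, contortion, basic covector, fundamental tensors and $E_{\mu\nu}$; the Mikhail–Wanas GFT field equations are the Euler–Lagrange equations of the corresponding Lagrangian $|\bar\lambda|\,g^{\mu\nu}H_{\mu\nu}$ on $M$, explicitly $E_{\mu\nu}=0$. **Theorem.** Suppose that the canonical $d$-connection of an EAP-space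 on $\mathcal D$ is of both Cartan and Berwald type. Then the following holds in every chart. 1. The vertical field equations vanish: $\delta\mathcal V/\delta\lambda_{jb}$, $E_{ab}$, $C_a$ and all vertical fundamental tensors vanish identically on $\mathcal D$. 2. The horizontal $\lambda_i^\alpha$ depend on $x$ only: there is an AP-space $(M,\bar\lambda)$ with $d\pi(\lambda_i(u))=\bar\lambda_i(\pi(u))$ for all $u\in\mathcal D$, where $\pi:TM\to M$ is the projection. The coefficients $\Gamma^\alpha_{\mu\nu}$ and $\overset{\circ}{\Gamma}{}^\alpha_{\mu\nu}$ are functions of $x$ only and equal those of this AP-space; the torsion and the contortion are $(\Lambda^\alpha_{\mu\nu},0,0,0,0)$ and $(\gamma^\alpha_{\mu\nu},0,0,0)$, where $\Lambda$ and $\gamma$ are those of the AP-space. The $g_{\mu\nu}$, $C_\mu$, the horizontal fundamental tensors, and hence also $\tfrac12g_{\mu\nu}(g^{\alpha\beta}\sigma_{\alpha\beta}-g^{\alpha\beta}\varpi_{\alpha\beta})-(\sigma_{\mu\nu}-\varpi_{\mu\nu})$ and $\gamma_{\mu\nu}-\xi_{\mu\nu}+\eta_{\mu\nu}$ (energy-momentum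 tensor and electromagnetic field), are functions of $x$ only and equal those of the AP-space. 3. The horizontal field equations coincide with the GFT field equations of $(M,\bar\lambda)$: at each point $(x,y)$ of $\mathcal D$ the expression $\delta\mathcal H/\delta\lambda_{j\beta}$ equals the GFT Euler–Lagrange expression at $x$. On both sides $g_{\mu\beta}\frac1{|\lambda|}\frac{\delta\mathcal H}{\delta\lambda_{j\beta}}\lambda_{j\nu}=E_{\mu\nu}$, and the two tensors $E_{\mu\nu}$ agree. In particular the horizontal field equations hold on $\mathcal D$ if and only if the GFT field equations hold on $M$. -/

import Mathlib

open scoped Manifold ContDiff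

noncomputable section

namespace EAP

/-! ### Coordinates and partial derivatives -/

/-- Coordinate space of an `n`-dimensional manifold. -/
abbrev Co (n : ℕ) : Type := EuclideanSpace ℝ (Fin n)

/-- `∂f/∂x^μ` for a function on (an open part of) `ℝⁿ`. -/
def pd {n : ℕ} (μ : Fin n) (f : Co n → ℝ) (x : Co n) : ℝ :=
  fderiv ℝ f x (EuclideanSpace.single μ 1)

/-- `∂f/∂x^μ` for a function of `(x, y)`. -/
def pdx {n : ℕ} (μ : Fin n) (f : Co n × Co n → ℝ) (p : Co n × Co n) : ℝ :=
  fderiv ℝ f p (EuclideanSpace.single μ 1, 0)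

/-- `∂f/∂y^a` for a function of `(x, y)`. -/
def pdy {n : ℕ} (a : Fin n) (f : Co n × Co n → ℝ) (p : Co n × Co n) : ℝ :=
  fderiv ℝ f p (0, EuclideanSpace.single a 1)

/-- `δ_μ = ∂_μ - N^a_μ ∂̇_a`, where `N p a μ` is `N^a_μ` at `p = (x, y)`. -/
def hd {n : ℕ} (N : Co n × Co n → Fin n → Fin n → ℝ) (μ : Fin n)
    (f : Co n × Co n → ℝ) (p : Co n × Co n) : ℝ :=
  pdx μ f p - ∑ a, N p a μ * pdy a f p

/-! ### The Lagrangian of Mikhail and Wanas, as a function of the covectors and their derivatives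

Here `A i μ` stands for `λ_{iμ}` and `B i μ ν` for the derivative of `λ_{iμ}` in direction `ν`. -/

section Lagrangian

variable {n : ℕ}

/-- `Γ^α_{μν} = λ_i^α B_{iμν}`. -/
def jetGam (A : Matrix (Fin n) (Fin n) ℝ) (B : Fin n → Fin n → Fin n → ℝ) (α μ ν : Fin n) : ℝ :=
  ∑ i, A⁻¹ α i * B i μ ν

/-- `Λ^α_{μν} = Γ^α_{μν} - Γ^α_{νμ}`. -/
def jetTor (A : Matrix (Fin n) (Fin n) ℝ) (B : Fin n → Fin n → Fin n → ℝ) (α μ ν : Fin n) : ℝ :=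
  jetGam A B α μ ν - jetGam A B α ν μ

/-- `C_μ = Λ^α_{μα}`. -/
def jetC (A : Matrix (Fin n) (Fin n) ℝ) (B : Fin n → Fin n → Fin n → ℝ) (μ : Fin n) : ℝ :=
  ∑ α, jetTor A B α μ α

/-- `H_{μν} = Λ^α_{εμ} Λ^ε_{αν} - C_μ C_ν`. -/
def jetH (A : Matrix (Fin n) (Fin n) ℝ) (B : Fin n → Fin n → Fin n → ℝ) (μ ν : Fin n) : ℝ :=
  (∑ α, ∑ ε, jetTor A B α ε μ * jetTor A B ε α ν) - jetC A B μ * jetC A B ν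

/-- `|λ| g^{μν} H_{μν}`, with `|λ| = det (λ_{iμ})` and `g^{μν} = λ_i^μ λ_i^ν`. -/
def lagrangian (A : Matrix (Fin n) (Fin n) ℝ) (B : Fin n → Fin n → Fin n → ℝ) : ℝ :=
  A.det * ∑ μ, ∑ ν, (∑ i, A⁻¹ μ i * A⁻¹ ν i) * jetH A B μ ν

/-- Partial derivative with respect to the variable `λ_{jβ}`. -/
def dA (L : Matrix (Fin n) (Fin n) ℝ → (Fin n → Fin n → Fin n → ℝ) → ℝ) (j β : Fin n)
    (A : Matrix (Fin n) (Fin n) ℝ) (B : Fin n → Fin n → Fin n → ℝ) : ℝ :=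
  deriv (fun t : ℝ => L (A + t • Matrix.single j β 1) B) 0

/-- Partial derivative with respect to the variable `B_{jβγ}`. -/
def dB (L : Matrix (Fin n) (Fin n) ℝ → (Fin n → Fin n → Fin n → ℝ) → ℝ) (j β γ : Fin n)
    (A : Matrix (Fin n) (Fin n) ℝ) (B : Fin n → Fin n → Fin n → ℝ) : ℝ :=
  deriv (fun t : ℝ => L A (fun i μ ν => B i μ ν + if i = j ∧ μ = β ∧ ν = γ then t else 0)) 0

end Lagrangian

/-! ### Calculus of an absolute parallelism frame

The horizontal geometry (with `δ_μ`), the vertical geometry (with `∂̇_a`) and the conventional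
AP-geometry (with `∂_μ`) are given by the same formulas; they are written once, for a frame and
for the `n` differential operators in question. -/

/-- `frame p i α` is `λ_i^α` at `p`; `d ν` is the derivation `δ_ν`, `∂̇_ν` or `∂_ν`. -/
structure FrameCalculus (n : ℕ) (X : Type) where
  d : Fin n → (X → ℝ) → X → ℝ
  frame : X → Matrix (Fin n) (Fin n) ℝ

namespace FrameCalculus

variable {n : ℕ} {X : Type} (F : FrameCalculus n X)

/-- `λ_{iμ}`: the inverse matrix, `λ_i^α λ_{iβ} = δ^α_β`. -/
def co (i μ : Fin n) (p : X) : ℝ := (F.frame p)⁻¹ μ i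

/-- `(λ_{iμ})` as a matrix, rows indexed by `i`. -/
def coMat (p : X) : Matrix (Fin n) (Fin n) ℝ := Matrix.of fun i μ => F.co i μ p

/-- `g_{μν} = λ_{iμ} λ_{iν}`. -/
def g (μ ν : Fin n) (p : X) : ℝ := ∑ i, F.co i μ p * F.co i ν p

/-- `g^{μν} = λ_i^μ λ_i^ν`. -/
def gInv (μ ν : Fin n) (p : X) : ℝ := ∑ i, F.frame p i μ * F.frame p i ν

/-- Canonical connection `Γ^α_{μν} = λ_i^α d_ν λ_{iμ}`. -/
def Gam (α μ ν : Fin n) (p : X) : ℝ := ∑ i, F.frame p i α * F.d ν (F.co i μ) p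

/-- Natural metric connection `½ g^{αε} (d_μ g_{εν} + d_ν g_{εμ} - d_ε g_{μν})`. -/
def Gam0 (α μ ν : Fin n) (p : X) : ℝ :=
  1 / 2 * ∑ ε, F.gInv α ε p * (F.d μ (F.g ε ν) p + F.d ν (F.g ε μ) p - F.d ε (F.g μ ν) p)

/-- Torsion `Λ^α_{μν} = Γ^α_{μν} - Γ^α_{νμ}` of the canonical connection. -/
def Tor (α μ ν : Fin n) (p : X) : ℝ := F.Gam α μ ν p - F.Gam α ν μ p

/-- Contortion `γ^α_{μν}`: canonical minus natural metric connection. -/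
def gam (α μ ν : Fin n) (p : X) : ℝ := F.Gam α μ ν p - F.Gam0 α μ ν p

/-- `Ω^α_{μν} = γ^α_{μν} + γ^α_{νμ}`. -/
def Om (α μ ν : Fin n) (p : X) : ℝ := F.gam α μ ν p + F.gam α ν μ p

/-- Basic covector `C_μ = Λ^α_{μα}`. -/
def C (μ : Fin n) (p : X) : ℝ := ∑ α, F.Tor α μ α p

/-- `C^μ = g^{με} C_ε`. -/
def CUp (μ : Fin n) (p : X) : ℝ := ∑ ε, F.gInv μ ε p * F.C ε p

/-- `Λ_{αμν} = g_{αε} Λ^ε_{μν}`. -/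
def TorLow (α μ ν : Fin n) (p : X) : ℝ := ∑ ε, F.g α ε p * F.Tor ε μ ν p

/-- `γ_{αμν} = g_{αε} γ^ε_{μν}`. -/
def gamLow (α μ ν : Fin n) (p : X) : ℝ := ∑ ε, F.g α ε p * F.gam ε μ ν p

/-- `gamUp3 α μ ν` is `γ_{μν}{}^α = g^{αε} γ_{μνε}`. -/
def gamUp3 (α μ ν : Fin n) (p : X) : ℝ := ∑ ε, F.gInv α ε p * F.gamLow μ ν ε p

/-- `V^α_{|σ}`. All covariant derivatives are with respect to the canonical connection. -/
def cov10 (V : Fin n → X → ℝ) (α σ : Fin n) (p : X) : ℝ :=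
  F.d σ (V α) p + ∑ ε, F.Gam α ε σ p * V ε p

/-- `W_{μ|σ}`. -/
def cov01 (W : Fin n → X → ℝ) (μ σ : Fin n) (p : X) : ℝ :=
  F.d σ (W μ) p - ∑ ε, F.Gam ε μ σ p * W ε p

/-- `T^α_{μν|σ}`. -/
def cov12 (T : Fin n → Fin n → Fin n → X → ℝ) (α μ ν σ : Fin n) (p : X) : ℝ :=
  F.d σ (T α μ ν) p + (∑ ε, F.Gam α ε σ p * T ε μ ν p)
    - (∑ ε, F.Gam ε μ σ p * T α ε ν p) - ∑ ε, F.Gam ε ν σ p * T α μ ε p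

/-- `T_{αμν|σ}`. -/
def cov03 (T : Fin n → Fin n → Fin n → X → ℝ) (α μ ν σ : Fin n) (p : X) : ℝ :=
  F.d σ (T α μ ν) p - (∑ ε, F.Gam ε α σ p * T ε μ ν p)
    - (∑ ε, F.Gam ε μ σ p * T α ε ν p) - ∑ ε, F.Gam ε ν σ p * T α μ ε p

/-! The fundamental second rank tensors. -/

/-- `ξ_{μν} = γ_{μν}{}^α{}_{|α}`. -/
def xi (μ ν : Fin n) (p : X) : ℝ := ∑ α, F.cov12 F.gamUp3 α μ ν α p

/-- `γ_{μν} = C_α γ_{μν}{}^α`. -/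
def gam2 (μ ν : Fin n) (p : X) : ℝ := ∑ α, F.C α p * F.gamUp3 α μ ν p

/-- `η_{μν} = C_β Λ^β_{μν}`. -/
def eta (μ ν : Fin n) (p : X) : ℝ := ∑ β, F.C β p * F.Tor β μ ν p

/-- `φ_{μν} = C_β Ω^β_{μν}`. -/
def phi (μ ν : Fin n) (p : X) : ℝ := ∑ β, F.C β p * F.Om β μ ν p

/-- `χ_{μν} = Λ^α_{μν|α}`. -/
def chi (μ ν : Fin n) (p : X) : ℝ := ∑ α, F.cov12 F.Tor α μ ν α p

/-- `ψ_{μν} = Ω^α_{μν|α}`. -/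
def psi (μ ν : Fin n) (p : X) : ℝ := ∑ α, F.cov12 F.Om α μ ν α p

/-- `ε_{μν} = C_{μ|ν} - C_{ν|μ}`. -/
def eps (μ ν : Fin n) (p : X) : ℝ := F.cov01 F.C μ ν p - F.cov01 F.C ν μ p

/-- `θ_{μν} = C_{μ|ν} + C_{ν|μ}`. -/
def theta (μ ν : Fin n) (p : X) : ℝ := F.cov01 F.C μ ν p + F.cov01 F.C ν μ p

/-- `κ_{μν} = γ^β_{αμ} γ^α_{νβ} - γ^β_{μα} γ^α_{βν}`. -/
def kappa (μ ν : Fin n) (p : X) : ℝ :=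
  ∑ α, ∑ β, (F.gam β α μ p * F.gam α ν β p - F.gam β μ α p * F.gam α β ν p)

/-- `ϖ_{μν} = γ^β_{αμ} γ^α_{νβ} + γ^β_{μα} γ^α_{βν}`. -/
def varpi (μ ν : Fin n) (p : X) : ℝ :=
  ∑ α, ∑ β, (F.gam β α μ p * F.gam α ν β p + F.gam β μ α p * F.gam α β ν p)

/-- `σ_{μν} = γ^β_{αμ} γ^α_{βν}`. -/
def sig (μ ν : Fin n) (p : X) : ℝ := ∑ α, ∑ β, F.gam β α μ p * F.gam α β ν p

/-- `ω_{μν} = γ^β_{μα} γ^α_{νβ}`. -/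
def om (μ ν : Fin n) (p : X) : ℝ := ∑ α, ∑ β, F.gam β μ α p * F.gam α ν β p

/-- `α_{μν} = C_μ C_ν`. -/
def al (μ ν : Fin n) (p : X) : ℝ := F.C μ p * F.C ν p

/-- The list of all thirteen fundamental second rank tensors. -/
def table : Fin 13 → Fin n → Fin n → X → ℝ :=
  ![F.xi, F.gam2, F.eta, F.phi, F.chi, F.psi, F.eps, F.theta, F.kappa, F.varpi, F.sig, F.om, F.al]

/-- Trace `g^{μν} S_{μν}`. -/
def tr (S : Fin n → Fin n → X → ℝ) (p : X) : ℝ := ∑ μ, ∑ ν, F.gInv μ ν p * S μ ν p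

/-- Geometric energy-momentum tensor `½ g_{μν} (σ - ϖ) - (σ_{μν} - ϖ_{μν})`. -/
def energyMomentum (μ ν : Fin n) (p : X) : ℝ :=
  1 / 2 * F.g μ ν p * (F.tr F.sig p - F.tr F.varpi p) - (F.sig μ ν p - F.varpi μ ν p)

/-- Geometric electromagnetic field `γ_{μν} - ξ_{μν} + η_{μν}`. -/
def emField (μ ν : Fin n) (p : X) : ℝ := F.gam2 μ ν p - F.xi μ ν p + F.eta μ ν p

/-- `H_{μν} = Λ^α_{εμ} Λ^ε_{αν} - C_μ C_ν`. -/
def H (μ ν : Fin n) (p : X) : ℝ :=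
  (∑ α, ∑ ε, F.Tor α ε μ p * F.Tor ε α ν p) - F.C μ p * F.C ν p

/-- The tensor of the field equations in explicit form:
`E_{μν} = g_{μν} H - 2 H_{μν} - 2 C_μ C_ν - 2 g_{μν} (C^ε_{|ε} - C^ε C_ε) - 2 C^ε Λ_{μεν}
  + 2 C_{ν|μ} - 2 g^{εα} Λ_{μνα|ε}`. -/
def E (μ ν : Fin n) (p : X) : ℝ :=
  F.g μ ν p * F.tr F.H p - 2 * F.H μ ν p - 2 * F.C μ p * F.C ν p
    - 2 * F.g μ ν p * ((∑ ε, F.cov10 F.CUp ε ε p) - ∑ ε, F.CUp ε p * F.C ε p)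
    - 2 * (∑ ε, F.CUp ε p * F.TorLow μ ε ν p)
    + 2 * F.cov01 F.C ν μ p
    - 2 * ∑ ε, ∑ α, F.gInv ε α p * F.cov03 F.TorLow μ ν α ε p

/-- The first derivatives `d_ν λ_{iμ}`. -/
def dco (p : X) (i μ ν : Fin n) : ℝ := F.d ν (F.co i μ) p

/-- Euler-Lagrange expression of `|λ| g^{μν} H_{μν}` with respect to `λ_{jβ}`:
`∂L/∂λ_{jβ} - d_γ (∂L/∂(d_γ λ_{jβ}))`. -/
def eulerLagrange (j β : Fin n) (p : X) : ℝ :=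
  dA lagrangian j β (F.coMat p) (F.dco p)
    - ∑ γ, F.d γ (fun q => dB lagrangian j β γ (F.coMat q) (F.dco q)) p

/-- `g_{μβ} (1/|λ|) Z_{jβ} λ_{jν}`, the covariant tensor formed from an Euler-Lagrange
expression `Z_{jβ} = δL/δλ_{jβ}`. -/
def lowerEL (Z : Fin n → Fin n → X → ℝ) (μ ν : Fin n) (p : X) : ℝ :=
  ∑ β, F.g μ β p * ∑ j, 1 / (F.coMat p).det * Z j β p * F.co j ν p

end FrameCalculus

/-! ### `d`-connections in coordinates -/

/-- Coefficients `(Γ^α_{μν}, Γ^a_{bν}, C^α_{μc}, C^a_{bc})` of a `d`-connection,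
as functions of `(x, y)`. -/
structure DConnection (n : ℕ) where
  hh : Fin n → Fin n → Fin n → Co n × Co n → ℝ
  vh : Fin n → Fin n → Fin n → Co n × Co n → ℝ
  hv : Fin n → Fin n → Fin n → Co n × Co n → ℝ
  vv : Fin n → Fin n → Fin n → Co n × Co n → ℝ

namespace DConnection

variable {n : ℕ} (D : DConnection n) (N : Co n × Co n → Fin n → Fin n → ℝ)

/-- `Λ^α_{μν}`. -/
def torHH (α μ ν : Fin n) (p : Co n × Co n) : ℝ := D.hh α μ ν p - D.hh α ν μ p

/-- `P^a_{μc} = ∂̇_c N^a_μ - Γ^a_{cμ}`. -/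
def torP (a μ c : Fin n) (p : Co n × Co n) : ℝ := pdy c (fun q => N q a μ) p - D.vh a c μ p

/-- `T^a_{bc}`. -/
def torVV (a b c : Fin n) (p : Co n × Co n) : ℝ := D.vv a b c p - D.vv a c b p

/-- Cartan type at `p`: `y^a_{|μ} = 0` and `y^a_{||c} = δ^a_c`. -/
def CartanAt (p : Co n × Co n) : Prop :=
  (∀ a μ, hd N μ (fun q => q.2 a) p + ∑ b, D.vh a b μ p * p.2 b = 0) ∧
  (∀ a c, pdy c (fun q => q.2 a) p + ∑ b, D.vv a b c p * p.2 b = if a = c then 1 else 0)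

/-- Berwald type at `p`: `∂̇_b N^a_μ = Γ^a_{bμ}` and `C^α_{μc} = 0`. -/
def BerwaldAt (p : Co n × Co n) : Prop :=
  (∀ a b μ, pdy b (fun q => N q a μ) p = D.vh a b μ p) ∧ (∀ α μ c, D.hv α μ c p = 0)

end DConnection

/-- Curvature of the nonlinear connection, `R^a_{μν} = δ_ν N^a_μ - δ_μ N^a_ν`. -/
def nlCurv {n : ℕ} (N : Co n × Co n → Fin n → Fin n → ℝ) (a μ ν : Fin n)
    (p : Co n × Co n) : ℝ :=
  hd N ν (fun q => N q a μ) p - hd N μ (fun q => N q a ν) p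

/-! ### An EAP-space in a chart -/

/-- The components `N^a_μ`, `λ_i^α` (horizontal) and `λ_i^a` (vertical) as functions of `(x, y)`. -/
structure LocalEAP (n : ℕ) where
  N : Co n × Co n → Fin n → Fin n → ℝ
  hFrame : Co n × Co n → Matrix (Fin n) (Fin n) ℝ
  vFrame : Co n × Co n → Matrix (Fin n) (Fin n) ℝ

namespace LocalEAP

variable {n : ℕ} (S : LocalEAP n)

/-- The horizontal geometry. -/
def hor : FrameCalculus n (Co n × Co n) := ⟨hd S.N, S.hFrame⟩

/-- The vertical geometry. -/
def ver : FrameCalculus n (Co n × Co n) := ⟨pdy, S.vFrame⟩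

/-- The canonical `d`-connection. -/
def canonical : DConnection n where
  hh := S.hor.Gam
  vh a b ν p := ∑ i, S.vFrame p i a * hd S.N ν (S.ver.co i b) p
  hv α μ c p := ∑ i, S.hFrame p i α * pdy c (S.hor.co i μ) p
  vv := S.ver.Gam

/-- The natural metric `d`-connection. -/
def natural : DConnection n where
  hh := S.hor.Gam0
  vh a b ν p := pdy b (fun q => S.N q a ν) p +
    1 / 2 * ∑ c, S.ver.gInv a c p * (hd S.N ν (S.ver.g b c) p
      - (∑ d, S.ver.g d c p * pdy b (fun q => S.N q d ν) p)
      - ∑ d, S.ver.g b d p * pdy c (fun q => S.N q d ν) p)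
  hv α μ c p := 1 / 2 * ∑ ε, S.hor.gInv α ε p * pdy c (S.hor.g μ ε) p
  vv := S.ver.Gam0

/-- The horizontal Lagrangian as a function of `λ_{iμ}`, `λ_{iμ,ν}` and `λ_{iμ;a}`;
it involves these through `δ_ν λ_{iμ} = λ_{iμ,ν} - N^a_ν λ_{iμ;a}`. -/
def horLagrangian (N : Fin n → Fin n → ℝ) (B' : Fin n → Fin n → Fin n → ℝ)
    (A : Matrix (Fin n) (Fin n) ℝ) (B : Fin n → Fin n → Fin n → ℝ) : ℝ :=
  lagrangian A (fun i μ ν => B i μ ν - ∑ a, N a ν * B' i μ a)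

/-- `λ_{iμ,ν}`. -/
def hcoX (p : Co n × Co n) (i μ ν : Fin n) : ℝ := pdx ν (S.hor.co i μ) p

/-- `λ_{iμ;a}`. -/
def hcoY (p : Co n × Co n) (i μ a : Fin n) : ℝ := pdy a (S.hor.co i μ) p

/-- The Euler-Lagrange expression `∂𝓗/∂λ_{jβ} - ∂/∂x^γ (∂𝓗/∂λ_{jβ,γ})` that gives the horizontal
field equations when the canonical connection is of Berwald type. -/
def horEL (j β : Fin n) (p : Co n × Co n) : ℝ :=
  dA (horLagrangian (S.N p) (S.hcoY p)) j β (S.hor.coMat p) (S.hcoX p)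
    - ∑ γ, pdx γ (fun q =>
        dB (horLagrangian (S.N q) (S.hcoY q)) j β γ (S.hor.coMat q) (S.hcoX q)) p

/-- The Euler-Lagrange expression `∂𝓥/∂λ_{jb} - ∂/∂y^e (∂𝓥/∂λ_{jb;e})` that gives the vertical
field equations. -/
def verEL (j b : Fin n) (p : Co n × Co n) : ℝ := S.ver.eulerLagrange j b p

end LocalEAP

/-! ### Manifolds, tangent bundles, charts -/

section Manifold

variable (n : ℕ) (M : Type*) [TopologicalSpace M] [ChartedSpace (Co n) M] [IsManifold (𝓡 n) ∞ M]

/-- The smooth charts of `M`. -/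
abbrev charts : Set (OpenPartialHomeomorph M (Co n)) := IsManifold.maximalAtlas (𝓡 n) ∞ M

variable {n M}

/-- The coordinates `(x, y)` that a chart of `M` induces on `TM`. -/
def tmCoord (e : OpenPartialHomeomorph M (Co n)) (u : TangentBundle (𝓡 n) M) : Co n × Co n :=
  (e u.proj, mfderiv (𝓡 n) (𝓡 n) e u.proj u.2)

/-- A tangent vector of the coordinate space, as an element of that space. -/
def vec {x : Co n} (v : TangentSpace (𝓡 n) x) : Co n := v

/-- The point of `TM` with coordinates `(x, y)`. -/
def tmPoint (e : OpenPartialHomeomorph M (Co n)) (p : Co n × Co n) : TangentBundle (𝓡 n) M :=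
  ⟨e.symm p.1, mfderiv (𝓡 n) (𝓡 n) e.symm p.1 p.2⟩

/-- The part of the coordinate space that corresponds to `dom ⊆ TM`. -/
def coordDom (dom : Set (TangentBundle (𝓡 n) M)) (e : OpenPartialHomeomorph M (Co n)) :
    Set (Co n × Co n) :=
  {p | p.1 ∈ e.target ∧ tmPoint e p ∈ dom}

/-- `jac e e' z a' a = ∂x^{a'}/∂x^a` at the point with `e`-coordinates `z`; the coordinates
`x^{a'}` are those of `e'`. -/
def jac (e e' : OpenPartialHomeomorph M (Co n)) (z : Co n) (a' a : Fin n) : ℝ :=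
  pd a (fun w => e' (e.symm w) a') z

/-- A nonlinear connection on `dom ⊆ TM`, given by its coefficients in the charts of `M`:
`coeff e p a μ` is `N^a_μ` at the point with `e`-coordinates `p = (x, y)`. -/
structure NonlinearConnection (dom : Set (TangentBundle (𝓡 n) M)) where
  coeff : OpenPartialHomeomorph M (Co n) → Co n × Co n → Fin n → Fin n → ℝ
  smooth : ∀ e ∈ charts n M, ∀ a μ, ContDiffOn ℝ ∞ (fun p => coeff e p a μ) (coordDom dom e)
  transform : ∀ e ∈ charts n M, ∀ e' ∈ charts n M, ∀ u ∈ dom,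
    u.proj ∈ e.source → u.proj ∈ e'.source → ∀ a' μ',
    coeff e' (tmCoord e' u) a' μ' =
      (∑ a, ∑ μ, jac e e' (e u.proj) a' a * jac e' e (e' u.proj) μ μ' *
        coeff e (tmCoord e u) a μ) +
      ∑ a, ∑ c', jac e e' (e u.proj) a' a *
        pd μ' (fun w => jac e' e w a c') (e' u.proj) * (tmCoord e' u).2 c'

/-- Horizontal components `λ_i^α = dx^α(λ_i)` of vector fields `λ_1, …, λ_n` on `TM`. -/
def hComp (lam : Fin n → (u : TangentBundle (𝓡 n) M) → TangentSpace (𝓡 n).tangent u)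
    (e : OpenPartialHomeomorph M (Co n)) (p : Co n × Co n) : Matrix (Fin n) (Fin n) ℝ :=
  Matrix.of fun i α =>
    (mfderiv (𝓡 n).tangent 𝓘(ℝ, Co n × Co n) (tmCoord e) (tmPoint e p)
      (lam i (tmPoint e p)) : Co n × Co n).1 α

/-- Vertical components `λ_i^a = δy^a(λ_i)`, with `δy^a = dy^a + N^a_α dx^α`. -/
def vComp (lam : Fin n → (u : TangentBundle (𝓡 n) M) → TangentSpace (𝓡 n).tangent u)
    (N : Co n × Co n → Fin n → Fin n → ℝ)
    (e : OpenPartialHomeomorph M (Co n)) (p : Co n × Co n) : Matrix (Fin n) (Fin n) ℝ :=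
  Matrix.of fun i a =>
    (mfderiv (𝓡 n).tangent 𝓘(ℝ, Co n × Co n) (tmCoord e) (tmPoint e p)
      (lam i (tmPoint e p)) : Co n × Co n).2 a + ∑ α, N p a α * hComp lam e p i α

variable (n M)

/-- An EAP-space: a nonlinear connection and `n` smooth vector fields on `TM` whose horizontal
parts, and whose vertical parts, are linearly independent. The objects live on an open subset `dom`
of `TM` that meets every tangent space in a non-empty connected set: on `TM` itself or,
if the zero section is to be left out, on the slit tangent bundle (`n ≥ 2`). -/
structure EAPSpace where
  dom : Set (TangentBundle (𝓡 n) M)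
  isOpen_dom : IsOpen dom
  isConnected_fibre : ∀ x : M,
    IsConnected {v : TangentSpace (𝓡 n) x | (⟨x, v⟩ : TangentBundle (𝓡 n) M) ∈ dom}
  nlc : NonlinearConnection dom
  lam : Fin n → (u : TangentBundle (𝓡 n) M) → TangentSpace (𝓡 n).tangent u
  smooth_lam : ∀ i, ContMDiffOn (𝓡 n).tangent (𝓡 n).tangent.tangent ∞
    (fun u => (⟨u, lam i u⟩ : TangentBundle (𝓡 n).tangent (TangentBundle (𝓡 n) M))) dom
  indep_hor : ∀ e ∈ charts n M, ∀ p ∈ coordDom dom e, LinearIndependent ℝ (hComp lam e p).row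
  indep_ver : ∀ e ∈ charts n M, ∀ p ∈ coordDom dom e,
    LinearIndependent ℝ (vComp lam (nlc.coeff e) e p).row

/-- A conventional AP-space: `n` smooth vector fields on `M`, linearly independent everywhere. -/
structure APSpace where
  lam : Fin n → (x : M) → TangentSpace (𝓡 n) x
  smooth_lam : ∀ i, ContMDiff (𝓡 n) (𝓡 n).tangent ∞
    (fun x => (⟨x, lam i x⟩ : TangentBundle (𝓡 n) M))
  indep : ∀ x, LinearIndependent ℝ (fun i => lam i x)

variable {n M}

namespace EAPSpace

variable (S : EAPSpace n M)

/-- The EAP-space in the chart `e`. -/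
def loc (e : OpenPartialHomeomorph M (Co n)) : LocalEAP n where
  N := S.nlc.coeff e
  hFrame := hComp S.lam e
  vFrame := vComp S.lam (S.nlc.coeff e) e

/-- The canonical `d`-connection is of Cartan type. -/
def IsCartanType : Prop :=
  ∀ e ∈ charts n M, ∀ p ∈ coordDom S.dom e, (S.loc e).canonical.CartanAt (S.loc e).N p

/-- The canonical `d`-connection is of Berwald type. -/
def IsBerwaldType : Prop :=
  ∀ e ∈ charts n M, ∀ p ∈ coordDom S.dom e, (S.loc e).canonical.BerwaldAt (S.loc e).N p

/-- The horizontal field equations (in the Berwald-type case). -/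
def HorizontalFieldEquations : Prop :=
  ∀ e ∈ charts n M, ∀ p ∈ coordDom S.dom e, ∀ j β, (S.loc e).horEL j β p = 0

end EAPSpace

namespace APSpace

variable (A : APSpace n M)

/-- The AP-geometry in the chart `e`. -/
def loc (e : OpenPartialHomeomorph M (Co n)) : FrameCalculus n (Co n) where
  d := pd
  frame x := Matrix.of fun i α =>
    vec (mfderiv (𝓡 n) (𝓡 n) e (e.symm x) (A.lam i (e.symm x))) α

/-- The field equations of the generalized field theory of Mikhail and Wanas. -/
def GFTFieldEquations : Prop :=
  ∀ e ∈ charts n M, ∀ x ∈ e.target, ∀ j β, (A.loc e).eulerLagrange j β x = 0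

end APSpace

end Manifold

end EAP

end

/-! Everything vertical rests on the functions $f_i=y^b\lambda_{ib}$. The second Cartan condition
says $C^a_{bc}y^b=0$; stripping off the invertible $\lambda_i^a$ leaves
$y^b\dot\partial_c\lambda_{ib}=0$, so $\dot\partial_cf_i=\lambda_{ic}$. The vertical covectors are
thus gradients along the fibres, and symmetry of second derivatives makes the canonical vertical
connection symmetric. Being metric as well, it is the Levi-Civita connection: torsion, contortion
and all that is built from them vanish, and so do the Euler–Lagrange expressions, the Lagrangian
being quadratic in the torsion (`ver_isClosedOn`, `IsClosedOn`). The first Cartan condition gives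
$\delta_\mu f_i=\lambda_{ia}\,y^a{}_{|\mu}=0$; applying
$[\delta_\nu,\delta_\mu]=-R^a_{\mu\nu}\dot\partial_a$ to $f_i$ yields $R^a_{\mu\nu}\lambda_{ia}=0$,
that is, $R=0$ (`hd_hd`, `nlCurv_eq_zero`).

The Berwald conditions give $P=0$ at once and, by metricity, $\gamma^a_{b\mu}=0$. They also give
$\dot\partial_c\lambda_{i\mu}=0$; as the fibres of $\mathcal D$ are connected, the horizontal frame
depends on $x$ only and descends to a smooth frame on $M$ (`hComp_fibre`, `mfderiv_proj_lam`,
`contMDiff_baseFrame`). On functions of $x$ the operator $\delta_\mu$ is $\partial_\mu$, so every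
horizontal object equals its counterpart on $M$, including the variational expression (`ProjectsTo`,
`horEL_eq`).

What remains is to compute the Euler–Lagrange expression on $M$. In components $t_{abc}$ of the
torsion with respect to the frame, the Lagrangian is $|\lambda|$ times a quadratic form in $t$ with
constant coefficients (`lagrangian_eq`). Covariant derivatives of the canonical connection are plain
derivatives of frame components, since the frame is parallel. With
$\partial_\gamma(|\lambda|\lambda_c^\gamma)=-|\lambda|c_c$ the variation takes the form `elF`, while
$E_{\mu\nu}$ has frame components `eF`; the two differ by twice the contracted Bianchi identity,
which expresses $d(d\lambda_a)=0$ (`bianchi`, `elF_eq_eF`). -/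

noncomputable section

namespace EAP

/-! ### Derivatives of determinants and inverses along a curve of matrices -/

section MatrixCalculus

variable {n : ℕ}

/-- Jacobi's formula for the derivative of a determinant. -/
theorem hasDerivAt_det {M : ℝ → Matrix (Fin n) (Fin n) ℝ} {M' : Matrix (Fin n) (Fin n) ℝ} {s : ℝ}
    (hM : ∀ i j, HasDerivAt (fun t => M t i j) (M' i j) s) :
    HasDerivAt (fun t => (M t).det) (∑ i, ∑ k, (M s).adjugate i k * M' k i) s := by
  have h1 : HasDerivAt (fun t => (M t).det)
      (∑ σ : Equiv.Perm (Fin n), (Equiv.Perm.sign σ : ℤ) *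
        ∑ i, (∏ j ∈ Finset.univ.erase i, M s (σ j) j) • M' (σ i) i) s := by
    simp only [Matrix.det_apply']
    refine HasDerivAt.fun_sum fun σ _ => ?_
    exact (HasDerivAt.fun_finsetProd fun i _ => hM (σ i) i).const_mul _
  convert h1 using 1
  -- By Cramer's rule the pairing with the adjugate is the determinant with one column
  -- differentiated, which is what the product rule gives permutation by permutation.
  have h2 : ∀ i, ∑ k, (M s).adjugate i k * M' k i = ((M s).updateCol i (fun k => M' k i)).det := by
    intro i
    rw [← Matrix.cramer_apply, Matrix.cramer_eq_adjugate_mulVec]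
    rfl
  simp only [h2, Matrix.det_apply', Finset.mul_sum]
  rw [Finset.sum_comm]
  refine Finset.sum_congr rfl fun σ _ => Finset.sum_congr rfl fun i _ => ?_
  rw [← Finset.mul_prod_erase Finset.univ _ (Finset.mem_univ i)]
  simp only [Matrix.updateCol_self, smul_eq_mul]
  rw [Finset.prod_congr rfl (g := fun j => M s (σ j) j)]
  · ring
  · intro j hj
    rw [Matrix.updateCol_ne (Finset.ne_of_mem_erase hj)]

theorem hasDerivAt_det_of_isUnit {M : ℝ → Matrix (Fin n) (Fin n) ℝ}
    {M' : Matrix (Fin n) (Fin n) ℝ} {s : ℝ}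
    (hM : ∀ i j, HasDerivAt (fun t => M t i j) (M' i j) s) (hu : (M s).det ≠ 0) :
    HasDerivAt (fun t => (M t).det) ((M s).det * ∑ i, ∑ k, (M s)⁻¹ i k * M' k i) s := by
  convert hasDerivAt_det hM using 1
  simp only [Matrix.inv_def, Ring.inverse_eq_inv', Matrix.smul_apply, smul_eq_mul, Finset.mul_sum]
  refine Finset.sum_congr rfl fun i _ => Finset.sum_congr rfl fun k _ => ?_
  field_simp

/-- Entries of the inverse are cofactors divided by the determinant, and a cofactor is itself a
determinant with one constant row. This is needed before the product rule may be applied to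
$M^{-1}M=1$. -/
theorem differentiableAt_inv {M : ℝ → Matrix (Fin n) (Fin n) ℝ} {s : ℝ}
    (hM : ∀ i j, DifferentiableAt ℝ (fun t => M t i j) s) (hu : (M s).det ≠ 0) (i j : Fin n) :
    DifferentiableAt ℝ (fun t => (M t)⁻¹ i j) s := by
  have hd : ∀ N : ℝ → Matrix (Fin n) (Fin n) ℝ, (∀ i j, DifferentiableAt ℝ (fun t => N t i j) s) →
      DifferentiableAt ℝ (fun t => (N t).det) s := fun N hN =>
    (hasDerivAt_det (M' := Matrix.of fun i j => deriv (fun t => N t i j) s)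
      fun i j => (hN i j).hasDerivAt).differentiableAt
  simp only [Matrix.inv_def, Ring.inverse_eq_inv', Matrix.smul_apply, smul_eq_mul,
    Matrix.adjugate_apply]
  refine ((hd M hM).inv hu).mul (hd _ fun k l => ?_)
  by_cases hk : k = j
  · subst hk; simp
  · simpa [Matrix.updateRow_ne hk] using hM k l

theorem hasDerivAt_inv {M : ℝ → Matrix (Fin n) (Fin n) ℝ}
    {M' : Matrix (Fin n) (Fin n) ℝ} {s : ℝ}
    (hM : ∀ i j, HasDerivAt (fun t => M t i j) (M' i j) s) (hu : (M s).det ≠ 0) (i j : Fin n) :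
    HasDerivAt (fun t => (M t)⁻¹ i j) (-((M s)⁻¹ * M' * (M s)⁻¹) i j) s := by
  have hdiff := differentiableAt_inv (fun i j => (hM i j).differentiableAt) hu
  set P : Matrix (Fin n) (Fin n) ℝ := Matrix.of fun i j => deriv (fun t => (M t)⁻¹ i j) s with hP
  have hPd : ∀ i j, HasDerivAt (fun t => (M t)⁻¹ i j) (P i j) s :=
    fun i j => (hdiff i j).hasDerivAt
  have hcont : ∀ᶠ t in nhds s, (M t).det ≠ 0 :=
    (hasDerivAt_det hM).continuousAt.eventually_ne hu
  -- Differentiate $M^{-1}M=1$, an identity available only near $s$, where the determinant stays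
  -- nonzero.
  have key : P * M s + (M s)⁻¹ * M' = 0 := by
    ext k l
    have h1 : HasDerivAt (fun t => ((M t)⁻¹ * M t) k l) ((P * M s + (M s)⁻¹ * M') k l) s := by
      simp only [Matrix.mul_apply, Matrix.add_apply, ← Finset.sum_add_distrib]
      exact HasDerivAt.fun_sum fun m _ => (hPd k m).mul (hM m l)
    have h2 : HasDerivAt (fun t => ((M t)⁻¹ * M t) k l) 0 s := by
      refine (hasDerivAt_const s ((1 : Matrix (Fin n) (Fin n) ℝ) k l)).congr_of_eventuallyEq ?_
      filter_upwards [hcont] with t ht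
      rw [Matrix.nonsing_inv_mul _ (isUnit_iff_ne_zero.2 ht)]
    exact h1.unique h2
  have hu' : IsUnit (M s).det := isUnit_iff_ne_zero.2 hu
  have : P = -((M s)⁻¹ * M' * (M s)⁻¹) := by
    have := congrArg (· * (M s)⁻¹) (eq_neg_of_add_eq_zero_left key)
    simpa [Matrix.mul_assoc, Matrix.mul_nonsing_inv _ hu'] using this
  rw [← Matrix.neg_apply, ← this]
  exact hPd i j

end MatrixCalculus

/-! ### The Lagrangian in frame components -/

section Jet

variable {n : ℕ}

/-- Frame components `t_{abc}` of the torsion. -/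
def jetT (A : Matrix (Fin n) (Fin n) ℝ) (B : Fin n → Fin n → Fin n → ℝ) (a b c : Fin n) : ℝ :=
  ∑ μ, ∑ ν, A⁻¹ μ b * A⁻¹ ν c * (B a μ ν - B a ν μ)

/-- Trace `c_b = t_{aba}`. -/
def trT (t : Fin n → Fin n → Fin n → ℝ) (b : Fin n) : ℝ := ∑ a, t a b a

/-- `t_{aec} t_{eac} - c_c c_c`. -/
def quadT (t : Fin n → Fin n → Fin n → ℝ) : ℝ :=
  (∑ a, ∑ e, ∑ c, t a e c * t e a c) - ∑ c, trT t c * trT t c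

/-- The derivative of the Lagrangian with respect to the frame components of the derivatives of the
covectors is twice `w_{bcj} = t_{bjc} - t_{cjb} - c_b δ_{cj} + c_c δ_{bj}`. -/
def momT (t : Fin n → Fin n → Fin n → ℝ) (b c j : Fin n) : ℝ :=
  t b j c - t c j b - (if c = j then trT t b else 0) + (if b = j then trT t c else 0)

theorem jetT_antisymm (A : Matrix (Fin n) (Fin n) ℝ) (B : Fin n → Fin n → Fin n → ℝ)
    (a b c : Fin n) : jetT A B a c b = -jetT A B a b c := by
  unfold jetT
  rw [Finset.sum_comm, ← Finset.sum_neg_distrib]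
  refine Finset.sum_congr rfl fun μ _ => ?_
  rw [← Finset.sum_neg_distrib]
  exact Finset.sum_congr rfl fun ν _ => by ring

/-- A quadratic form has as derivative twice its polar form; exchanging the summation indices $a$
and $e$ shows that the bilinear form is symmetric. -/
theorem hasDerivAt_quadT {t : ℝ → Fin n → Fin n → Fin n → ℝ} {t' : Fin n → Fin n → Fin n → ℝ}
    {s : ℝ} (ht : ∀ a b c, HasDerivAt (fun r => t r a b c) (t' a b c) s) :
    HasDerivAt (fun r => quadT (t r))
      (2 * (∑ a, ∑ e, ∑ c, t' a e c * t s e a c) - 2 * ∑ c, trT t' c * trT (t s) c) s := by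
  have hc : ∀ b, HasDerivAt (fun r => trT (t r) b) (trT t' b) s := fun b =>
    HasDerivAt.fun_sum fun a _ => ht a b a
  have h1 : HasDerivAt (fun r => ∑ a, ∑ e, ∑ c, t r a e c * t r e a c)
      (∑ a, ∑ e, ∑ c, (t' a e c * t s e a c + t s a e c * t' e a c)) s :=
    HasDerivAt.fun_sum fun a _ => HasDerivAt.fun_sum fun e _ => HasDerivAt.fun_sum fun c _ =>
      (ht a e c).mul (ht e a c)
  have h2 : HasDerivAt (fun r => ∑ c, trT (t r) c * trT (t r) c)
      (∑ c, (trT t' c * trT (t s) c + trT (t s) c * trT t' c)) s :=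
    HasDerivAt.fun_sum fun c _ => (hc c).mul (hc c)
  refine (h1.sub h2).congr_deriv ?_
  simp only [Finset.sum_add_distrib]
  have h3 : ∑ a, ∑ e, ∑ c, t s a e c * t' e a c = ∑ a, ∑ e, ∑ c, t' a e c * t s e a c := by
    rw [Finset.sum_comm]
    simp only [mul_comm]
  rw [h3]
  simp only [mul_comm (trT (t s) _)]
  ring

theorem jetTor_eq (A : Matrix (Fin n) (Fin n) ℝ) (B : Fin n → Fin n → Fin n → ℝ)
    (α μ ν : Fin n) : jetTor A B α μ ν = ∑ a, A⁻¹ α a * (B a μ ν - B a ν μ) := by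
  simp only [jetTor, jetGam, mul_sub, Finset.sum_sub_distrib]

end Jet

/-! ### Contractions in terms of frame components -/

section Contractions

variable {n : ℕ} {A : Matrix (Fin n) (Fin n) ℝ}

theorem sum_inv_mul (hA : A.det ≠ 0) (α β : Fin n) :
    ∑ i, A⁻¹ α i * A i β = if α = β then 1 else 0 := by
  rw [← Matrix.mul_apply, Matrix.nonsing_inv_mul _ (isUnit_iff_ne_zero.2 hA), Matrix.one_apply]

theorem sum_mul_inv (hA : A.det ≠ 0) (i j : Fin n) :
    ∑ α, A i α * A⁻¹ α j = if i = j then 1 else 0 := by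
  rw [← Matrix.mul_apply, Matrix.mul_nonsing_inv _ (isUnit_iff_ne_zero.2 hA), Matrix.one_apply]

/-- A covector is recovered from its frame components; `sum_sum_inv` is the converse passage. -/
theorem sum_inv_sum (hA : A.det ≠ 0) (f : Fin n → ℝ) (μ : Fin n) :
    ∑ b, A b μ * ∑ ν, A⁻¹ ν b * f ν = f μ := by
  simp only [Finset.mul_sum]
  rw [Finset.sum_comm]
  have : ∀ ν, ∑ b, A b μ * (A⁻¹ ν b * f ν) = if ν = μ then f ν else 0 := by
    intro ν
    rw [← one_mul (f ν), ← ite_zero_mul, ← sum_inv_mul hA, Finset.sum_mul]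
    exact Finset.sum_congr rfl fun b _ => by ring
  simp [this]

theorem sum_sum_inv (hA : A.det ≠ 0) (f : Fin n → ℝ) (b : Fin n) :
    ∑ ν, A⁻¹ ν b * ∑ c, A c ν * f c = f b := by
  simp only [Finset.mul_sum]
  rw [Finset.sum_comm]
  have : ∀ c, ∑ ν, A⁻¹ ν b * (A c ν * f c) = if c = b then f c else 0 := by
    intro c
    rw [← one_mul (f c), ← ite_zero_mul, ← sum_mul_inv hA, Finset.sum_mul]
    exact Finset.sum_congr rfl fun b _ => by ring
  simp [this]

/-- Contraction of a covector and a vector given by their frame components. -/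
theorem sum_pairing (hA : A.det ≠ 0) (u v : Fin n → ℝ) :
    ∑ α, (∑ a, A⁻¹ α a * u a) * ∑ c, A c α * v c = ∑ a, u a * v a := by
  simp only [Finset.sum_mul]
  rw [Finset.sum_comm]
  refine Finset.sum_congr rfl fun a _ => ?_
  rw [← sum_sum_inv hA v a, Finset.mul_sum]
  exact Finset.sum_congr rfl fun b _ => by ring

/-- Contraction with the inverse metric, in frame components. -/
theorem sum_gInv (hA : A.det ≠ 0) (f : Fin n → ℝ) (μ : Fin n) :
    ∑ ν, (∑ i, A⁻¹ μ i * A⁻¹ ν i) * ∑ c, A c ν * f c = ∑ b, A⁻¹ μ b * f b := by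
  simp only [Finset.sum_mul]
  rw [Finset.sum_comm]
  refine Finset.sum_congr rfl fun i _ => ?_
  rw [← sum_sum_inv hA f i, Finset.mul_sum]
  exact Finset.sum_congr rfl fun b _ => by ring

/-- Contraction with the metric, in frame components. -/
theorem sum_g (hA : A.det ≠ 0) (f : Fin n → ℝ) (μ : Fin n) :
    ∑ ν, (∑ i, A i μ * A i ν) * ∑ c, A⁻¹ ν c * f c = ∑ b, A b μ * f b := by
  simp only [Finset.sum_mul]
  rw [Finset.sum_comm]
  refine Finset.sum_congr rfl fun i _ => ?_
  have : f i = ∑ ν, A i ν * ∑ c, A⁻¹ ν c * f c := by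
    simp only [Finset.mul_sum]
    rw [Finset.sum_comm]
    simp only [← mul_assoc, ← Finset.sum_mul, sum_mul_inv hA]
    simp
  rw [this, Finset.mul_sum]
  exact Finset.sum_congr rfl fun b _ => by ring

/-- The frame is orthonormal for $g$, so a metric trace is the sum of the diagonal frame components.
-/
theorem sum_gInv_two (hA : A.det ≠ 0) (f : Fin n → Fin n → ℝ) :
    ∑ μ, ∑ ν, (∑ i, A⁻¹ μ i * A⁻¹ ν i) * (∑ c, A c μ * ∑ d, A d ν * f c d) = ∑ c, f c c := by
  have : ∀ μ ν, ∑ c, A c μ * ∑ d, A d ν * f c d = ∑ d, A d ν * ∑ c, A c μ * f c d := by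
    intro μ ν
    simp only [Finset.mul_sum]
    rw [Finset.sum_comm]
    exact Finset.sum_congr rfl fun _ _ => Finset.sum_congr rfl fun _ _ => by ring
  simp only [this, sum_gInv hA]
  rw [Finset.sum_comm]
  exact Finset.sum_congr rfl fun b _ => sum_sum_inv hA _ b

end Contractions

/-! ### The torsion, its quadratic expressions and the Lagrangian through $t_{abc}$ -/

section Jet

variable {n : ℕ} {A : Matrix (Fin n) (Fin n) ℝ} {B : Fin n → Fin n → Fin n → ℝ}

/-- Frame components of `H_{μν}`. -/
def hT (t : Fin n → Fin n → Fin n → ℝ) (c d : Fin n) : ℝ :=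
  (∑ a, ∑ e, t a e c * t e a d) - trT t c * trT t d

theorem quadT_eq (t : Fin n → Fin n → Fin n → ℝ) : quadT t = ∑ c, hT t c c := by
  simp only [quadT, hT, Finset.sum_sub_distrib]
  congr 1
  rw [Finset.sum_comm_cycle]

theorem sub_eq_jetT (hA : A.det ≠ 0) (a μ ν : Fin n) :
    B a μ ν - B a ν μ = ∑ b, A b μ * ∑ c, A c ν * jetT A B a b c := by
  rw [← sum_inv_sum hA (fun μ => B a μ ν - B a ν μ) μ]
  refine Finset.sum_congr rfl fun b _ => congrArg _ ?_
  rw [← sum_inv_sum hA (fun ν => ∑ κ, A⁻¹ κ b * (B a κ ν - B a ν κ)) ν]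
  refine Finset.sum_congr rfl fun c _ => congrArg _ ?_
  simp only [jetT, Finset.mul_sum]
  rw [Finset.sum_comm]
  exact Finset.sum_congr rfl fun _ _ => Finset.sum_congr rfl fun _ _ => by ring

theorem jetTor_eq_jetT (hA : A.det ≠ 0) (α μ ν : Fin n) :
    jetTor A B α μ ν = ∑ a, A⁻¹ α a * ∑ b, A b μ * ∑ c, A c ν * jetT A B a b c := by
  simp only [jetTor_eq, sub_eq_jetT hA]

theorem jetC_eq (hA : A.det ≠ 0) (μ : Fin n) :
    jetC A B μ = ∑ b, A b μ * trT (jetT A B) b := by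
  simp only [jetC, jetTor_eq_jetT hA, trT]
  have : ∀ a ν, ∑ b, A b μ * ∑ c, A c ν * jetT A B a b c
      = ∑ c, A c ν * ∑ b, A b μ * jetT A B a b c := by
    intro a ν
    simp only [Finset.mul_sum]
    rw [Finset.sum_comm]
    exact Finset.sum_congr rfl fun _ _ => Finset.sum_congr rfl fun _ _ => by ring
  simp only [this]
  rw [Finset.sum_comm]
  simp only [sum_sum_inv hA]
  rw [Finset.sum_comm]
  simp only [Finset.mul_sum]

theorem jetH_eq (hA : A.det ≠ 0) (μ ν : Fin n) :
    jetH A B μ ν = ∑ c, A c μ * ∑ d, A d ν * hT (jetT A B) c d := by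
  have h1 : ∑ α, ∑ ε, jetTor A B α ε μ * jetTor A B ε α ν
      = ∑ c, A c μ * ∑ d, A d ν * ∑ a, ∑ e, jetT A B a e c * jetT A B e a d := by
    -- With the last index fixed, the torsion is a matrix $A^{-1}T_\kappa A$. The quadratic term is
    -- a trace of a product of two such matrices, and the conjugation by $A$ drops out.
    let T : Fin n → Matrix (Fin n) (Fin n) ℝ := fun μ =>
      Matrix.of fun a b => ∑ c, A c μ * jetT A B a b c
    have hN : ∀ κ, (Matrix.of fun α ε => jetTor A B α ε κ) = A⁻¹ * T κ * A := by
      intro κ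
      ext α ε
      rw [Matrix.mul_assoc, Matrix.mul_apply]
      simp only [Matrix.of_apply, jetTor_eq_jetT hA, Matrix.mul_apply, T]
      exact Finset.sum_congr rfl fun _ _ => congrArg _ <|
        Finset.sum_congr rfl fun _ _ => mul_comm _ _
    have h2 : ∑ α, ∑ ε, jetTor A B α ε μ * jetTor A B ε α ν
        = Matrix.trace ((Matrix.of fun α ε => jetTor A B α ε μ) *
            (Matrix.of fun α ε => jetTor A B α ε ν)) := by
      simp [Matrix.trace, Matrix.mul_apply]
    have h3 : A⁻¹ * T μ * A * (A⁻¹ * T ν * A) = A⁻¹ * (T μ * T ν * A) := by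
      have h4 : A * A⁻¹ = 1 := Matrix.mul_nonsing_inv _ (isUnit_iff_ne_zero.2 hA)
      calc A⁻¹ * T μ * A * (A⁻¹ * T ν * A) = A⁻¹ * T μ * (A * A⁻¹) * T ν * A := by noncomm_ring
        _ = _ := by rw [h4]; noncomm_ring
    rw [h2, hN, hN, h3, Matrix.trace_mul_comm, Matrix.mul_assoc,
      Matrix.mul_nonsing_inv _ (isUnit_iff_ne_zero.2 hA), Matrix.mul_one]
    simp only [Matrix.trace, Matrix.diag_apply, Matrix.mul_apply, T, Matrix.of_apply,
      Finset.sum_mul_sum]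
    simp only [Finset.mul_sum]
    refine (Finset.sum_congr rfl fun a _ => Finset.sum_comm).trans (Finset.sum_comm.trans ?_)
    refine Finset.sum_congr rfl fun c _ => ?_
    refine (Finset.sum_congr rfl fun a _ => Finset.sum_comm).trans (Finset.sum_comm.trans ?_)
    exact Finset.sum_congr rfl fun _ _ => Finset.sum_congr rfl fun _ _ =>
      Finset.sum_congr rfl fun _ _ => by ring
  rw [jetH, h1, jetC_eq hA, jetC_eq hA, Finset.sum_mul, ← Finset.sum_sub_distrib]
  refine Finset.sum_congr rfl fun c _ => ?_
  rw [mul_assoc, ← mul_sub, Finset.mul_sum, ← Finset.sum_sub_distrib]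
  refine congrArg _ (Finset.sum_congr rfl fun d _ => ?_)
  rw [hT]
  ring

/-- All metric factors are absorbed by the orthonormal frame. Hence the covectors enter only through
the determinant and $t$, and their derivatives only through $t$. -/
theorem lagrangian_eq (hA : A.det ≠ 0) : lagrangian A B = A.det * quadT (jetT A B) := by
  rw [lagrangian, quadT_eq]
  simp only [jetH_eq hA, sum_gInv_two hA]

end Jet

/-! ### Partial derivatives of the Lagrangian -/

section JetDerivatives

variable {n : ℕ} {A : Matrix (Fin n) (Fin n) ℝ}

/-- The frame components of `∂L/∂λ_{jβ}`. -/
def forceT (t : Fin n → Fin n → Fin n → ℝ) (b j : Fin n) : ℝ :=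
  (if b = j then quadT t else 0) - 2 * (∑ a, ∑ c, t b a c * t a j c)
    - 2 * (∑ e, ∑ a, t e a b * t a e j) + 2 * (trT t b * trT t j) + 2 * ∑ a, trT t a * t b a j

/-- With $B$ fixed, varying $\lambda_{j\beta}$ changes $|\lambda|$ by $|\lambda|\lambda_j^\beta$
and, through the two inverse matrices in $t$, changes $t_{abc}$ by $-\lambda_b^\beta
t_{ajc}-\lambda_c^\beta t_{abj}$. The polar form of `quadT` then collects the terms of `forceT`. -/
theorem dA_lagrangian (hA : A.det ≠ 0) (B : Fin n → Fin n → Fin n → ℝ) (j β : Fin n) :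
    dA lagrangian j β A B = A.det * ∑ b, A⁻¹ β b * forceT (jetT A B) b j := by
  set t := jetT A B with ht
  set M : ℝ → Matrix (Fin n) (Fin n) ℝ := fun s => A + s • Matrix.single j β 1 with hM
  have hM0 : M 0 = A := by simp [hM]
  have hMd : ∀ k l, HasDerivAt (fun s => M s k l) (Matrix.single j β (1 : ℝ) k l) 0 := by
    intro k l
    simp only [hM, Matrix.add_apply, Matrix.smul_apply, smul_eq_mul]
    simpa using ((hasDerivAt_id (0 : ℝ)).mul_const (Matrix.single j β (1 : ℝ) k l)).const_add (A k l)
  have hdet := hasDerivAt_det_of_isUnit hMd (by rwa [hM0])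
  have hinv := fun k l => hasDerivAt_inv hMd (by rwa [hM0]) k l
  rw [hM0] at hdet
  simp only [hM0] at hinv
  have hsum : ∑ i, ∑ k, A⁻¹ i k * Matrix.single j β (1 : ℝ) k i = A⁻¹ β j := by
    rw [Finset.sum_eq_single β, Finset.sum_eq_single j] <;> simp +contextual [Matrix.single_apply, eq_comm]
  have hsing : ∀ k l, (A⁻¹ * Matrix.single j β (1 : ℝ) * A⁻¹) k l = A⁻¹ k j * A⁻¹ β l := by
    intro k l
    rw [Matrix.mul_assoc, Matrix.mul_apply, Finset.sum_eq_single j]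
    · simp
    · intro b _ hb
      simp [Matrix.single_mul_apply_of_ne _ _ _ _ _ hb]
    · simp
  rw [hsum] at hdet
  simp only [hsing] at hinv
  have hT : ∀ a b c, HasDerivAt (fun s => jetT (M s) B a b c)
      (-(A⁻¹ β b * t a j c) - A⁻¹ β c * t a b j) 0 := by
    intro a b c
    have h1 : HasDerivAt (fun s => jetT (M s) B a b c)
        (∑ μ, ∑ ν, (-(A⁻¹ μ j * A⁻¹ β b) * A⁻¹ ν c + A⁻¹ μ b * -(A⁻¹ ν j * A⁻¹ β c))
          * (B a μ ν - B a ν μ)) 0 := by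
      refine HasDerivAt.fun_sum fun μ _ => HasDerivAt.fun_sum fun ν _ => ?_
      have := ((hinv μ b).mul (hinv ν c)).mul_const (B a μ ν - B a ν μ)
      rwa [hM0] at this
    refine h1.congr_deriv ?_
    simp only [ht, jetT, Finset.mul_sum, ← Finset.sum_neg_distrib, ← Finset.sum_sub_distrib]
    exact Finset.sum_congr rfl fun _ _ => Finset.sum_congr rfl fun _ _ => by ring
  have hQ := hasDerivAt_quadT hT
  have hL := hdet.mul hQ
  -- The frame form of the Lagrangian needs an invertible matrix, so it is used only for small $s$.
  have hev : ∀ᶠ s in nhds (0 : ℝ), lagrangian (M s) B = (M s).det * quadT (jetT (M s) B) := by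
    have : ∀ᶠ s in nhds (0 : ℝ), (M s).det ≠ 0 :=
      hdet.continuousAt.eventually_ne (by rwa [hM0])
    filter_upwards [this] with s hs using lagrangian_eq hs
  rw [dA, (hL.congr_of_eventuallyEq hev).deriv, hM0, ← ht, mul_assoc, ← mul_add]
  congr 1
  have htr : ∀ b, trT (fun a b c => -(A⁻¹ β b * t a j c) - A⁻¹ β c * t a b j) b
      = -(A⁻¹ β b * trT t j) - ∑ a, A⁻¹ β a * t a b j := by
    intro b
    simp only [trT, Finset.sum_sub_distrib, Finset.sum_neg_distrib, Finset.mul_sum]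
  have e1 : ∑ a, ∑ e, ∑ c, (-(A⁻¹ β e * t a j c) - A⁻¹ β c * t a e j) * t e a c
      = -(∑ b, A⁻¹ β b * ∑ a, ∑ c, t b a c * t a j c)
        - ∑ b, A⁻¹ β b * ∑ e, ∑ a, t e a b * t a e j := by
    simp only [sub_mul, Finset.sum_sub_distrib, neg_mul, Finset.sum_neg_distrib, Finset.mul_sum]
    congr 1
    · rw [Finset.sum_comm]
      exact congrArg _ <| Finset.sum_congr rfl fun _ _ => Finset.sum_congr rfl fun _ _ =>
        Finset.sum_congr rfl fun _ _ => by ring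
    · rw [Finset.sum_comm]
      refine (Finset.sum_congr rfl fun a _ => Finset.sum_comm).trans (Finset.sum_comm.trans ?_)
      exact Finset.sum_congr rfl fun _ _ => Finset.sum_congr rfl fun _ _ =>
        Finset.sum_congr rfl fun _ _ => by ring
  have e2 : ∑ c, (-(A⁻¹ β c * trT t j) - ∑ a, A⁻¹ β a * t a c j) * trT t c
      = -(∑ b, A⁻¹ β b * (trT t b * trT t j)) - ∑ b, A⁻¹ β b * ∑ a, trT t a * t b a j := by
    simp only [sub_mul, Finset.sum_sub_distrib, neg_mul, Finset.sum_neg_distrib, Finset.mul_sum,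
      Finset.sum_mul]
    congr 1
    · exact congrArg _ <| Finset.sum_congr rfl fun _ _ => by ring
    · rw [Finset.sum_comm]
      exact Finset.sum_congr rfl fun _ _ => Finset.sum_congr rfl fun _ _ => by ring
  simp only [htr]
  rw [e1, e2]
  have e3 : A⁻¹ β j * quadT t = ∑ b, A⁻¹ β b * (if b = j then quadT t else 0) := by simp
  rw [e3]
  simp only [forceT, mul_add, mul_sub, Finset.sum_add_distrib, Finset.sum_sub_distrib,
    mul_left_comm _ (2 : ℝ) _, ← Finset.mul_sum]
  ring

/-- $t$ is linear in $B$ and the determinant does not involve it, so only the polar form of `quadT`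
contributes. The factors are grouped so as to isolate $|\lambda|\lambda_c^\gamma$, whose divergence
is computed in `sum_pd_det_mul_frame`. -/
theorem dB_lagrangian (hA : A.det ≠ 0) (B : Fin n → Fin n → Fin n → ℝ) (j β γ : Fin n) :
    dB lagrangian j β γ A B
      = 2 * ∑ b, ∑ c, A.det * A⁻¹ γ c * (A⁻¹ β b * momT (jetT A B) b c j) := by
  set t := jetT A B with ht
  set E : ℝ → Fin n → Fin n → Fin n → ℝ :=
    fun s i μ ν => B i μ ν + if i = j ∧ μ = β ∧ ν = γ then s else 0 with hE
  have hT : ∀ a b c, HasDerivAt (fun s => jetT A (E s) a b c)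
      (if a = j then A⁻¹ β b * A⁻¹ γ c - A⁻¹ γ b * A⁻¹ β c else 0) 0 := by
    intro a b c
    have hEd : ∀ μ ν, HasDerivAt (fun s => E s a μ ν)
        (if a = j ∧ μ = β ∧ ν = γ then 1 else 0) 0 := by
      intro μ ν
      simp only [hE]
      split_ifs
      · simpa using (hasDerivAt_id (0 : ℝ)).const_add (B a μ ν)
      · simpa using hasDerivAt_const (0 : ℝ) (B a μ ν)
    have h1 : HasDerivAt (fun s => jetT A (E s) a b c)
        (∑ μ, ∑ ν, A⁻¹ μ b * A⁻¹ ν c * ((if a = j ∧ μ = β ∧ ν = γ then 1 else 0)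
          - (if a = j ∧ ν = β ∧ μ = γ then 1 else 0))) 0 :=
      HasDerivAt.fun_sum fun μ _ => HasDerivAt.fun_sum fun ν _ =>
        ((hEd μ ν).sub (hEd ν μ)).const_mul _
    refine h1.congr_deriv ?_
    by_cases ha : a = j
    · simp [ha, mul_sub, Finset.sum_sub_distrib, ite_and]
    · simp [ha]
  have hL := (hasDerivAt_quadT hT).const_mul A.det
  have hE0 : E 0 = B := by funext i μ ν; simp [hE]
  rw [dB]
  simp only [lagrangian_eq hA]
  rw [hL.deriv, hE0, ← ht]
  have htr : ∀ b, trT (fun a b c => if a = j then A⁻¹ β b * A⁻¹ γ c - A⁻¹ γ b * A⁻¹ β c else 0) b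
      = A⁻¹ β b * A⁻¹ γ j - A⁻¹ γ b * A⁻¹ β j := by
    intro b
    simp [trT]
  have e1 : ∑ a, ∑ e, ∑ c, (if a = j then A⁻¹ β e * A⁻¹ γ c - A⁻¹ γ e * A⁻¹ β c else 0) * t e a c
      = ∑ b, ∑ c, A⁻¹ γ c * (A⁻¹ β b * (t b j c - t c j b)) := by
    rw [Finset.sum_eq_single j]
    · simp only [if_true, sub_mul, mul_sub, Finset.sum_sub_distrib]
      congr 1
      · exact Finset.sum_congr rfl fun _ _ => Finset.sum_congr rfl fun _ _ => by ring
      · rw [Finset.sum_comm]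
        exact Finset.sum_congr rfl fun _ _ => Finset.sum_congr rfl fun _ _ => by ring
    · intro a _ ha
      simp [ha]
    · simp
  have e2 : ∑ c, (A⁻¹ β c * A⁻¹ γ j - A⁻¹ γ c * A⁻¹ β j) * trT t c
      = ∑ b, ∑ c, A⁻¹ γ c * (A⁻¹ β b * ((if c = j then trT t b else 0)
          - (if b = j then trT t c else 0))) := by
    simp only [sub_mul, mul_sub, Finset.sum_sub_distrib]
    congr 1
    · refine Finset.sum_congr rfl fun _ _ => ?_
      simp; ring
    · rw [Finset.sum_comm]
      refine Finset.sum_congr rfl fun _ _ => ?_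
      simp; ring
  simp only [htr]
  rw [e1, e2, ← mul_sub, ← Finset.sum_sub_distrib]
  simp only [← Finset.sum_sub_distrib, ← mul_sub]
  rw [mul_left_comm, Finset.mul_sum]
  simp only [Finset.mul_sum, momT]
  exact Finset.sum_congr rfl fun _ _ => Finset.sum_congr rfl fun _ _ => by ring

end JetDerivatives

/-! ### Directional and partial derivatives of smooth functions and matrices -/

section DirectionalDerivatives

variable {E : Type*} [NormedAddCommGroup E] [NormedSpace ℝ E] {f : E → ℝ} {V : Set E} {x : E}

theorem contDiffOn_fderiv_apply (hV : IsOpen V) (hf : ContDiffOn ℝ ∞ f V) (v : E) :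
    ContDiffOn ℝ ∞ (fun y => fderiv ℝ f y v) V :=
  (hf.fderiv_of_isOpen hV (m := ∞) (by simp)).clm_apply contDiffOn_const

theorem fderiv_fderiv_comm (hV : IsOpen V) (hf : ContDiffOn ℝ ∞ f V) (hx : x ∈ V) (v w : E) :
    fderiv ℝ (fun y => fderiv ℝ f y v) x w = fderiv ℝ (fun y => fderiv ℝ f y w) x v := by
  have hfx : ContDiffAt ℝ ∞ f x := hf.contDiffAt (hV.mem_nhds hx)
  have hd : DifferentiableAt ℝ (fderiv ℝ f) x :=
    ((hf.fderiv_of_isOpen hV (m := ∞) (by simp)).contDiffAt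
      (hV.mem_nhds hx)).differentiableAt (by simp)
  have h1 : ∀ v w : E, fderiv ℝ (fun y => fderiv ℝ f y v) x w
      = fderiv ℝ (fderiv ℝ f) x w v := by
    intro v w
    rw [fderiv_clm_apply hd (differentiableAt_const _)]
    simp
  have h2 : minSmoothness ℝ 2 ≤ (∞ : WithTop ℕ∞) := by
    rw [minSmoothness_of_isRCLikeNormedField]
    exact WithTop.coe_le_coe.2 le_top
  rw [h1, h1]
  exact (hfx.isSymmSndFDerivAt h2) _ _

end DirectionalDerivatives

section PartialDerivatives

variable {n : ℕ} {f g : Co n → ℝ} {x : Co n}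

theorem pd_mul (μ : Fin n) (hf : DifferentiableAt ℝ f x) (hg : DifferentiableAt ℝ g x) :
    pd μ (fun y => f y * g y) x = pd μ f x * g x + f x * pd μ g x := by
  simp only [pd]
  rw [fderiv_fun_mul hf hg]
  simp
  ring

theorem pd_const_mul (μ : Fin n) (c : ℝ) (hf : DifferentiableAt ℝ f x) :
    pd μ (fun y => c * f y) x = c * pd μ f x := by
  simp only [pd]
  rw [fderiv_const_mul hf]
  simp

theorem pd_add (μ : Fin n) (hf : DifferentiableAt ℝ f x) (hg : DifferentiableAt ℝ g x) :
    pd μ (fun y => f y + g y) x = pd μ f x + pd μ g x := by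
  simp only [pd]
  rw [fderiv_fun_add hf hg]
  simp

theorem pd_sub (μ : Fin n) (hf : DifferentiableAt ℝ f x) (hg : DifferentiableAt ℝ g x) :
    pd μ (fun y => f y - g y) x = pd μ f x - pd μ g x := by
  simp only [pd]
  rw [fderiv_fun_sub hf hg]
  simp

theorem pd_sum (μ : Fin n) {ι : Type*} [Fintype ι] {f : ι → Co n → ℝ}
    (hf : ∀ i, DifferentiableAt ℝ (f i) x) :
    pd μ (fun y => ∑ i, f i y) x = ∑ i, pd μ (f i) x := by
  simp only [pd]
  rw [fderiv_fun_sum fun i _ => hf i]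
  simp

theorem pd_congr (μ : Fin n) (h : f =ᶠ[nhds x] g) : pd μ f x = pd μ g x := by
  simp only [pd, h.fderiv_eq]

theorem pd_const (μ : Fin n) (c : ℝ) : pd μ (fun _ => c) x = 0 := by
  simp [pd]

/-- This carries the formulas for curves of matrices over to partial derivatives. -/
theorem hasDerivAt_line (μ : Fin n) (hf : DifferentiableAt ℝ f x) :
    HasDerivAt (fun s : ℝ => f (x + s • EuclideanSpace.single μ 1)) (pd μ f x) 0 :=
  hf.hasFDerivAt.hasLineDerivAt _

theorem contDiffOn_pd {V : Set (Co n)} (hV : IsOpen V) (hf : ContDiffOn ℝ ∞ f V) (μ : Fin n) :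
    ContDiffOn ℝ ∞ (pd μ f) V :=
  contDiffOn_fderiv_apply hV hf _

theorem pd_comm {V : Set (Co n)} (hV : IsOpen V) (hf : ContDiffOn ℝ ∞ f V) (hx : x ∈ V)
    (μ ν : Fin n) : pd μ (pd ν f) x = pd ν (pd μ f) x :=
  fderiv_fderiv_comm hV hf hx _ _

end PartialDerivatives

section SmoothMatrix

variable {n : ℕ} {E : Type*} [NormedAddCommGroup E] [NormedSpace ℝ E] {V : Set E}

theorem contDiffOn_det {M : E → Matrix (Fin n) (Fin n) ℝ}
    (hM : ∀ i j, ContDiffOn ℝ ∞ (fun x => M x i j) V) :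
    ContDiffOn ℝ ∞ (fun x => (M x).det) V := by
  simp only [Matrix.det_apply']
  exact ContDiffOn.sum fun σ _ => contDiffOn_const.mul (contDiffOn_prod fun i _ => hM _ _)

theorem contDiffOn_inv {M : E → Matrix (Fin n) (Fin n) ℝ}
    (hM : ∀ i j, ContDiffOn ℝ ∞ (fun x => M x i j) V) (hu : ∀ x ∈ V, (M x).det ≠ 0)
    (i j : Fin n) : ContDiffOn ℝ ∞ (fun x => (M x)⁻¹ i j) V := by
  simp only [Matrix.inv_def, Ring.inverse_eq_inv', Matrix.smul_apply, smul_eq_mul,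
    Matrix.adjugate_apply]
  refine ((contDiffOn_det hM).inv hu).mul (contDiffOn_det fun k l => ?_)
  by_cases hk : k = j
  · subst hk
    simpa using contDiffOn_const
  · simpa [Matrix.updateRow_ne hk] using hM k l

end SmoothMatrix

/-! ### Frame components of the tensors of a frame calculus, at a point -/

namespace FrameCalculus

section Pointwise

variable {n : ℕ} {X : Type} (F : FrameCalculus n X) {p : X}

theorem coMat_eq (p : X) : F.coMat p = ((F.frame p)⁻¹).transpose := rfl

theorem det_coMat_ne_zero (h : (F.frame p).det ≠ 0) : (F.coMat p).det ≠ 0 := by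
  rw [coMat_eq, Matrix.det_transpose]
  exact (Matrix.isUnit_nonsing_inv_det _ (isUnit_iff_ne_zero.2 h)).ne_zero

/-- The dictionary between the jet formulas, written with $A^{-1}$, and the formulas written with
the frame; note the transposition of the indices. -/
theorem coMat_inv (h : (F.frame p).det ≠ 0) (α i : Fin n) :
    (F.coMat p)⁻¹ α i = F.frame p i α := by
  rw [coMat_eq, ← Matrix.transpose_nonsing_inv, Matrix.transpose_apply,
    Matrix.nonsing_inv_nonsing_inv _ (isUnit_iff_ne_zero.2 h)]

theorem Gam_eq_jetGam (h : (F.frame p).det ≠ 0) (α μ ν : Fin n) :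
    F.Gam α μ ν p = jetGam (F.coMat p) (F.dco p) α μ ν := by
  simp only [Gam, jetGam, F.coMat_inv h, dco]

theorem Tor_eq_jetTor (h : (F.frame p).det ≠ 0) (α μ ν : Fin n) :
    F.Tor α μ ν p = jetTor (F.coMat p) (F.dco p) α μ ν := by
  simp only [Tor, jetTor, F.Gam_eq_jetGam h]

theorem C_eq_jetC (h : (F.frame p).det ≠ 0) (μ : Fin n) :
    F.C μ p = jetC (F.coMat p) (F.dco p) μ := by
  simp only [C, jetC, F.Tor_eq_jetTor h]

theorem H_eq_jetH (h : (F.frame p).det ≠ 0) (μ ν : Fin n) :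
    F.H μ ν p = jetH (F.coMat p) (F.dco p) μ ν := by
  simp only [H, jetH, F.Tor_eq_jetTor h, F.C_eq_jetC h]

/-- Frame components of the torsion. -/
def tF (a b c : Fin n) (p : X) : ℝ := jetT (F.coMat p) (F.dco p) a b c

/-- Frame components of the basic covector. -/
def cF (b : Fin n) (p : X) : ℝ := trT (fun a b c => F.tF a b c p) b

theorem tF_antisymm (a b c : Fin n) (p : X) : F.tF a c b p = -F.tF a b c p :=
  jetT_antisymm _ _ _ _ _

/-- Derivative in the direction of the frame vector `λ_c`. -/
def along (c : Fin n) (f : X → ℝ) (p : X) : ℝ := ∑ γ, F.frame p c γ * F.d γ f p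

/-- Frame components of the canonical connection. -/
def GamF (a b c : Fin n) (p : X) : ℝ := ∑ ε, F.frame p b ε * F.along c (F.co a ε) p

theorem tF_eq_GamF (h : (F.frame p).det ≠ 0) (a b c : Fin n) :
    F.tF a b c p = F.GamF a b c p - F.GamF a c b p := by
  simp only [tF, jetT, GamF, along, F.coMat_inv h, dco, Finset.mul_sum, mul_sub,
    Finset.sum_sub_distrib]
  congr 1
  · exact Finset.sum_congr rfl fun _ _ => Finset.sum_congr rfl fun _ _ => by ring
  · rw [Finset.sum_comm]
    exact Finset.sum_congr rfl fun _ _ => Finset.sum_congr rfl fun _ _ => by ring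

theorem C_eq (h : (F.frame p).det ≠ 0) (μ : Fin n) :
    F.C μ p = ∑ b, F.co b μ p * F.cF b p := by
  rw [F.C_eq_jetC h, jetC_eq (F.det_coMat_ne_zero h)]
  rfl

theorem Tor_eq (h : (F.frame p).det ≠ 0) (α μ ν : Fin n) :
    F.Tor α μ ν p = ∑ a, F.frame p a α * ∑ b, F.co b μ p * ∑ c, F.co c ν p * F.tF a b c p := by
  rw [F.Tor_eq_jetTor h, jetTor_eq_jetT (F.det_coMat_ne_zero h)]
  simp only [F.coMat_inv h]
  rfl

theorem H_eq (h : (F.frame p).det ≠ 0) (μ ν : Fin n) :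
    F.H μ ν p = ∑ c, F.co c μ p * ∑ d, F.co d ν p * hT (fun a b c => F.tF a b c p) c d := by
  rw [F.H_eq_jetH h, jetH_eq (F.det_coMat_ne_zero h)]
  rfl

theorem tr_H_eq (h : (F.frame p).det ≠ 0) :
    F.tr F.H p = quadT (fun a b c => F.tF a b c p) := by
  have := sum_gInv_two (F.det_coMat_ne_zero h) (hT fun a b c => F.tF a b c p)
  simp only [F.coMat_inv h] at this
  simp only [tr, F.H_eq h, quadT_eq]
  exact this

theorem CUp_eq (h : (F.frame p).det ≠ 0) (μ : Fin n) :
    F.CUp μ p = ∑ b, F.frame p b μ * F.cF b p := by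
  have := sum_gInv (F.det_coMat_ne_zero h) (fun b => F.cF b p) μ
  simp only [F.coMat_inv h] at this
  simp only [CUp, F.C_eq h]
  exact this

theorem TorLow_eq (h : (F.frame p).det ≠ 0) (α μ ν : Fin n) :
    F.TorLow α μ ν p
      = ∑ a, F.co a α p * ∑ b, F.co b μ p * ∑ c, F.co c ν p * F.tF a b c p := by
  have := sum_g (F.det_coMat_ne_zero h)
    (fun a => ∑ b, F.co b μ p * ∑ c, F.co c ν p * F.tF a b c p) α
  simp only [F.coMat_inv h] at this
  simp only [TorLow, F.Tor_eq h]
  exact this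

end Pointwise

end FrameCalculus

/-! ### Smooth frames: derivatives of the frame and of its frame components -/

namespace FrameCalculus

section Smooth

variable {n : ℕ}

/-- A smooth frame on an open subset of the coordinate space, with the partial derivatives. -/
structure IsSmoothOn (F : FrameCalculus n (Co n)) (V : Set (Co n)) : Prop where
  isOpen : IsOpen V
  d_eq : F.d = pd
  det_ne : ∀ x ∈ V, (F.frame x).det ≠ 0
  smooth : ∀ i α, ContDiffOn ℝ ∞ (fun x => F.frame x i α) V

namespace IsSmoothOn

variable {F : FrameCalculus n (Co n)} {V : Set (Co n)} (hF : F.IsSmoothOn V) {x : Co n}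
include hF

theorem co (i μ : Fin n) : ContDiffOn ℝ ∞ (F.co i μ) V :=
  contDiffOn_inv hF.smooth hF.det_ne μ i

theorem coInv (α i : Fin n) : ContDiffOn ℝ ∞ (fun x => (F.coMat x)⁻¹ α i) V :=
  contDiffOn_inv (fun i μ => hF.co i μ) (fun x hx => F.det_coMat_ne_zero (hF.det_ne x hx)) α i

theorem det : ContDiffOn ℝ ∞ (fun x => (F.coMat x).det) V :=
  contDiffOn_det fun i μ => hF.co i μ

theorem tF (a b c : Fin n) : ContDiffOn ℝ ∞ (F.tF a b c) V := by
  have hd : ∀ i μ ν, ContDiffOn ℝ ∞ (fun x => F.dco x i μ ν) V := fun i μ ν => by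
    simp only [dco, hF.d_eq]
    exact contDiffOn_pd hF.isOpen (hF.co i μ) ν
  unfold FrameCalculus.tF jetT
  exact ContDiffOn.sum fun μ _ => ContDiffOn.sum fun ν _ =>
    ((hF.coInv μ b).mul (hF.coInv ν c)).mul ((hd a μ ν).sub (hd a ν μ))

theorem cF (b : Fin n) : ContDiffOn ℝ ∞ (F.cF b) V := by
  unfold FrameCalculus.cF trT
  exact ContDiffOn.sum fun a _ => hF.tF a b a

theorem diffAt (hx : x ∈ V) {f : Co n → ℝ} (hf : ContDiffOn ℝ ∞ f V) : DifferentiableAt ℝ f x :=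
  (hf.contDiffAt (hF.isOpen.mem_nhds hx)).differentiableAt (by simp)

theorem line_zero (i μ γ : Fin n) (hx : x ∈ V) :
    HasDerivAt (fun s : ℝ => F.coMat (x + s • EuclideanSpace.single γ 1) i μ)
      (pd γ (F.co i μ) x) 0 :=
  hasDerivAt_line γ (hF.diffAt hx (hF.co i μ))

/-- The frame is the inverse of the coframe matrix, so `hasDerivAt_inv` applies along the coordinate
line. -/
theorem pd_frame (j β γ : Fin n) (hx : x ∈ V) :
    pd γ (fun y => F.frame y j β) x
      = -∑ a, F.frame x a β * ∑ ε, F.frame x j ε * pd γ (F.co a ε) x := by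
  have hD : (F.coMat (x + (0 : ℝ) • EuclideanSpace.single γ 1)).det ≠ 0 := by
    simpa using F.det_coMat_ne_zero (hF.det_ne x hx)
  have h1 := hasDerivAt_inv (M' := Matrix.of fun i μ => pd γ (F.co i μ) x)
    (fun i μ => hF.line_zero i μ γ hx) hD β j
  have h2 := hasDerivAt_line γ (hF.diffAt hx (hF.coInv β j))
  have h3 : pd γ (fun y => F.frame y j β) x = pd γ (fun y => (F.coMat y)⁻¹ β j) x := by
    refine pd_congr γ ?_
    filter_upwards [hF.isOpen.mem_nhds hx] with y hy using
      (F.coMat_inv (hF.det_ne y hy) β j).symm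
  rw [h3, h2.unique h1, Matrix.mul_assoc]
  simp only [zero_smul, add_zero, Matrix.mul_apply, Matrix.of_apply,
    F.coMat_inv (hF.det_ne x hx)]
  exact congrArg _ <| Finset.sum_congr rfl fun _ _ => congrArg _ <|
    Finset.sum_congr rfl fun _ _ => mul_comm _ _

theorem pd_det (γ : Fin n) (hx : x ∈ V) :
    pd γ (fun y => (F.coMat y).det) x
      = (F.coMat x).det * ∑ a, ∑ ε, F.frame x a ε * pd γ (F.co a ε) x := by
  have hD : (F.coMat (x + (0 : ℝ) • EuclideanSpace.single γ 1)).det ≠ 0 := by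
    simpa using F.det_coMat_ne_zero (hF.det_ne x hx)
  have h1 := hasDerivAt_det_of_isUnit (M' := Matrix.of fun i μ => pd γ (F.co i μ) x)
    (fun i μ => hF.line_zero i μ γ hx) hD
  have h2 := hasDerivAt_line γ (hF.diffAt hx hF.det)
  rw [h2.unique h1]
  simp only [zero_smul, add_zero, Matrix.of_apply, F.coMat_inv (hF.det_ne x hx)]
  rw [Finset.sum_comm]

theorem along_frame (b c β : Fin n) (hx : x ∈ V) :
    F.along c (fun y => F.frame y b β) x = -∑ a, F.frame x a β * F.GamF a b c x := by
  simp only [along, hF.d_eq, hF.pd_frame b β _ hx, GamF, mul_neg, Finset.sum_neg_distrib,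
    Finset.mul_sum]
  rw [Finset.sum_comm]
  refine congrArg _ <| Finset.sum_congr rfl fun a _ => ?_
  rw [Finset.sum_comm]
  exact Finset.sum_congr rfl fun _ _ => Finset.sum_congr rfl fun _ _ => by ring

/-- The divergence of the density `|λ| λ_c`. -/
theorem sum_pd_det_mul_frame (c : Fin n) (hx : x ∈ V) :
    ∑ γ, pd γ (fun y => (F.coMat y).det * F.frame y c γ) x = -((F.coMat x).det * F.cF c x) := by
  have h1 : ∀ γ, pd γ (fun y => (F.coMat y).det * F.frame y c γ) x
      = (F.coMat x).det * ((∑ a, ∑ ε, F.frame x a ε * pd γ (F.co a ε) x) * F.frame x c γ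
        - ∑ a, F.frame x a γ * ∑ ε, F.frame x c ε * pd γ (F.co a ε) x) := by
    intro γ
    rw [pd_mul γ (hF.diffAt hx hF.det) (hF.diffAt hx (hF.smooth c γ)), hF.pd_det γ hx,
      hF.pd_frame c γ γ hx]
    ring
  simp only [h1]
  rw [← Finset.mul_sum, ← mul_neg]
  congr 1
  -- The derivative of the determinant contributes $\Gamma_{aac}$ and that of the frame vector
  -- $-\Gamma_{aca}$; together they are minus the trace of the torsion.
  have h2 : F.cF c x = ∑ a, (F.GamF a c a x - F.GamF a a c x) := by
    unfold FrameCalculus.cF trT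
    exact Finset.sum_congr rfl fun a _ => F.tF_eq_GamF (hF.det_ne x hx) a c a
  rw [h2, ← Finset.sum_neg_distrib, Finset.sum_sub_distrib]
  simp only [neg_sub]
  rw [Finset.sum_sub_distrib]
  simp only [GamF, along, hF.d_eq, Finset.mul_sum, Finset.sum_mul]
  congr 1
  · rw [Finset.sum_comm]
    refine Finset.sum_congr rfl fun a _ => ?_
    rw [Finset.sum_comm]
    exact Finset.sum_congr rfl fun _ _ => Finset.sum_congr rfl fun _ _ => by ring
  · rw [Finset.sum_comm]
    refine Finset.sum_congr rfl fun a _ => ?_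
    rw [Finset.sum_comm]
    exact Finset.sum_congr rfl fun _ _ => Finset.sum_congr rfl fun _ _ => by ring

theorem along_add {f g : Co n → ℝ} (c : Fin n) (hx : x ∈ V) (hf : ContDiffOn ℝ ∞ f V)
    (hg : ContDiffOn ℝ ∞ g V) : F.along c (fun y => f y + g y) x = F.along c f x + F.along c g x := by
  simp only [along, hF.d_eq, pd_add _ (hF.diffAt hx hf) (hF.diffAt hx hg), mul_add,
    Finset.sum_add_distrib]

theorem along_sub {f g : Co n → ℝ} (c : Fin n) (hx : x ∈ V) (hf : ContDiffOn ℝ ∞ f V)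
    (hg : ContDiffOn ℝ ∞ g V) : F.along c (fun y => f y - g y) x = F.along c f x - F.along c g x := by
  simp only [along, hF.d_eq, pd_sub _ (hF.diffAt hx hf) (hF.diffAt hx hg), mul_sub,
    Finset.sum_sub_distrib]

theorem along_mul {f g : Co n → ℝ} (c : Fin n) (hx : x ∈ V) (hf : ContDiffOn ℝ ∞ f V)
    (hg : ContDiffOn ℝ ∞ g V) :
    F.along c (fun y => f y * g y) x = F.along c f x * g x + f x * F.along c g x := by
  simp only [along, hF.d_eq, pd_mul _ (hF.diffAt hx hf) (hF.diffAt hx hg), Finset.sum_mul,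
    Finset.mul_sum, ← Finset.sum_add_distrib]
  exact Finset.sum_congr rfl fun _ _ => by ring

theorem along_sum {ι : Type*} [Fintype ι] {f : ι → Co n → ℝ} (c : Fin n) (hx : x ∈ V)
    (hf : ∀ i, ContDiffOn ℝ ∞ (f i) V) :
    F.along c (fun y => ∑ i, f i y) x = ∑ i, F.along c (f i) x := by
  simp only [along, hF.d_eq, pd_sum _ fun i => hF.diffAt hx (hf i), Finset.mul_sum]
  rw [Finset.sum_comm]

theorem along_congr {f g : Co n → ℝ} (c : Fin n) (hx : x ∈ V) (h : ∀ y ∈ V, f y = g y) :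
    F.along c f x = F.along c g x := by
  have : f =ᶠ[nhds x] g := by
    filter_upwards [hF.isOpen.mem_nhds hx] with y hy using h y hy
  simp only [along, hF.d_eq, pd_congr _ this]

theorem along_zero (c : Fin n) : F.along c (fun _ => (0 : ℝ)) x = 0 := by
  simp [along, hF.d_eq, pd_const]

theorem along_cF (b c : Fin n) (hx : x ∈ V) :
    F.along c (F.cF b) x = ∑ a, F.along c (F.tF a b a) x :=
  hF.along_sum c hx fun a => hF.tF a b a

theorem momF (b c j : Fin n) :
    ContDiffOn ℝ ∞ (fun y => momT (fun a b c => F.tF a b c y) b c j) V := by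
  have hif : ∀ (P : Prop) [Decidable P] (b : Fin n),
      ContDiffOn ℝ ∞ (fun y => if P then F.cF b y else 0) V := by
    intro P _ b
    split_ifs
    exacts [hF.cF b, contDiffOn_const]
  exact (((hF.tF b j c).sub (hF.tF c j b)).sub (hif _ b)).add (hif _ c)

theorem along_momF (b c j e : Fin n) (hx : x ∈ V) :
    F.along e (fun y => momT (fun a b c => F.tF a b c y) b c j) x
      = F.along e (F.tF b j c) x - F.along e (F.tF c j b) x
        - (if c = j then F.along e (F.cF b) x else 0)
        + (if b = j then F.along e (F.cF c) x else 0) := by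
  have hif : ∀ (P : Prop) [Decidable P] (b : Fin n),
      ContDiffOn ℝ ∞ (fun y => if P then F.cF b y else 0) V := by
    intro P _ b
    split_ifs
    exacts [hF.cF b, contDiffOn_const]
  have hif' : ∀ (P : Prop) [Decidable P] (b : Fin n),
      F.along e (fun y => if P then F.cF b y else 0) x = if P then F.along e (F.cF b) x else 0 := by
    intro P _ b
    split_ifs
    exacts [rfl, hF.along_zero e]
  rw [← hif', ← hif', ← hF.along_sub e hx (hF.tF b j c) (hF.tF c j b),
    ← hF.along_sub e hx ((hF.tF b j c).sub (hF.tF c j b)) (hif _ b),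
    ← hF.along_add e hx (((hF.tF b j c).sub (hF.tF c j b)).sub (hif _ b)) (hif _ c)]
  rfl

end IsSmoothOn

end Smooth

end FrameCalculus
-- The Euler–Lagrange expression and $E_{\mu\nu}$ compared in frame components
namespace FrameCalculus
section Smooth
variable {n : ℕ}

/-- Frame components of the Euler-Lagrange expression. -/
def elF (F : FrameCalculus n (Co n)) (b j : Fin n) (x : Co n) : ℝ :=
  forceT (fun a b c => F.tF a b c x) b j
    - 2 * ((∑ c, F.along c (fun y => momT (fun a b c => F.tF a b c y) b c j) x)
      - (∑ c, F.cF c x * momT (fun a b c => F.tF a b c x) b c j)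
      - 1 / 2 * ∑ a, ∑ c, F.tF b a c x * momT (fun a b c => F.tF a b c x) a c j)

/-- Frame components of `E_{μν}`. -/
def eF (F : FrameCalculus n (Co n)) (m j : Fin n) (x : Co n) : ℝ :=
  (if m = j then quadT (fun a b c => F.tF a b c x) else 0)
    - 2 * hT (fun a b c => F.tF a b c x) m j - 2 * (F.cF m x * F.cF j x)
    - 2 * (if m = j then (∑ c, F.along c (F.cF c) x) - ∑ c, F.cF c x * F.cF c x else 0)
    - 2 * (∑ c, F.cF c x * F.tF m c j x) + 2 * F.along m (F.cF j) x
    - 2 * ∑ c, F.along c (F.tF m j c) x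

/-- Contracted with the momentum, the connection only counts through its antisymmetric part, which
is half the torsion; hence the factor $\frac12$ in `elF`. -/
theorem momT_antisymm (t : Fin n → Fin n → Fin n → ℝ) (b c j : Fin n) :
    momT t c b j = -momT t b c j := by
  unfold momT
  ring

namespace IsSmoothOn

variable {F : FrameCalculus n (Co n)} {V : Set (Co n)} (hF : F.IsSmoothOn V) {x : Co n}
include hF

/-- The divergence of $2|\lambda|\lambda_c^\gamma\,\lambda_b^\beta w_{bcj}$ splits by the product
rule: the density gives $-c_c$, the factor $\lambda_b^\beta$ gives the connection, and $w$ is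
differentiated along the frame. -/
theorem eulerLagrange_eq (j β : Fin n) (hx : x ∈ V) :
    F.eulerLagrange j β x = (F.coMat x).det * ∑ b, F.frame x b β * F.elF b j x := by
  have hdet := F.det_coMat_ne_zero (hF.det_ne x hx)
  set m : Fin n → Fin n → Co n → ℝ := fun b c y => momT (fun a b c => F.tF a b c y) b c j with hm
  have hms : ∀ b c, ContDiffOn ℝ ∞ (m b c) V := fun b c => hF.momF b c j
  have h1 : dA lagrangian j β (F.coMat x) (F.dco x) = (F.coMat x).det *
      ∑ b, F.frame x b β * forceT (fun a b c => F.tF a b c x) b j := by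
    rw [dA_lagrangian hdet]
    simp only [F.coMat_inv (hF.det_ne x hx)]
    rfl
  have h2 : ∀ γ, pd γ (fun q => dB lagrangian j β γ (F.coMat q) (F.dco q)) x
      = 2 * ∑ b, ∑ c, (pd γ (fun q => (F.coMat q).det * F.frame q c γ) x
          * (F.frame x b β * m b c x)
        + (F.coMat x).det * F.frame x c γ * pd γ (fun q => F.frame q b β * m b c q) x) := by
    intro γ
    have e1 : (fun q => dB lagrangian j β γ (F.coMat q) (F.dco q)) =ᶠ[nhds x] fun q =>
        2 * ∑ b, ∑ c, (F.coMat q).det * F.frame q c γ * (F.frame q b β * m b c q) := by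
      filter_upwards [hF.isOpen.mem_nhds hx] with q hq
      rw [dB_lagrangian (F.det_coMat_ne_zero (hF.det_ne q hq))]
      simp only [F.coMat_inv (hF.det_ne q hq)]
      rfl
    have e2 : ∀ c, ContDiffOn ℝ ∞ (fun q => (F.coMat q).det * F.frame q c γ) V :=
      fun c => hF.det.mul (hF.smooth c γ)
    have e3 : ∀ b c, ContDiffOn ℝ ∞ (fun q => F.frame q b β * m b c q) V :=
      fun b c => (hF.smooth b β).mul (hms b c)
    rw [pd_congr γ e1, pd_const_mul γ 2 (hF.diffAt hx <| ContDiffOn.sum fun b _ =>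
      ContDiffOn.sum fun c _ => (e2 c).mul (e3 b c)),
      pd_sum γ fun b => hF.diffAt hx <| ContDiffOn.sum fun c _ => (e2 c).mul (e3 b c)]
    congr 1
    refine Finset.sum_congr rfl fun b _ => ?_
    rw [pd_sum γ fun c => hF.diffAt hx <| (e2 c).mul (e3 b c)]
    exact Finset.sum_congr rfl fun c _ => pd_mul γ (hF.diffAt hx (e2 c)) (hF.diffAt hx (e3 b c))
  have h3 : ∑ γ, pd γ (fun q => dB lagrangian j β γ (F.coMat q) (F.dco q)) x
      = 2 * ∑ b, ∑ c, (-((F.coMat x).det * F.cF c x) * (F.frame x b β * m b c x)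
        + (F.coMat x).det * (-(∑ a, F.frame x a β * F.GamF a b c x) * m b c x
          + F.frame x b β * F.along c (m b c) x)) := by
    simp only [h2]
    rw [← Finset.mul_sum, Finset.sum_comm]
    congr 1
    refine Finset.sum_congr rfl fun b _ => ?_
    rw [Finset.sum_comm]
    refine Finset.sum_congr rfl fun c _ => ?_
    rw [Finset.sum_add_distrib, ← Finset.sum_mul, hF.sum_pd_det_mul_frame c hx,
      ← hF.along_frame b c β hx, ← hF.along_mul c hx (hF.smooth b β) (hms b c)]
    simp only [along, hF.d_eq, Finset.mul_sum, mul_assoc]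
  have h4 : ∑ b, ∑ c, (∑ a, F.frame x a β * F.GamF a b c x) * m b c x
      = ∑ a, F.frame x a β * (1 / 2 * ∑ b, ∑ c, F.tF a b c x * m b c x) := by
    have e1 : ∀ a, 1 / 2 * ∑ b, ∑ c, F.tF a b c x * m b c x
        = ∑ b, ∑ c, F.GamF a b c x * m b c x := by
      intro a
      have e2 : ∑ b, ∑ c, F.GamF a c b x * m b c x = -∑ b, ∑ c, F.GamF a b c x * m b c x := by
        rw [Finset.sum_comm]
        simp only [← Finset.sum_neg_distrib]
        refine Finset.sum_congr rfl fun b _ => Finset.sum_congr rfl fun c _ => ?_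
        rw [hm]
        simp only
        rw [momT_antisymm _ b c]
        ring
      simp only [F.tF_eq_GamF (hF.det_ne x hx), sub_mul, Finset.sum_sub_distrib]
      rw [e2]
      ring
    simp only [e1, Finset.sum_mul, Finset.mul_sum]
    refine (Finset.sum_congr rfl fun a _ => Finset.sum_comm).trans (Finset.sum_comm.trans ?_)
    exact Finset.sum_congr rfl fun _ _ => Finset.sum_congr rfl fun _ _ =>
      Finset.sum_congr rfl fun _ _ => by ring
  have h5 : ∑ b, ∑ c, (-((F.coMat x).det * F.cF c x) * (F.frame x b β * m b c x)
        + (F.coMat x).det * (-(∑ a, F.frame x a β * F.GamF a b c x) * m b c x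
          + F.frame x b β * F.along c (m b c) x))
      = (F.coMat x).det * ((∑ b, F.frame x b β * ∑ c, F.along c (m b c) x)
        - (∑ b, F.frame x b β * ∑ c, F.cF c x * m b c x)
        - ∑ a, F.frame x a β * (1 / 2 * ∑ b, ∑ c, F.tF a b c x * m b c x)) := by
    rw [← h4]
    simp only [Finset.mul_sum, mul_sub, ← Finset.sum_sub_distrib]
    exact Finset.sum_congr rfl fun _ _ => Finset.sum_congr rfl fun _ _ => by ring
  rw [eulerLagrange, h1]
  simp only [hF.d_eq]
  rw [h3, h5, mul_left_comm, ← mul_sub]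
  congr 1
  simp only [elF, mul_sub, Finset.sum_sub_distrib, mul_left_comm _ (2 : ℝ) _, ← Finset.mul_sum]
  ring

theorem lowerEL_eq (μ ν : Fin n) (hx : x ∈ V) :
    F.lowerEL F.eulerLagrange μ ν x = ∑ m, F.co m μ x * ∑ j, F.co j ν x * F.elF m j x := by
  have hdet := F.det_coMat_ne_zero (hF.det_ne x hx)
  have h := sum_g hdet (fun b => ∑ j, F.co j ν x * F.elF b j x) μ
  simp only [F.coMat_inv (hF.det_ne x hx)] at h
  refine Eq.trans ?_ h
  unfold lowerEL
  refine Finset.sum_congr rfl fun β _ => congrArg _ ?_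
  simp only [hF.eulerLagrange_eq _ _ hx, Finset.mul_sum, Finset.sum_mul]
  rw [Finset.sum_comm]
  refine Finset.sum_congr rfl fun _ _ => Finset.sum_congr rfl fun _ _ => ?_
  field_simp

/-- Parallelism of the coframe, $\lambda_{a\alpha|\sigma}=0$. Together with `sum_Gam_mul_frame` it
reduces covariant derivatives to derivatives of frame components. -/
theorem sum_Gam_mul_co (a α σ : Fin n) (hx : x ∈ V) :
    ∑ ε, F.Gam ε α σ x * F.co a ε x = pd σ (F.co a α) x := by
  have h := sum_mul_inv (F.det_coMat_ne_zero (hF.det_ne x hx)) a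
  simp only [F.coMat_inv (hF.det_ne x hx)] at h
  simp only [Gam, hF.d_eq, Finset.sum_mul]
  rw [Finset.sum_comm]
  have : ∀ i, ∑ ε, F.frame x i ε * pd σ (F.co i α) x * F.co a ε x
      = (if a = i then 1 else 0) * pd σ (F.co i α) x := by
    intro i
    rw [← h, Finset.sum_mul]
    exact Finset.sum_congr rfl fun _ _ => by change _ = F.co _ _ _ * _ * _; ring
  simp [this]

theorem sum_Gam_mul_frame (b α σ : Fin n) (hx : x ∈ V) :
    ∑ ε, F.Gam α ε σ x * F.frame x b ε = -pd σ (fun y => F.frame y b α) x := by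
  rw [hF.pd_frame b α σ hx, neg_neg]
  simp only [Gam, hF.d_eq, Finset.sum_mul, Finset.mul_sum]
  rw [Finset.sum_comm]
  exact Finset.sum_congr rfl fun _ _ => Finset.sum_congr rfl fun _ _ => by ring

/-- The covariant derivative of a vector field, in terms of its frame components. -/
theorem cov10_eq {W : Fin n → Co n → ℝ} {w : Fin n → Co n → ℝ}
    (hw : ∀ b, ContDiffOn ℝ ∞ (w b) V)
    (hW : ∀ y ∈ V, ∀ α, W α y = ∑ b, F.frame y b α * w b y) (α σ : Fin n) (hx : x ∈ V) :
    F.cov10 W α σ x = ∑ b, F.frame x b α * pd σ (w b) x := by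
  have h1 : W α =ᶠ[nhds x] fun y => ∑ b, F.frame y b α * w b y := by
    filter_upwards [hF.isOpen.mem_nhds hx] with y hy using hW y hy α
  simp only [cov10, hF.d_eq, pd_congr σ h1, hW x hx]
  rw [pd_sum σ fun b => hF.diffAt hx ((hF.smooth b α).mul (hw b))]
  simp only [pd_mul σ (hF.diffAt hx (hF.smooth _ α)) (hF.diffAt hx (hw _)),
    Finset.sum_add_distrib]
  have h2 : ∑ ε, F.Gam α ε σ x * ∑ b, F.frame x b ε * w b x
      = ∑ b, (-pd σ (fun y => F.frame y b α) x) * w b x := by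
    simp only [← hF.sum_Gam_mul_frame _ α σ hx, Finset.mul_sum, Finset.sum_mul]
    rw [Finset.sum_comm]
    simp only [mul_assoc]
  rw [h2]
  simp only [neg_mul, Finset.sum_neg_distrib]
  ring

/-- The covariant derivative of a covector field, in terms of its frame components. -/
theorem cov01_eq {W : Fin n → Co n → ℝ} {w : Fin n → Co n → ℝ}
    (hw : ∀ b, ContDiffOn ℝ ∞ (w b) V)
    (hW : ∀ y ∈ V, ∀ μ, W μ y = ∑ b, F.co b μ y * w b y) (μ σ : Fin n) (hx : x ∈ V) :
    F.cov01 W μ σ x = ∑ b, F.co b μ x * pd σ (w b) x := by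
  have h1 : W μ =ᶠ[nhds x] fun y => ∑ b, F.co b μ y * w b y := by
    filter_upwards [hF.isOpen.mem_nhds hx] with y hy using hW y hy μ
  simp only [cov01, hF.d_eq, pd_congr σ h1, hW x hx]
  rw [pd_sum σ fun b => hF.diffAt hx ((hF.co b μ).mul (hw b))]
  simp only [pd_mul σ (hF.diffAt hx (hF.co _ μ)) (hF.diffAt hx (hw _)),
    Finset.sum_add_distrib]
  have h2 : ∑ ε, F.Gam ε μ σ x * ∑ b, F.co b ε x * w b x
      = ∑ b, pd σ (F.co b μ) x * w b x := by
    simp only [← hF.sum_Gam_mul_co _ μ σ hx, Finset.mul_sum, Finset.sum_mul]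
    rw [Finset.sum_comm]
    simp only [mul_assoc]
  rw [h2]
  ring

/-- The covariant derivative of a threefold covariant tensor, in terms of its frame components. -/
theorem cov03_eq {T : Fin n → Fin n → Fin n → Co n → ℝ} {t : Fin n → Fin n → Fin n → Co n → ℝ}
    (ht : ∀ a b c, ContDiffOn ℝ ∞ (t a b c) V)
    (hT : ∀ y ∈ V, ∀ α μ ν, T α μ ν y
      = ∑ a, F.co a α y * ∑ b, F.co b μ y * ∑ c, F.co c ν y * t a b c y)
    (α μ ν σ : Fin n) (hx : x ∈ V) :
    F.cov03 T α μ ν σ x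
      = ∑ a, F.co a α x * ∑ b, F.co b μ x * ∑ c, F.co c ν x * pd σ (t a b c) x := by
  have h1 : T α μ ν =ᶠ[nhds x] fun y =>
      ∑ a, F.co a α y * ∑ b, F.co b μ y * ∑ c, F.co c ν y * t a b c y := by
    filter_upwards [hF.isOpen.mem_nhds hx] with y hy using hT y hy α μ ν
  have s3 : ∀ a b c, ContDiffOn ℝ ∞ (fun y => F.co c ν y * t a b c y) V :=
    fun a b c => (hF.co c ν).mul (ht a b c)
  have s2 : ∀ a b, ContDiffOn ℝ ∞ (fun y => ∑ c, F.co c ν y * t a b c y) V :=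
    fun a b => ContDiffOn.sum fun c _ => s3 a b c
  have s1 : ∀ a b, ContDiffOn ℝ ∞ (fun y => F.co b μ y * ∑ c, F.co c ν y * t a b c y) V :=
    fun a b => (hF.co b μ).mul (s2 a b)
  have s0 : ∀ a, ContDiffOn ℝ ∞ (fun y => ∑ b, F.co b μ y * ∑ c, F.co c ν y * t a b c y) V :=
    fun a => ContDiffOn.sum fun b _ => s1 a b
  -- The product rule differentiates each of the three coframe factors in turn; these terms are
  -- cancelled below by the three connection terms, leaving the derivative of the components.
  have h2 : pd σ (T α μ ν) x = ∑ a, (pd σ (F.co a α) x *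
        (∑ b, F.co b μ x * ∑ c, F.co c ν x * t a b c x)
      + F.co a α x * ∑ b, (pd σ (F.co b μ) x * (∑ c, F.co c ν x * t a b c x)
        + F.co b μ x * ∑ c, (pd σ (F.co c ν) x * t a b c x + F.co c ν x * pd σ (t a b c) x))) := by
    rw [pd_congr σ h1, pd_sum σ fun a => hF.diffAt hx ((hF.co a α).mul (s0 a))]
    refine Finset.sum_congr rfl fun a _ => ?_
    rw [pd_mul σ (hF.diffAt hx (hF.co a α)) (hF.diffAt hx (s0 a)),
      pd_sum σ fun b => hF.diffAt hx (s1 a b)]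
    congr 2
    refine Finset.sum_congr rfl fun b _ => ?_
    rw [pd_mul σ (hF.diffAt hx (hF.co b μ)) (hF.diffAt hx (s2 a b)),
      pd_sum σ fun c => hF.diffAt hx (s3 a b c)]
    congr 2
    exact Finset.sum_congr rfl fun c _ =>
      pd_mul σ (hF.diffAt hx (hF.co c ν)) (hF.diffAt hx (ht a b c))
  have h3 : ∀ (κ : Fin n) (f : Fin n → ℝ), ∑ ε, F.Gam ε κ σ x * ∑ a, F.co a ε x * f a
      = ∑ a, pd σ (F.co a κ) x * f a := by
    intro κ f
    simp only [← hF.sum_Gam_mul_co _ κ σ hx, Finset.mul_sum, Finset.sum_mul]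
    rw [Finset.sum_comm]
    simp only [mul_assoc]
  have h4 : ∑ ε, F.Gam ε μ σ x * T α ε ν x
      = ∑ a, F.co a α x * ∑ b, pd σ (F.co b μ) x * ∑ c, F.co c ν x * t a b c x := by
    have e1 : ∀ ε, F.Gam ε μ σ x * T α ε ν x = ∑ a, F.co a α x *
        (F.Gam ε μ σ x * ∑ b, F.co b ε x * ∑ c, F.co c ν x * t a b c x) := by
      intro ε
      rw [hT x hx, Finset.mul_sum]
      exact Finset.sum_congr rfl fun a _ => mul_left_comm _ _ _
    simp only [e1, ← h3 μ]
    rw [Finset.sum_comm]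
    exact Finset.sum_congr rfl fun a _ => (Finset.mul_sum _ _ _).symm
  have h5 : ∑ ε, F.Gam ε ν σ x * T α μ ε x
      = ∑ a, F.co a α x * ∑ b, F.co b μ x * ∑ c, pd σ (F.co c ν) x * t a b c x := by
    have e1 : ∀ ε, F.Gam ε ν σ x * T α μ ε x = ∑ a, F.co a α x * ∑ b, F.co b μ x *
        (F.Gam ε ν σ x * ∑ c, F.co c ε x * t a b c x) := by
      intro ε
      rw [hT x hx, Finset.mul_sum]
      refine Finset.sum_congr rfl fun a _ => ?_
      rw [mul_left_comm, Finset.mul_sum]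
      exact congrArg _ <| Finset.sum_congr rfl fun b _ => mul_left_comm _ _ _
    simp only [e1, ← h3 ν]
    rw [Finset.sum_comm]
    refine Finset.sum_congr rfl fun a _ => ?_
    rw [← Finset.mul_sum, Finset.sum_comm]
    exact congrArg _ <| Finset.sum_congr rfl fun b _ => (Finset.mul_sum _ _ _).symm
  have h6 : ∑ ε, F.Gam ε α σ x * T ε μ ν x
      = ∑ a, pd σ (F.co a α) x * ∑ b, F.co b μ x * ∑ c, F.co c ν x * t a b c x := by
    simp only [hT x hx, h3 α]
  simp only [cov03, hF.d_eq]
  rw [h2, h4, h5, h6]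
  simp only [mul_add, Finset.sum_add_distrib]
  ring

theorem pd_eq_along {f : Co n → ℝ} (μ : Fin n) (hx : x ∈ V) :
    pd μ f x = ∑ m, F.co m μ x * F.along m f x := by
  have h := sum_inv_sum (F.det_coMat_ne_zero (hF.det_ne x hx)) (fun γ => pd γ f x) μ
  simp only [F.coMat_inv (hF.det_ne x hx)] at h
  simp only [along, hF.d_eq]
  exact h.symm

/-- Term by term: the metric becomes a Kronecker delta, contractions become plain sums, and
covariant derivatives become derivatives along the frame. -/
theorem E_eq (μ ν : Fin n) (hx : x ∈ V) :
    F.E μ ν x = ∑ m, F.co m μ x * ∑ j, F.co j ν x * F.eF m j x := by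
  have hne := hF.det_ne x hx
  have hdet := F.det_coMat_ne_zero hne
  have hg : ∀ r, F.g μ ν x * r = ∑ m, F.co m μ x * ∑ j, F.co j ν x * (if m = j then r else 0) := by
    intro r
    simp only [g, Finset.sum_mul, mul_ite, mul_zero, Finset.sum_ite_eq, Finset.mem_univ, if_true,
      mul_assoc]
  have hC : F.C μ x * F.C ν x
      = ∑ m, F.co m μ x * ∑ j, F.co j ν x * (F.cF m x * F.cF j x) := by
    rw [F.C_eq hne, F.C_eq hne, Finset.sum_mul_sum]
    simp only [Finset.mul_sum]
    exact Finset.sum_congr rfl fun _ _ => Finset.sum_congr rfl fun _ _ => by ring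
  have hdiv : ∑ ε, F.cov10 F.CUp ε ε x = ∑ c, F.along c (F.cF c) x := by
    simp only [hF.cov10_eq hF.cF (fun y hy α => F.CUp_eq (hF.det_ne y hy) α) _ _ hx, along, hF.d_eq]
    rw [Finset.sum_comm]
  have hCC : ∑ ε, F.CUp ε x * F.C ε x = ∑ c, F.cF c x * F.cF c x := by
    have := sum_pairing hdet (fun b => F.cF b x) (fun b => F.cF b x)
    simp only [F.coMat_inv hne] at this
    simp only [F.CUp_eq hne, F.C_eq hne]
    exact this
  have hCT : ∑ ε, F.CUp ε x * F.TorLow μ ε ν x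
      = ∑ m, F.co m μ x * ∑ j, F.co j ν x * ∑ c, F.cF c x * F.tF m c j x := by
    have e1 : ∀ ε, F.TorLow μ ε ν x
        = ∑ b, F.co b ε x * ∑ m, F.co m μ x * ∑ j, F.co j ν x * F.tF m b j x := by
      intro ε
      rw [F.TorLow_eq hne]
      simp only [Finset.mul_sum]
      rw [Finset.sum_comm]
      exact Finset.sum_congr rfl fun _ _ => Finset.sum_congr rfl fun _ _ =>
        Finset.sum_congr rfl fun _ _ => by ring
    have := sum_pairing hdet (fun b => F.cF b x)
      (fun b => ∑ m, F.co m μ x * ∑ j, F.co j ν x * F.tF m b j x)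
    simp only [F.coMat_inv hne] at this
    simp only [F.CUp_eq hne, e1]
    refine this.trans ?_
    simp only [Finset.mul_sum]
    rw [Finset.sum_comm]
    refine Finset.sum_congr rfl fun _ _ => ?_
    rw [Finset.sum_comm]
    exact Finset.sum_congr rfl fun _ _ => Finset.sum_congr rfl fun _ _ => by ring
  have hcov : F.cov01 F.C ν μ x
      = ∑ m, F.co m μ x * ∑ j, F.co j ν x * F.along m (F.cF j) x := by
    rw [hF.cov01_eq hF.cF (fun y hy α => F.C_eq (hF.det_ne y hy) α) _ _ hx]
    simp only [hF.pd_eq_along μ hx, Finset.mul_sum]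
    rw [Finset.sum_comm]
    exact Finset.sum_congr rfl fun _ _ => Finset.sum_congr rfl fun _ _ => by ring
  have hdT : ∑ ε, ∑ α, F.gInv ε α x * F.cov03 F.TorLow μ ν α ε x
      = ∑ m, F.co m μ x * ∑ j, F.co j ν x * ∑ c, F.along c (F.tF m j c) x := by
    have e1 : ∀ ε α, F.cov03 F.TorLow μ ν α ε x
        = ∑ c, F.co c α x * ∑ m, F.co m μ x * ∑ j, F.co j ν x * pd ε (F.tF m j c) x := by
      intro ε α
      rw [hF.cov03_eq hF.tF (fun y hy α μ ν => F.TorLow_eq (hF.det_ne y hy) α μ ν) _ _ _ _ hx]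
      simp only [Finset.mul_sum]
      refine (Finset.sum_congr rfl fun a _ => Finset.sum_comm).trans (Finset.sum_comm.trans ?_)
      exact Finset.sum_congr rfl fun _ _ => Finset.sum_congr rfl fun _ _ =>
        Finset.sum_congr rfl fun _ _ => by ring
    have e2 : ∀ ε, ∑ α, F.gInv ε α x * F.cov03 F.TorLow μ ν α ε x
        = ∑ c, F.frame x c ε * ∑ m, F.co m μ x * ∑ j, F.co j ν x * pd ε (F.tF m j c) x := by
      intro ε
      have := sum_gInv hdet
        (fun c => ∑ m, F.co m μ x * ∑ j, F.co j ν x * pd ε (F.tF m j c) x) ε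
      simp only [F.coMat_inv hne] at this
      simp only [e1]
      exact this
    simp only [e2, along, hF.d_eq, Finset.mul_sum]
    refine (Finset.sum_congr rfl fun a _ => Finset.sum_comm).trans (Finset.sum_comm.trans ?_)
    refine Finset.sum_congr rfl fun m _ => ?_
    refine (Finset.sum_congr rfl fun a _ => Finset.sum_comm).trans (Finset.sum_comm.trans ?_)
    refine Finset.sum_congr rfl fun j _ => ?_
    rw [Finset.sum_comm]
    exact Finset.sum_congr rfl fun _ _ => Finset.sum_congr rfl fun _ _ => by ring
  have hassoc : ∀ r, 2 * F.g μ ν x * r = 2 * (F.g μ ν x * r) := fun r => mul_assoc _ _ _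
  rw [E, hassoc, hg, hg, mul_assoc 2 (F.C μ x), hC, hdiv, hCC, hCT, hcov, hdT, F.H_eq hne,
    F.tr_H_eq hne]
  simp only [eF, mul_add, mul_sub, Finset.sum_add_distrib, Finset.sum_sub_distrib,
    mul_left_comm _ (2 : ℝ) _, ← Finset.mul_sum]

/-- The contracted Bianchi identity of the canonical connection, in frame components. -/
theorem bianchi (m j : Fin n) (hx : x ∈ V) :
    (∑ c, F.along c (F.tF c j m) x) + F.along j (F.cF m) x - F.along m (F.cF j) x
      - ∑ c, F.cF c x * F.tF c j m x = 0 := by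
  have hne := hF.det_ne x hx
  -- Second derivatives of the coframe in frame components, symmetric in the last two indices. They
  -- are the only second-order terms, and this symmetry makes them cancel.
  let K : Fin n → Fin n → Fin n → Fin n → ℝ := fun a b c d =>
    ∑ μ, ∑ ν, ∑ σ, F.frame x b μ * F.frame x c ν * F.frame x d σ * pd σ (pd ν (F.co a μ)) x
  have hK : ∀ a b c d, K a b c d = K a b d c := by
    intro a b c d
    refine Finset.sum_congr rfl fun μ _ => ?_
    rw [Finset.sum_comm]
    refine Finset.sum_congr rfl fun ν _ => Finset.sum_congr rfl fun σ _ => ?_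
    rw [pd_comm hF.isOpen (hF.co a μ) hx]
    ring
  have hG : ∀ a b c, F.GamF a b c
      = fun y => ∑ μ, F.frame y b μ * ∑ ν, F.frame y c ν * pd ν (F.co a μ) y := by
    intro a b c
    funext y
    simp only [GamF, along, hF.d_eq]
  -- Besides the second derivatives, the two frame vectors inside $\Gamma_{abc}$ are differentiated,
  -- each by `along_frame`.
  have hd : ∀ a b c d, F.along d (F.GamF a b c) x
      = -(∑ f, F.GamF f b d x * F.GamF a f c x) - (∑ f, F.GamF f c d x * F.GamF a b f x)
        + K a b c d := by
    intro a b c d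
    have s1 : ∀ μ ν, ContDiffOn ℝ ∞ (fun y => F.frame y c ν * pd ν (F.co a μ) y) V :=
      fun μ ν => (hF.smooth c ν).mul (contDiffOn_pd hF.isOpen (hF.co a μ) ν)
    have s2 : ∀ μ, ContDiffOn ℝ ∞ (fun y => ∑ ν, F.frame y c ν * pd ν (F.co a μ) y) V :=
      fun μ => ContDiffOn.sum fun ν _ => s1 μ ν
    have e2 : F.along d (F.GamF a b c) x
        = ∑ μ, ((-∑ f, F.frame x f μ * F.GamF f b d x) * (∑ ν, F.frame x c ν * pd ν (F.co a μ) x)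
          + F.frame x b μ * ∑ ν, ((-∑ f, F.frame x f ν * F.GamF f c d x) * pd ν (F.co a μ) x
            + F.frame x c ν * F.along d (pd ν (F.co a μ)) x)) := by
      rw [hG, hF.along_sum d hx fun μ => (hF.smooth b μ).mul (s2 μ)]
      refine Finset.sum_congr rfl fun μ _ => ?_
      rw [hF.along_mul d hx (hF.smooth b μ) (s2 μ), hF.along_sum d hx (s1 μ),
        hF.along_frame b d μ hx]
      congr 2
      refine Finset.sum_congr rfl fun ν _ => ?_
      rw [hF.along_mul d hx (hF.smooth c ν) (contDiffOn_pd hF.isOpen (hF.co a μ) ν),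
        hF.along_frame c d ν hx]
    have e3 : ∑ f, F.GamF f b d x * F.GamF a f c x
        = ∑ μ, (∑ f, F.frame x f μ * F.GamF f b d x) * ∑ ν, F.frame x c ν * pd ν (F.co a μ) x := by
      have : ∀ f, F.GamF f b d x * F.GamF a f c x = F.GamF f b d x *
          ∑ μ, F.frame x f μ * ∑ ν, F.frame x c ν * pd ν (F.co a μ) x := fun f => by rw [hG a f c]
      rw [Finset.sum_congr rfl fun f _ => this f]
      have hS : ∀ S : Fin n → ℝ, ∑ f, F.GamF f b d x * ∑ μ, F.frame x f μ * S μ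
          = ∑ μ, (∑ f, F.frame x f μ * F.GamF f b d x) * S μ := by
        intro S
        simp only [Finset.mul_sum, Finset.sum_mul]
        rw [Finset.sum_comm]
        exact Finset.sum_congr rfl fun _ _ => Finset.sum_congr rfl fun _ _ => by ring
      exact hS _
    have e4 : ∑ f, F.GamF f c d x * F.GamF a b f x
        = ∑ μ, F.frame x b μ *
          ∑ ν, (∑ f, F.frame x f ν * F.GamF f c d x) * pd ν (F.co a μ) x := by
      have : ∀ f, F.GamF f c d x * F.GamF a b f x = F.GamF f c d x *
          ∑ μ, F.frame x b μ * ∑ ν, F.frame x f ν * pd ν (F.co a μ) x := fun f => by rw [hG a b f]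
      rw [Finset.sum_congr rfl fun f _ => this f]
      simp only [Finset.mul_sum, Finset.sum_mul]
      rw [Finset.sum_comm]
      refine Finset.sum_congr rfl fun μ _ => ?_
      rw [Finset.sum_comm]
      exact Finset.sum_congr rfl fun _ _ => Finset.sum_congr rfl fun _ _ => by ring
    have e5 : K a b c d
        = ∑ μ, F.frame x b μ * ∑ ν, F.frame x c ν * F.along d (pd ν (F.co a μ)) x := by
      simp only [K, along, hF.d_eq, Finset.mul_sum]
      exact Finset.sum_congr rfl fun _ _ => Finset.sum_congr rfl fun _ _ =>
        Finset.sum_congr rfl fun _ _ => by ring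
    rw [e2, e3, e4, e5]
    simp only [neg_mul, mul_add, Finset.sum_add_distrib, Finset.sum_neg_distrib, mul_neg]
    ring
  have hGs : ∀ a b c, ContDiffOn ℝ ∞ (F.GamF a b c) V := by
    intro a b c
    unfold GamF along
    simp only [hF.d_eq]
    exact ContDiffOn.sum fun μ _ => (hF.smooth b μ).mul <| ContDiffOn.sum fun ν _ =>
      (hF.smooth c ν).mul (contDiffOn_pd hF.isOpen (hF.co a μ) ν)
  have ht : ∀ a b c d, F.along d (F.tF a b c) x
      = (∑ f, (F.GamF f c d x * F.tF a f b x - F.GamF f b d x * F.tF a f c x))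
        + K a b c d - K a c b d := by
    intro a b c d
    rw [hF.along_congr d hx (g := fun y => F.GamF a b c y - F.GamF a c b y)
      fun y hy => F.tF_eq_GamF (hF.det_ne y hy) a b c, hF.along_sub d hx (hGs a b c) (hGs a c b),
      hd, hd]
    simp only [F.tF_eq_GamF hne, mul_sub, Finset.sum_sub_distrib]
    ring
  -- The remaining quadratic terms agree only after summation: the names $a$ and $f$ must be
  -- exchanged. With this difference inserted, the rest is an identity for each pair $(a,f)$.
  have hswap : ∑ a, ∑ f, F.tF a f j x * F.tF f m a x = ∑ a, ∑ f, F.tF a f m x * F.tF f j a x := by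
    rw [Finset.sum_comm]
    refine Finset.sum_congr rfl fun f _ => Finset.sum_congr rfl fun a _ => ?_
    rw [F.tF_antisymm a f j, F.tF_antisymm f a m]
    ring
  have hc : ∑ c, F.cF c x * F.tF c j m x = ∑ a, ∑ f, F.tF a f a x * F.tF f j m x := by
    rw [Finset.sum_comm]
    simp only [FrameCalculus.cF, trT, Finset.sum_mul]
  rw [hF.along_cF m j hx, hF.along_cF j m hx, hc, ← Finset.sum_add_distrib,
    ← Finset.sum_sub_distrib]
  rw [← sub_eq_zero] at hswap
  rw [← Finset.sum_sub_distrib, ← hswap, ← Finset.sum_sub_distrib]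
  refine Finset.sum_congr rfl fun a _ => ?_
  rw [ht, ht, ht, hK a m j a, hK a j m a, hK a a m j]
  have : ∀ p q r k l s : ℝ, p + k - l + (q + l - s) - (r + k - s) = p + q - r := by
    intros; ring
  rw [this, ← Finset.sum_add_distrib, ← Finset.sum_sub_distrib, ← Finset.sum_sub_distrib,
    ← Finset.sum_sub_distrib]
  refine Finset.sum_congr rfl fun f _ => ?_
  rw [F.tF_eq_GamF hne f m a, F.tF_eq_GamF hne f j a, F.tF_eq_GamF hne f j m]
  ring

/-- The variation contains $\lambda_c(t_{cjm})$ and $\lambda_j(c_m)$ where $E$ has $\lambda_m(c_j)$.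
The contracted Bianchi identity trades one for the other. -/
theorem elF_eq_eF (m j : Fin n) (hx : x ∈ V) : F.elF m j x = F.eF m j x := by
  have hif : ∀ f : Fin n → ℝ, ∑ c, (if m = j then f c else 0) = if m = j then ∑ c, f c else 0 := by
    intro f
    split_ifs <;> simp
  have e1 : ∑ c, F.along c (fun y => momT (fun a b c => F.tF a b c y) m c j) x
      = (∑ c, F.along c (F.tF m j c) x) - (∑ c, F.along c (F.tF c j m) x) - F.along j (F.cF m) x
        + (if m = j then ∑ c, F.along c (F.cF c) x else 0) := by
    simp only [hF.along_momF _ _ _ _ hx, Finset.sum_add_distrib, Finset.sum_sub_distrib, hif,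
      Finset.sum_ite_eq', Finset.mem_univ, if_true]
  have e2 : ∑ c, F.cF c x * momT (fun a b c => F.tF a b c x) m c j
      = (∑ c, F.cF c x * F.tF m j c x) - (∑ c, F.cF c x * F.tF c j m x) - F.cF m x * F.cF j x
        + (if m = j then ∑ c, F.cF c x * F.cF c x else 0) := by
    change ∑ c, F.cF c x * (F.tF m j c x - F.tF c j m x - (if c = j then F.cF m x else 0)
      + (if m = j then F.cF c x else 0)) = _
    simp only [mul_add, mul_sub, mul_ite, mul_zero, Finset.sum_add_distrib,
      Finset.sum_sub_distrib, hif, Finset.sum_ite_eq', Finset.mem_univ, if_true]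
    ring
  -- This contraction cancels the products $t_{mac}t_{ajc}$ and $c_at_{maj}$ of `forceT`.
  have e3 : ∑ a, ∑ c, F.tF m a c x * momT (fun a b c => F.tF a b c x) a c j
      = 2 * (∑ a, ∑ c, F.tF m a c x * F.tF a j c x) + 2 * ∑ c, F.cF c x * F.tF m j c x := by
    have h1 : ∑ a, ∑ c, F.tF m a c x * F.tF c j a x
        = -∑ a, ∑ c, F.tF m a c x * F.tF a j c x := by
      rw [Finset.sum_comm]
      simp only [← Finset.sum_neg_distrib]
      refine Finset.sum_congr rfl fun a _ => Finset.sum_congr rfl fun c _ => ?_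
      rw [F.tF_antisymm m a c]
      ring
    have h2 : ∑ a, F.tF m a j x * F.cF a x = -∑ c, F.cF c x * F.tF m j c x := by
      rw [← Finset.sum_neg_distrib]
      refine Finset.sum_congr rfl fun c _ => ?_
      rw [F.tF_antisymm m j c]
      ring
    have h3 : ∑ a, ∑ c, (if a = j then F.tF m a c x * F.cF c x else 0)
        = ∑ c, F.cF c x * F.tF m j c x := by
      rw [Finset.sum_comm]
      simp only [Finset.sum_ite_eq', Finset.mem_univ, if_true, mul_comm]
    change ∑ a, ∑ c, F.tF m a c x * (F.tF a j c x - F.tF c j a x - (if c = j then F.cF a x else 0)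
      + (if a = j then F.cF c x else 0)) = _
    simp only [mul_add, mul_sub, mul_ite, mul_zero, Finset.sum_add_distrib,
      Finset.sum_sub_distrib]
    rw [h1, h3]
    simp only [Finset.sum_ite_eq', Finset.mem_univ, if_true]
    rw [h2]
    ring
  have e4 : ∑ a, F.cF a x * F.tF m a j x = -∑ c, F.cF c x * F.tF m j c x := by
    rw [← Finset.sum_neg_distrib]
    refine Finset.sum_congr rfl fun c _ => ?_
    rw [F.tF_antisymm m j c]
    ring
  have e5 : forceT (fun a b c => F.tF a b c x) m j
      = (if m = j then quadT (fun a b c => F.tF a b c x) else 0)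
        - 2 * (∑ a, ∑ c, F.tF m a c x * F.tF a j c x)
        - 2 * (∑ e, ∑ a, F.tF e a m x * F.tF a e j x) + 2 * (F.cF m x * F.cF j x)
        + 2 * ∑ a, F.cF a x * F.tF m a j x := rfl
  have e6 : hT (fun a b c => F.tF a b c x) m j
      = (∑ e, ∑ a, F.tF e a m x * F.tF a e j x) - F.cF m x * F.cF j x := rfl
  have hb := hF.bianchi m j hx
  rw [elF, eF, e1, e2, e3, e5, e6, e4]
  split_ifs <;> linear_combination 2 * hb

/-- The Euler-Lagrange expression of the Lagrangian of Mikhail and Wanas in explicit form. -/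
theorem lowerEL_eulerLagrange (μ ν : Fin n) (hx : x ∈ V) :
    F.lowerEL F.eulerLagrange μ ν x = F.E μ ν x := by
  simp only [hF.lowerEL_eq μ ν hx, hF.E_eq μ ν hx, hF.elF_eq_eF _ _ hx]

end IsSmoothOn
end Smooth
end FrameCalculus
-- Transport of all derived objects along a projection
namespace FrameCalculus

section Projection

variable {n : ℕ} {X Y : Type}

/-- Over `U`, the frame and the derivations of `F` project to those of `G` along `φ`. -/
structure ProjectsTo (F : FrameCalculus n X) (G : FrameCalculus n Y) (φ : X → Y) (U : Set X) :
    Prop where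
  frame : ∀ p ∈ U, F.frame p = G.frame (φ p)
  d : ∀ (f : X → ℝ) (f' : Y → ℝ), (∀ p ∈ U, f p = f' (φ p)) →
    ∀ ν, ∀ p ∈ U, F.d ν f p = G.d ν f' (φ p)

namespace ProjectsTo

variable {F : FrameCalculus n X} {G : FrameCalculus n Y} {φ : X → Y} {U : Set X}
  (h : F.ProjectsTo G φ U)
include h

/-- Here and below equality is recorded on all of $U$, not at one point, because `ProjectsTo.d`
requires that before a quantity may be differentiated. -/
theorem co (i μ : Fin n) : ∀ p ∈ U, F.co i μ p = G.co i μ (φ p) := fun p hp => by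
  simp only [FrameCalculus.co, h.frame p hp]

theorem coMat : ∀ p ∈ U, F.coMat p = G.coMat (φ p) := fun p hp => by
  simp only [FrameCalculus.coMat, h.co _ _ p hp]

theorem g (μ ν : Fin n) : ∀ p ∈ U, F.g μ ν p = G.g μ ν (φ p) := fun p hp => by
  simp only [FrameCalculus.g, h.co _ _ p hp]

theorem gInv (μ ν : Fin n) : ∀ p ∈ U, F.gInv μ ν p = G.gInv μ ν (φ p) := fun p hp => by
  simp only [FrameCalculus.gInv, h.frame p hp]

theorem dco : ∀ p ∈ U, F.dco p = G.dco (φ p) := fun p hp => by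
  funext i μ ν
  exact h.d _ _ (h.co i μ) ν p hp

theorem Gam (α μ ν : Fin n) : ∀ p ∈ U, F.Gam α μ ν p = G.Gam α μ ν (φ p) := fun p hp => by
  simp only [FrameCalculus.Gam, h.frame p hp, h.d _ _ (h.co _ _) _ p hp]

theorem Gam0 (α μ ν : Fin n) : ∀ p ∈ U, F.Gam0 α μ ν p = G.Gam0 α μ ν (φ p) := fun p hp => by
  simp only [FrameCalculus.Gam0, h.gInv _ _ p hp, h.d _ _ (h.g _ _) _ p hp]

theorem Tor (α μ ν : Fin n) : ∀ p ∈ U, F.Tor α μ ν p = G.Tor α μ ν (φ p) := fun p hp => by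
  simp only [FrameCalculus.Tor, h.Gam _ _ _ p hp]

theorem gam (α μ ν : Fin n) : ∀ p ∈ U, F.gam α μ ν p = G.gam α μ ν (φ p) := fun p hp => by
  simp only [FrameCalculus.gam, h.Gam _ _ _ p hp, h.Gam0 _ _ _ p hp]

theorem Om (α μ ν : Fin n) : ∀ p ∈ U, F.Om α μ ν p = G.Om α μ ν (φ p) := fun p hp => by
  simp only [FrameCalculus.Om, h.gam _ _ _ p hp]

theorem C (μ : Fin n) : ∀ p ∈ U, F.C μ p = G.C μ (φ p) := fun p hp => by
  simp only [FrameCalculus.C, h.Tor _ _ _ p hp]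

theorem CUp (μ : Fin n) : ∀ p ∈ U, F.CUp μ p = G.CUp μ (φ p) := fun p hp => by
  simp only [FrameCalculus.CUp, h.gInv _ _ p hp, h.C _ p hp]

theorem TorLow (α μ ν : Fin n) : ∀ p ∈ U, F.TorLow α μ ν p = G.TorLow α μ ν (φ p) :=
  fun p hp => by simp only [FrameCalculus.TorLow, h.g _ _ p hp, h.Tor _ _ _ p hp]

theorem gamLow (α μ ν : Fin n) : ∀ p ∈ U, F.gamLow α μ ν p = G.gamLow α μ ν (φ p) :=
  fun p hp => by simp only [FrameCalculus.gamLow, h.g _ _ p hp, h.gam _ _ _ p hp]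

theorem gamUp3 (α μ ν : Fin n) : ∀ p ∈ U, F.gamUp3 α μ ν p = G.gamUp3 α μ ν (φ p) :=
  fun p hp => by simp only [FrameCalculus.gamUp3, h.gInv _ _ p hp, h.gamLow _ _ _ p hp]

theorem cov10 {W : Fin n → X → ℝ} {W' : Fin n → Y → ℝ}
    (hW : ∀ α, ∀ p ∈ U, W α p = W' α (φ p)) (α σ : Fin n) :
    ∀ p ∈ U, F.cov10 W α σ p = G.cov10 W' α σ (φ p) := fun p hp => by
  simp only [FrameCalculus.cov10, h.d _ _ (hW _) _ p hp, h.Gam _ _ _ p hp, hW _ p hp]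

theorem cov01 {W : Fin n → X → ℝ} {W' : Fin n → Y → ℝ}
    (hW : ∀ α, ∀ p ∈ U, W α p = W' α (φ p)) (μ σ : Fin n) :
    ∀ p ∈ U, F.cov01 W μ σ p = G.cov01 W' μ σ (φ p) := fun p hp => by
  simp only [FrameCalculus.cov01, h.d _ _ (hW _) _ p hp, h.Gam _ _ _ p hp, hW _ p hp]

theorem cov12 {T : Fin n → Fin n → Fin n → X → ℝ} {T' : Fin n → Fin n → Fin n → Y → ℝ}
    (hT : ∀ α μ ν, ∀ p ∈ U, T α μ ν p = T' α μ ν (φ p)) (α μ ν σ : Fin n) :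
    ∀ p ∈ U, F.cov12 T α μ ν σ p = G.cov12 T' α μ ν σ (φ p) := fun p hp => by
  simp only [FrameCalculus.cov12, h.d _ _ (hT _ _ _) _ p hp, h.Gam _ _ _ p hp, hT _ _ _ p hp]

theorem cov03 {T : Fin n → Fin n → Fin n → X → ℝ} {T' : Fin n → Fin n → Fin n → Y → ℝ}
    (hT : ∀ α μ ν, ∀ p ∈ U, T α μ ν p = T' α μ ν (φ p)) (α μ ν σ : Fin n) :
    ∀ p ∈ U, F.cov03 T α μ ν σ p = G.cov03 T' α μ ν σ (φ p) := fun p hp => by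
  simp only [FrameCalculus.cov03, h.d _ _ (hT _ _ _) _ p hp, h.Gam _ _ _ p hp, hT _ _ _ p hp]

theorem table (k : Fin 13) (μ ν : Fin n) :
    ∀ p ∈ U, F.table k μ ν p = G.table k μ ν (φ p) := fun p hp => by
  fin_cases k
  · change F.xi μ ν p = G.xi μ ν (φ p)
    simp only [xi, h.cov12 h.gamUp3 _ _ _ _ p hp]
  · change F.gam2 μ ν p = G.gam2 μ ν (φ p)
    simp only [gam2, h.C _ p hp, h.gamUp3 _ _ _ p hp]
  · change F.eta μ ν p = G.eta μ ν (φ p)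
    simp only [eta, h.C _ p hp, h.Tor _ _ _ p hp]
  · change F.phi μ ν p = G.phi μ ν (φ p)
    simp only [phi, h.C _ p hp, h.Om _ _ _ p hp]
  · change F.chi μ ν p = G.chi μ ν (φ p)
    simp only [chi, h.cov12 h.Tor _ _ _ _ p hp]
  · change F.psi μ ν p = G.psi μ ν (φ p)
    simp only [psi, h.cov12 h.Om _ _ _ _ p hp]
  · change F.eps μ ν p = G.eps μ ν (φ p)
    simp only [eps, h.cov01 h.C _ _ p hp]
  · change F.theta μ ν p = G.theta μ ν (φ p)
    simp only [theta, h.cov01 h.C _ _ p hp]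
  · change F.kappa μ ν p = G.kappa μ ν (φ p)
    simp only [kappa, h.gam _ _ _ p hp]
  · change F.varpi μ ν p = G.varpi μ ν (φ p)
    simp only [varpi, h.gam _ _ _ p hp]
  · change F.sig μ ν p = G.sig μ ν (φ p)
    simp only [sig, h.gam _ _ _ p hp]
  · change F.om μ ν p = G.om μ ν (φ p)
    simp only [om, h.gam _ _ _ p hp]
  · change F.al μ ν p = G.al μ ν (φ p)
    simp only [al, h.C _ p hp]

theorem tr {T : Fin n → Fin n → X → ℝ} {T' : Fin n → Fin n → Y → ℝ}
    (hT : ∀ μ ν, ∀ p ∈ U, T μ ν p = T' μ ν (φ p)) :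
    ∀ p ∈ U, F.tr T p = G.tr T' (φ p) := fun p hp => by
  simp only [FrameCalculus.tr, h.gInv _ _ p hp, hT _ _ p hp]

theorem energyMomentum (μ ν : Fin n) :
    ∀ p ∈ U, F.energyMomentum μ ν p = G.energyMomentum μ ν (φ p) := fun p hp => by
  have h1 : ∀ μ ν, ∀ p ∈ U, F.sig μ ν p = G.sig μ ν (φ p) := h.table 10
  have h2 : ∀ μ ν, ∀ p ∈ U, F.varpi μ ν p = G.varpi μ ν (φ p) := h.table 9
  simp only [FrameCalculus.energyMomentum, h.g _ _ p hp, h.tr h1 p hp, h.tr h2 p hp, h1 _ _ p hp,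
    h2 _ _ p hp]

theorem emField (μ ν : Fin n) : ∀ p ∈ U, F.emField μ ν p = G.emField μ ν (φ p) := fun p hp => by
  have h1 : F.gam2 μ ν p = G.gam2 μ ν (φ p) := h.table 1 μ ν p hp
  have h2 : F.xi μ ν p = G.xi μ ν (φ p) := h.table 0 μ ν p hp
  have h3 : F.eta μ ν p = G.eta μ ν (φ p) := h.table 2 μ ν p hp
  simp only [FrameCalculus.emField, h1, h2, h3]

theorem H (μ ν : Fin n) : ∀ p ∈ U, F.H μ ν p = G.H μ ν (φ p) := fun p hp => by
  simp only [FrameCalculus.H, h.Tor _ _ _ p hp, h.C _ p hp]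

theorem E (μ ν : Fin n) : ∀ p ∈ U, F.E μ ν p = G.E μ ν (φ p) := fun p hp => by
  simp only [FrameCalculus.E, h.g _ _ p hp, h.tr h.H p hp, h.H _ _ p hp, h.C _ p hp,
    h.cov10 h.CUp _ _ p hp, h.CUp _ p hp, h.TorLow _ _ _ p hp, h.cov01 h.C _ _ p hp,
    h.gInv _ _ p hp, h.cov03 h.TorLow _ _ _ _ p hp]

theorem lowerEL {Z : Fin n → Fin n → X → ℝ} {Z' : Fin n → Fin n → Y → ℝ}
    (hZ : ∀ j β, ∀ p ∈ U, Z j β p = Z' j β (φ p)) (μ ν : Fin n) :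
    ∀ p ∈ U, F.lowerEL Z μ ν p = G.lowerEL Z' μ ν (φ p) := fun p hp => by
  simp only [FrameCalculus.lowerEL, h.g _ _ p hp, h.coMat p hp, hZ _ _ p hp, h.co _ _ p hp]

end ProjectsTo

end Projection

/-! ### Frames with closed covectors: everything vanishes -/

section Symmetric

variable {n : ℕ} {X : Type}

/-- A frame calculus whose covectors `λ_i` are closed on `U`. -/
structure IsClosedOn (F : FrameCalculus n X) (U : Set X) : Prop where
  det_ne : ∀ p ∈ U, (F.frame p).det ≠ 0
  d_zero : ∀ f : X → ℝ, (∀ p ∈ U, f p = 0) → ∀ ν, ∀ p ∈ U, F.d ν f p = 0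
  d_g : ∀ μ ν σ, ∀ p ∈ U, F.d σ (F.g μ ν) p
    = ∑ i, (F.d σ (F.co i μ) p * F.co i ν p + F.co i μ p * F.d σ (F.co i ν) p)
  symm : ∀ i μ ν, ∀ p ∈ U, F.d ν (F.co i μ) p = F.d μ (F.co i ν) p

namespace IsClosedOn

variable {F : FrameCalculus n X} {U : Set X} (h : F.IsClosedOn U)
include h

theorem Tor (α μ ν : Fin n) : ∀ p ∈ U, F.Tor α μ ν p = 0 := fun p hp => by
  simp only [FrameCalculus.Tor, Gam, h.symm _ μ ν p hp, sub_self]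

theorem C (μ : Fin n) : ∀ p ∈ U, F.C μ p = 0 := fun p hp => by
  simp only [FrameCalculus.C, h.Tor _ _ _ p hp, Finset.sum_const_zero]

/-- Uniqueness of the Levi-Civita connection: by closedness the Koszul combination collapses to
$2\lambda_{i\epsilon}\,d_\nu\lambda_{i\mu}$, and raising $\epsilon$ gives the canonical connection.
-/
theorem gam (α μ ν : Fin n) : ∀ p ∈ U, F.gam α μ ν p = 0 := fun p hp => by
  have hdet := F.det_coMat_ne_zero (h.det_ne p hp)
  have h1 : ∀ ε, F.d μ (F.g ε ν) p + F.d ν (F.g ε μ) p - F.d ε (F.g μ ν) p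
      = 2 * ∑ i, F.co i ε p * F.d ν (F.co i μ) p := by
    intro ε
    rw [h.d_g _ _ _ p hp, h.d_g _ _ _ p hp, h.d_g _ _ _ p hp, Finset.mul_sum,
      ← Finset.sum_add_distrib, ← Finset.sum_sub_distrib]
    refine Finset.sum_congr rfl fun i _ => ?_
    rw [h.symm i ε μ p hp, h.symm i ε ν p hp, h.symm i ν μ p hp]
    ring
  have h2 := sum_gInv hdet (fun i => F.d ν (F.co i μ) p) α
  simp only [F.coMat_inv (h.det_ne p hp)] at h2
  have h3 : ∑ ε, F.gInv α ε p * ∑ i, F.co i ε p * F.d ν (F.co i μ) p = F.Gam α μ ν p := h2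
  simp only [FrameCalculus.gam, Gam0, h1, mul_left_comm _ (2 : ℝ) _, ← Finset.mul_sum, h3]
  ring

theorem Om (α μ ν : Fin n) : ∀ p ∈ U, F.Om α μ ν p = 0 := fun p hp => by
  simp only [FrameCalculus.Om, h.gam _ _ _ p hp, add_zero]

theorem gamUp3 (α μ ν : Fin n) : ∀ p ∈ U, F.gamUp3 α μ ν p = 0 := fun p hp => by
  simp only [FrameCalculus.gamUp3, gamLow, h.gam _ _ _ p hp, mul_zero, Finset.sum_const_zero]

theorem cov01 {W : Fin n → X → ℝ} (hW : ∀ α, ∀ p ∈ U, W α p = 0) (μ σ : Fin n) :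
    ∀ p ∈ U, F.cov01 W μ σ p = 0 := fun p hp => by
  simp [FrameCalculus.cov01, h.d_zero _ (hW _) _ p hp, hW _ p hp]

theorem cov10 {W : Fin n → X → ℝ} (hW : ∀ α, ∀ p ∈ U, W α p = 0) (μ σ : Fin n) :
    ∀ p ∈ U, F.cov10 W μ σ p = 0 := fun p hp => by
  simp [FrameCalculus.cov10, h.d_zero _ (hW _) _ p hp, hW _ p hp]

theorem cov12 {T : Fin n → Fin n → Fin n → X → ℝ} (hT : ∀ α μ ν, ∀ p ∈ U, T α μ ν p = 0)
    (α μ ν σ : Fin n) : ∀ p ∈ U, F.cov12 T α μ ν σ p = 0 := fun p hp => by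
  simp [FrameCalculus.cov12, h.d_zero _ (hT _ _ _) _ p hp, hT _ _ _ p hp]

theorem cov03 {T : Fin n → Fin n → Fin n → X → ℝ} (hT : ∀ α μ ν, ∀ p ∈ U, T α μ ν p = 0)
    (α μ ν σ : Fin n) : ∀ p ∈ U, F.cov03 T α μ ν σ p = 0 := fun p hp => by
  simp [FrameCalculus.cov03, h.d_zero _ (hT _ _ _) _ p hp, hT _ _ _ p hp]

theorem table (k : Fin 13) (μ ν : Fin n) : ∀ p ∈ U, F.table k μ ν p = 0 := fun p hp => by
  fin_cases k
  · change F.xi μ ν p = 0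
    simp [xi, h.cov12 h.gamUp3 _ _ _ _ p hp]
  · change F.gam2 μ ν p = 0
    simp [gam2, h.C _ p hp]
  · change F.eta μ ν p = 0
    simp [eta, h.C _ p hp]
  · change F.phi μ ν p = 0
    simp [phi, h.C _ p hp]
  · change F.chi μ ν p = 0
    simp [chi, h.cov12 h.Tor _ _ _ _ p hp]
  · change F.psi μ ν p = 0
    simp [psi, h.cov12 h.Om _ _ _ _ p hp]
  · change F.eps μ ν p = 0
    simp [eps, h.cov01 h.C _ _ p hp]
  · change F.theta μ ν p = 0
    simp [theta, h.cov01 h.C _ _ p hp]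
  · change F.kappa μ ν p = 0
    simp [kappa, h.gam _ _ _ p hp]
  · change F.varpi μ ν p = 0
    simp [varpi, h.gam _ _ _ p hp]
  · change F.sig μ ν p = 0
    simp [sig, h.gam _ _ _ p hp]
  · change F.om μ ν p = 0
    simp [om, h.gam _ _ _ p hp]
  · change F.al μ ν p = 0
    simp [al, h.C _ p hp]

theorem E (μ ν : Fin n) : ∀ p ∈ U, F.E μ ν p = 0 := fun p hp => by
  have hCUp : ∀ μ, ∀ p ∈ U, F.CUp μ p = 0 := fun μ p hp => by simp [CUp, h.C _ p hp]
  have hTL : ∀ α μ ν, ∀ p ∈ U, F.TorLow α μ ν p = 0 := fun α μ ν p hp => by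
    simp [TorLow, h.Tor _ _ _ p hp]
  have hH : ∀ μ ν, F.H μ ν p = 0 := fun μ ν => by simp [H, h.Tor _ _ _ p hp, h.C _ p hp]
  simp [FrameCalculus.E, tr, hH, h.C _ p hp, h.cov10 hCUp _ _ p hp, hCUp _ p hp,
    h.cov01 h.C _ _ p hp, h.cov03 hTL _ _ _ _ p hp]

/-- The Lagrangian is quadratic in $t$, and $t=0$ on $U$; so both of its first partial derivatives
vanish there. -/
theorem eulerLagrange (j β : Fin n) : ∀ p ∈ U, F.eulerLagrange j β p = 0 := fun p hp => by
  have ht : ∀ q ∈ U, jetT (F.coMat q) (F.dco q) = fun _ _ _ => 0 := by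
    intro q hq
    funext a b c
    simp [jetT, dco, h.symm _ _ _ q hq]
  have hc : trT (n := n) (fun _ _ _ => 0) = fun _ => 0 := by funext b; simp [trT]
  have hB : ∀ γ, F.d γ (fun q => dB lagrangian j β γ (F.coMat q) (F.dco q)) p = 0 := fun γ =>
    h.d_zero _ (fun q hq => by
      rw [dB_lagrangian (F.det_coMat_ne_zero (h.det_ne q hq)), ht q hq]
      simp [momT, hc]) γ p hp
  rw [FrameCalculus.eulerLagrange, dA_lagrangian (F.det_coMat_ne_zero (h.det_ne p hp)), ht p hp]
  simp [hB, forceT, quadT, hc]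

end IsClosedOn

end Symmetric

end FrameCalculus

/-! ### Derivatives in $x$, in $y$ and along $\delta_\mu$ -/

section FibreDerivatives

variable {n : ℕ} {f g : Co n × Co n → ℝ} {f' : Co n → ℝ} {p : Co n × Co n}

/-- No differentiability is assumed: restriction to a slice of constant $y$ shows that $f'$ is
differentiable whenever its pullback is, and otherwise both derivatives take the default value zero.
This is why `ProjectsTo.d` can be required for arbitrary functions. -/
theorem fderiv_comp_fst (h : f =ᶠ[nhds p] fun q => f' q.1) (v : Co n × Co n) :
    fderiv ℝ f p v = fderiv ℝ f' p.1 v.1 := by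
  rw [h.fderiv_eq]
  by_cases hd : DifferentiableAt ℝ f' p.1
  · have := hd.hasFDerivAt.comp p (hasFDerivAt_fst (𝕜 := ℝ) (E := Co n) (F := Co n) (p := p))
    rw [show (fun q : Co n × Co n => f' q.1) = f' ∘ Prod.fst from rfl, this.fderiv]
    rfl
  · have hd' : ¬ DifferentiableAt ℝ (fun q : Co n × Co n => f' q.1) p := by
      intro h1
      refine hd ?_
      have h2 : DifferentiableAt ℝ (fun x : Co n => (x, p.2)) p.1 :=
        differentiableAt_id.prodMk (differentiableAt_const _)
      exact DifferentiableAt.comp (f := fun x : Co n => (x, p.2)) p.1 h1 h2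
    rw [fderiv_zero_of_not_differentiableAt hd, fderiv_zero_of_not_differentiableAt hd']
    rfl

theorem pdx_comp_fst (h : f =ᶠ[nhds p] fun q => f' q.1) (μ : Fin n) : pdx μ f p = pd μ f' p.1 :=
  fderiv_comp_fst h _

theorem pdy_comp_fst (h : f =ᶠ[nhds p] fun q => f' q.1) (a : Fin n) : pdy a f p = 0 := by
  rw [pdy, fderiv_comp_fst h]
  simp

theorem hd_comp_fst (h : f =ᶠ[nhds p] fun q => f' q.1) (N : Co n × Co n → Fin n → Fin n → ℝ)
    (μ : Fin n) : hd N μ f p = pd μ f' p.1 := by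
  simp [hd, pdx_comp_fst h, pdy_comp_fst h]

/-- At a point, $\delta_\mu$ is the derivative in one fixed direction, so the sum and product rules
for `fderiv` serve for it too. -/
theorem hd_eq_fderiv (N : Co n × Co n → Fin n → Fin n → ℝ) (μ : Fin n) :
    hd N μ f p = fderiv ℝ f p
      (EuclideanSpace.single μ 1, -∑ a, N p a μ • EuclideanSpace.single a (1 : ℝ)) := by
  have : ((EuclideanSpace.single μ 1, -∑ a, N p a μ • EuclideanSpace.single a (1 : ℝ)) :
      Co n × Co n) = (EuclideanSpace.single μ 1, 0)
        - ∑ a, N p a μ • ((0, EuclideanSpace.single a 1) : Co n × Co n) := by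
    ext : 1 <;> simp [Prod.fst_sum, Prod.snd_sum]
  rw [this, map_sub, map_sum]
  simp only [map_smul, smul_eq_mul]
  rfl

theorem fderiv_mul_apply (hf : DifferentiableAt ℝ f p) (hg : DifferentiableAt ℝ g p)
    (v : Co n × Co n) :
    fderiv ℝ (fun q => f q * g q) p v = fderiv ℝ f p v * g p + f p * fderiv ℝ g p v := by
  rw [fderiv_fun_mul hf hg]
  simp
  ring

theorem fderiv_sum_apply {ι : Type*} [Fintype ι] {f : ι → Co n × Co n → ℝ}
    (hf : ∀ i, DifferentiableAt ℝ (f i) p) (v : Co n × Co n) :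
    fderiv ℝ (fun q => ∑ i, f i q) p v = ∑ i, fderiv ℝ (f i) p v := by
  rw [fderiv_fun_sum fun i _ => hf i]
  simp

theorem fderiv_zero_on {U : Set (Co n × Co n)} (hU : IsOpen U) (hf : ∀ q ∈ U, f q = 0)
    (hp : p ∈ U) (v : Co n × Co n) : fderiv ℝ f p v = 0 := by
  have : f =ᶠ[nhds p] fun _ => 0 := by
    filter_upwards [hU.mem_nhds hp] with q hq using hf q hq
  rw [this.fderiv_eq]
  simp

end FibreDerivatives

/-! ### Consequences of the Cartan and Berwald conditions in a chart -/

namespace LocalEAP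

variable {n : ℕ}

/-- A smooth EAP-space of both Cartan and Berwald type on an open part of the coordinate space. -/
structure IsCartanBerwaldOn (S : LocalEAP n) (U : Set (Co n × Co n)) : Prop where
  isOpen : IsOpen U
  smooth_N : ∀ a μ, ContDiffOn ℝ ∞ (fun p => S.N p a μ) U
  smooth_h : ∀ i α, ContDiffOn ℝ ∞ (fun p => S.hFrame p i α) U
  smooth_v : ∀ i a, ContDiffOn ℝ ∞ (fun p => S.vFrame p i a) U
  det_h : ∀ p ∈ U, (S.hFrame p).det ≠ 0
  det_v : ∀ p ∈ U, (S.vFrame p).det ≠ 0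
  cartan : ∀ p ∈ U, S.canonical.CartanAt S.N p
  berwald : ∀ p ∈ U, S.canonical.BerwaldAt S.N p

namespace IsCartanBerwaldOn

variable {S : LocalEAP n} {U : Set (Co n × Co n)} (hS : S.IsCartanBerwaldOn U)
include hS

theorem diffAt {f : Co n × Co n → ℝ} (hf : ContDiffOn ℝ ∞ f U) {p} (hp : p ∈ U) :
    DifferentiableAt ℝ f p :=
  (hf.contDiffAt (hS.isOpen.mem_nhds hp)).differentiableAt (by simp)

theorem smooth_vco (i b : Fin n) : ContDiffOn ℝ ∞ (S.ver.co i b) U :=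
  contDiffOn_inv hS.smooth_v hS.det_v b i

theorem smooth_hco (i μ : Fin n) : ContDiffOn ℝ ∞ (S.hor.co i μ) U :=
  contDiffOn_inv hS.smooth_h hS.det_h μ i

theorem sum_vco_vFrame (w : Fin n → ℝ) (j : Fin n) {p} (hp : p ∈ U) :
    ∑ a, S.ver.co j a p * ∑ i, S.vFrame p i a * w i = w j := by
  have h := sum_mul_inv (S.ver.det_coMat_ne_zero (hS.det_v p hp)) j
  simp only [S.ver.coMat_inv (hS.det_v p hp)] at h
  simp only [Finset.mul_sum]
  rw [Finset.sum_comm]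
  have h2 : ∀ i, ∑ a, S.ver.co j a p * (S.vFrame p i a * w i) = (if j = i then 1 else 0) * w i := by
    intro i
    rw [← h, Finset.sum_mul]
    exact Finset.sum_congr rfl fun _ _ => (mul_assoc _ _ _).symm
  simp [h2]

theorem eq_zero_of_sum_vFrame {w : Fin n → ℝ} {p} (hp : p ∈ U)
    (hw : ∀ a, ∑ i, S.vFrame p i a * w i = 0) (j : Fin n) : w j = 0 := by
  rw [← hS.sum_vco_vFrame w j hp]
  simp [hw]

theorem eq_zero_of_sum_hFrame {w : Fin n → ℝ} {p} (hp : p ∈ U)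
    (hw : ∀ a, ∑ i, S.hFrame p i a * w i = 0) (j : Fin n) : w j = 0 := by
  have h := sum_mul_inv (S.hor.det_coMat_ne_zero (hS.det_h p hp)) j
  simp only [S.hor.coMat_inv (hS.det_h p hp)] at h
  have h2 : ∑ a, S.hor.co j a p * ∑ i, S.hFrame p i a * w i = w j := by
    simp only [Finset.mul_sum]
    rw [Finset.sum_comm]
    have h2 : ∀ i, ∑ a, S.hor.co j a p * (S.hFrame p i a * w i)
        = (if j = i then 1 else 0) * w i := by
      intro i
      rw [← h, Finset.sum_mul]
      exact Finset.sum_congr rfl fun _ _ => (mul_assoc _ _ _).symm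
    simp [h2]
  rw [← h2]
  simp [hw]

/-- The horizontal covectors do not depend on `y`. -/
theorem pdy_hco (i μ c : Fin n) {p} (hp : p ∈ U) : pdy c (S.hor.co i μ) p = 0 :=
  hS.eq_zero_of_sum_hFrame (w := fun i => pdy c (S.hor.co i μ) p) hp
    (fun α => (hS.berwald p hp).2 α μ c) i

/-- The functions `f_i = y^b λ_{ib}`. -/
theorem smooth_potential (i : Fin n) :
    ContDiffOn ℝ ∞ (fun q : Co n × Co n => ∑ b, q.2 b * S.ver.co i b q) U := by
  refine ContDiffOn.sum fun b _ => ContDiffOn.mul ?_ (hS.smooth_vco i b)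
  fun_prop

theorem fderiv_potential (i : Fin n) {p} (hp : p ∈ U) (v : Co n × Co n) :
    fderiv ℝ (fun q : Co n × Co n => ∑ b, q.2 b * S.ver.co i b q) p v
      = ∑ b, (fderiv ℝ (fun q : Co n × Co n => q.2 b) p v * S.ver.co i b p
        + p.2 b * fderiv ℝ (S.ver.co i b) p v) := by
  have h1 : ∀ b, DifferentiableAt ℝ (fun q : Co n × Co n => q.2 b) p := fun b => by fun_prop
  have h2 : ∀ b, DifferentiableAt ℝ (S.ver.co i b) p := fun b => hS.diffAt (hS.smooth_vco i b) hp
  rw [fderiv_sum_apply fun b => (h1 b).fun_mul (h2 b)]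
  exact Finset.sum_congr rfl fun b _ => fderiv_mul_apply (h1 b) (h2 b) v

omit hS in
theorem fderiv_snd_apply (b : Fin n) (p v : Co n × Co n) :
    fderiv ℝ (fun q : Co n × Co n => q.2 b) p v = v.2 b := by
  have : (fun q : Co n × Co n => q.2 b)
      = (EuclideanSpace.proj b : Co n →L[ℝ] ℝ) ∘L ContinuousLinearMap.snd ℝ (Co n) (Co n) := by
    funext q; rfl
  rw [this, ContinuousLinearMap.fderiv]
  rfl

/-- `λ_{ic}` is the derivative of `f_i` with respect to `y^c`. -/
theorem pdy_potential (i c : Fin n) {p} (hp : p ∈ U) :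
    pdy c (fun q : Co n × Co n => ∑ b, q.2 b * S.ver.co i b q) p = S.ver.co i c p := by
  -- This is the second Cartan condition $C^a_{bc}y^b=0$ with the invertible $\lambda_i^a$ removed.
  have h1 : ∑ b, p.2 b * pdy c (S.ver.co i b) p = 0 := by
    refine hS.eq_zero_of_sum_vFrame (w := fun i => ∑ b, p.2 b * pdy c (S.ver.co i b) p) hp
      (fun a => ?_) i
    have h2 := (hS.cartan p hp).2 a c
    have h3 : pdy c (fun q : Co n × Co n => q.2 a) p = if a = c then 1 else 0 := by
      rw [pdy, fderiv_snd_apply]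
      simp
    rw [h3, add_eq_left] at h2
    rw [← h2]
    change _ = ∑ b, (∑ i, S.vFrame p i a * pdy c (S.ver.co i b) p) * p.2 b
    simp only [Finset.mul_sum, Finset.sum_mul]
    rw [Finset.sum_comm]
    exact Finset.sum_congr rfl fun _ _ => Finset.sum_congr rfl fun _ _ => by ring
  rw [pdy, hS.fderiv_potential i hp, Finset.sum_add_distrib]
  refine (congrArg₂ _ ?_ h1).trans (add_zero _)
  simp [fderiv_snd_apply]

/-- Near $p$ the covectors are the fibre gradients of $f_i$, so this is symmetry of second
derivatives. -/
theorem pdy_vco_symm (i a b : Fin n) {p} (hp : p ∈ U) :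
    pdy b (S.ver.co i a) p = pdy a (S.ver.co i b) p := by
  have h1 : ∀ c, S.ver.co i c =ᶠ[nhds p]
      fun q => fderiv ℝ (fun q : Co n × Co n => ∑ b, q.2 b * S.ver.co i b q) q
        (0, EuclideanSpace.single c 1) := by
    intro c
    filter_upwards [hS.isOpen.mem_nhds hp] with q hq using (hS.pdy_potential i c hq).symm
  rw [pdy, pdy, (h1 a).fderiv_eq, (h1 b).fderiv_eq]
  exact fderiv_fderiv_comm hS.isOpen (hS.smooth_potential i) hp _ _

theorem fderiv_vg (b c : Fin n) {p} (hp : p ∈ U) (v : Co n × Co n) :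
    fderiv ℝ (S.ver.g b c) p v = ∑ i, (fderiv ℝ (S.ver.co i b) p v * S.ver.co i c p
      + S.ver.co i b p * fderiv ℝ (S.ver.co i c) p v) := by
  have h : ∀ i b, DifferentiableAt ℝ (S.ver.co i b) p :=
    fun i b => hS.diffAt (hS.smooth_vco i b) hp
  change fderiv ℝ (fun q => ∑ i, S.ver.co i b q * S.ver.co i c q) p v = _
  rw [fderiv_sum_apply fun i => (h i b).fun_mul (h i c)]
  exact Finset.sum_congr rfl fun i _ => fderiv_mul_apply (h i b) (h i c) v

theorem ver_isClosedOn : S.ver.IsClosedOn U where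
  det_ne := hS.det_v
  d_zero _ hf _ _ hp := fderiv_zero_on hS.isOpen hf hp _
  d_g μ ν _ _ hp := hS.fderiv_vg μ ν hp _
  symm i μ ν _ hp := hS.pdy_vco_symm i μ ν hp

/-- The functions `f_i` are horizontally constant. -/
theorem hd_potential (i μ : Fin n) {p} (hp : p ∈ U) :
    hd S.N μ (fun q : Co n × Co n => ∑ b, q.2 b * S.ver.co i b q) p = 0 := by
  rw [hd_eq_fderiv, hS.fderiv_potential i hp]
  simp only [← hd_eq_fderiv]
  -- Contracting $\Gamma^a_{b\mu}y^b$ with $\lambda_{ia}$ returns $y^b\delta_\mu\lambda_{ib}$,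
  -- whence $\delta_\mu f_i=\lambda_{ia}\,y^a{}_{|\mu}$.
  have h1 : ∑ a, S.ver.co i a p * ∑ b, S.canonical.vh a b μ p * p.2 b
      = ∑ b, p.2 b * hd S.N μ (S.ver.co i b) p := by
    rw [← hS.sum_vco_vFrame (fun i => ∑ b, p.2 b * hd S.N μ (S.ver.co i b) p) i hp]
    refine Finset.sum_congr rfl fun a _ => congrArg _ ?_
    simp only [canonical, Finset.mul_sum, Finset.sum_mul]
    rw [Finset.sum_comm]
    exact Finset.sum_congr rfl fun _ _ => Finset.sum_congr rfl fun _ _ => by ring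
  rw [Finset.sum_add_distrib, ← h1, ← Finset.sum_add_distrib]
  refine Finset.sum_eq_zero fun a _ => ?_
  have := (hS.cartan p hp).1 a μ
  linear_combination S.ver.co i a p * this

/-- All second derivatives of $f$ cancel by symmetry; only the derivatives of $N$ survive, and they
form the curvature. -/
theorem hd_hd {f : Co n × Co n → ℝ} (hf : ContDiffOn ℝ ∞ f U) (μ ν : Fin n) {p} (hp : p ∈ U) :
    hd S.N ν (hd S.N μ f) p - hd S.N μ (hd S.N ν f) p
      = -∑ a, nlCurv S.N a μ ν p * pdy a f p := by
  have hx : ∀ μ, ContDiffOn ℝ ∞ (pdx μ f) U := fun μ => contDiffOn_fderiv_apply hS.isOpen hf _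
  have hy : ∀ a, ContDiffOn ℝ ∞ (pdy a f) U := fun a => contDiffOn_fderiv_apply hS.isOpen hf _
  have h1 : ∀ μ ν, hd S.N ν (hd S.N μ f) p = hd S.N ν (pdx μ f) p
      - ∑ a, (hd S.N ν (fun q => S.N q a μ) p * pdy a f p
        + S.N p a μ * hd S.N ν (pdy a f) p) := by
    intro μ ν
    simp only [hd_eq_fderiv S.N ν]
    change fderiv ℝ (fun q => pdx μ f q - ∑ a, S.N q a μ * pdy a f q) p _ = _
    have h2 : ∀ a, ContDiffOn ℝ ∞ (fun q => S.N q a μ * pdy a f q) U :=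
      fun a => (hS.smooth_N a μ).mul (hy a)
    rw [fderiv_fun_sub (hS.diffAt (hx μ) hp)
      (hS.diffAt (ContDiffOn.sum fun a _ => h2 a) hp), sub_apply,
      fderiv_sum_apply fun a => hS.diffAt (h2 a) hp]
    congr 1
    exact Finset.sum_congr rfl fun a _ =>
      fderiv_mul_apply (hS.diffAt (hS.smooth_N a μ) hp) (hS.diffAt (hy a) hp) _
  have cxx : pdx ν (pdx μ f) p = pdx μ (pdx ν f) p := fderiv_fderiv_comm hS.isOpen hf hp _ _
  have cxy : ∀ a μ, pdy a (pdx μ f) p = pdx μ (pdy a f) p :=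
    fun a μ => fderiv_fderiv_comm hS.isOpen hf hp _ _
  have cyy : ∀ a b, pdy a (pdy b f) p = pdy b (pdy a f) p :=
    fun a b => fderiv_fderiv_comm hS.isOpen hf hp _ _
  have h3 : ∀ μ ν, ∑ a, S.N p a μ * hd S.N ν (pdy a f) p
      = (∑ a, S.N p a μ * pdx ν (pdy a f) p)
        - ∑ a, ∑ b, S.N p a μ * S.N p b ν * pdy b (pdy a f) p := by
    intro μ ν
    simp only [hd, mul_sub, Finset.sum_sub_distrib, Finset.mul_sum, mul_assoc]
  have h4 : ∑ a, ∑ b, S.N p a ν * S.N p b μ * pdy b (pdy a f) p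
      = ∑ a, ∑ b, S.N p a μ * S.N p b ν * pdy b (pdy a f) p := by
    rw [Finset.sum_comm]
    refine Finset.sum_congr rfl fun a _ => Finset.sum_congr rfl fun b _ => ?_
    rw [cyy a b]
    ring
  have h5 : ∀ μ ν, hd S.N ν (pdx μ f) p
      = pdx ν (pdx μ f) p - ∑ a, S.N p a ν * pdx μ (pdy a f) p := by
    intro μ ν
    simp only [hd, cxy]
  simp only [h1, Finset.sum_add_distrib]
  rw [h3, h3, h4, h5, h5, cxx]
  simp only [nlCurv, sub_mul, Finset.sum_sub_distrib]
  ring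

/-- The nonlinear connection is flat. -/
theorem nlCurv_eq_zero (a μ ν : Fin n) {p} (hp : p ∈ U) : nlCurv S.N a μ ν p = 0 := by
  -- The commutator is applied to $f_i$, which is killed by every $\delta_\mu$ and has vertical
  -- gradient $\lambda_{ib}$.
  have h1 : ∀ i, ∑ b, S.ver.co i b p * nlCurv S.N b μ ν p = 0 := by
    intro i
    have h2 := hS.hd_hd (hS.smooth_potential i) μ ν hp
    rw [hd_eq_fderiv, hd_eq_fderiv,
      fderiv_zero_on hS.isOpen (fun q hq => hS.hd_potential i μ hq) hp,
      fderiv_zero_on hS.isOpen (fun q hq => hS.hd_potential i ν hq) hp, sub_zero,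
      eq_comm, neg_eq_zero] at h2
    rw [← h2]
    exact Finset.sum_congr rfl fun b _ => by rw [hS.pdy_potential i b hp, mul_comm]
  have h := sum_inv_mul (S.ver.det_coMat_ne_zero (hS.det_v p hp)) a
  have h2 : ∑ i, (S.ver.coMat p)⁻¹ a i * ∑ b, S.ver.co i b p * nlCurv S.N b μ ν p
      = nlCurv S.N a μ ν p := by
    simp only [Finset.mul_sum]
    rw [Finset.sum_comm]
    have h3 : ∀ b, ∑ i, (S.ver.coMat p)⁻¹ a i * (S.ver.co i b p * nlCurv S.N b μ ν p)
        = (if a = b then 1 else 0) * nlCurv S.N b μ ν p := by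
      intro b
      rw [← h, Finset.sum_mul]
      exact Finset.sum_congr rfl fun _ _ => (mul_assoc _ _ _).symm
    simp [h3]
  rw [← h2]
  simp [h1]

/-- By the Berwald condition $\dot\partial_bN^d_\mu$ may be replaced by $\Gamma^d_{b\mu}$. Metricity
of the canonical connection then makes the bracket in the natural coefficients vanish, and what is
left is $\dot\partial_bN^a_\mu=\Gamma^a_{b\mu}$. -/
theorem vh_sub_natural (a b μ : Fin n) {p} (hp : p ∈ U) :
    S.canonical.vh a b μ p - S.natural.vh a b μ p = 0 := by
  have h1 : ∀ b c, ∑ d, S.ver.g d c p * pdy b (fun q => S.N q d μ) p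
      = ∑ i, hd S.N μ (S.ver.co i b) p * S.ver.co i c p := by
    intro b c
    simp only [(hS.berwald p hp).1, canonical]
    have h2 := sum_g (S.ver.det_coMat_ne_zero (hS.det_v p hp))
      (fun i => hd S.N μ (S.ver.co i b) p) c
    simp only [S.ver.coMat_inv (hS.det_v p hp)] at h2
    refine Eq.trans ?_ (h2.trans ?_)
    · refine Finset.sum_congr rfl fun d _ => congrArg₂ _ ?_ rfl
      exact Finset.sum_congr rfl fun _ _ => mul_comm _ _
    · exact Finset.sum_congr rfl fun _ _ => mul_comm _ _
  have h2 : ∀ c, hd S.N μ (S.ver.g b c) p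
      - (∑ d, S.ver.g d c p * pdy b (fun q => S.N q d μ) p)
      - ∑ d, S.ver.g b d p * pdy c (fun q => S.N q d μ) p = 0 := by
    intro c
    have h3 : ∑ d, S.ver.g b d p * pdy c (fun q => S.N q d μ) p
        = ∑ d, S.ver.g d b p * pdy c (fun q => S.N q d μ) p := by
      refine Finset.sum_congr rfl fun d _ => congrArg₂ _ ?_ rfl
      exact Finset.sum_congr rfl fun _ _ => mul_comm _ _
    rw [h3, h1, h1, hd_eq_fderiv, hS.fderiv_vg b c hp, Finset.sum_add_distrib]
    simp only [← hd_eq_fderiv]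
    rw [add_sub_cancel_left, sub_eq_zero]
    exact Finset.sum_congr rfl fun _ _ => mul_comm _ _
  simp only [natural, h2]
  simp [(hS.berwald p hp).1]

theorem hv_sub_natural (G : FrameCalculus n (Co n)) (hG : ∀ p ∈ U, S.hFrame p = G.frame p.1)
    (α μ c : Fin n) {p} (hp : p ∈ U) :
    S.canonical.hv α μ c p - S.natural.hv α μ c p = 0 := by
  have h1 : ∀ ε, pdy c (S.hor.g μ ε) p = 0 := by
    intro ε
    refine pdy_comp_fst (f' := G.g μ ε) ?_ c
    filter_upwards [hS.isOpen.mem_nhds hp] with q hq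
    simp [FrameCalculus.g, FrameCalculus.co, hor, hG q hq]
  simp [natural, h1, (hS.berwald p hp).2]

theorem hor_projectsTo (G : FrameCalculus n (Co n)) (hd' : G.d = pd)
    (hG : ∀ p ∈ U, S.hFrame p = G.frame p.1) : S.hor.ProjectsTo G Prod.fst U where
  frame := hG
  d f f' hf ν p hp := by
    rw [hd']
    refine hd_comp_fst ?_ S.N ν
    filter_upwards [hS.isOpen.mem_nhds hp] with q hq using hf q hq

/-- The parameters $\lambda_{i\mu;a}$ vanish on the open set $U$, so $N$ drops out of the
Lagrangian. This happens near $p$, not just at $p$, and therefore also under the outer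
$\partial/\partial x^\gamma$. -/
theorem horEL_eq (G : FrameCalculus n (Co n)) (hd' : G.d = pd)
    (hG : ∀ p ∈ U, S.hFrame p = G.frame p.1) (j β : Fin n) :
    ∀ p ∈ U, S.horEL j β p = G.eulerLagrange j β p.1 := by
  intro p hp
  have hpr := hS.hor_projectsTo G hd' hG
  have hY : ∀ q ∈ U, S.hcoY q = fun _ _ _ => 0 := by
    intro q hq
    funext i μ a
    exact hS.pdy_hco i μ a hq
  have hX : ∀ q ∈ U, S.hcoX q = G.dco q.1 := by
    intro q hq
    rw [← hpr.dco q hq]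
    funext i μ ν
    have h0 : ∀ a, pdy a (S.hor.co i μ) q = 0 := fun a => hS.pdy_hco i μ a hq
    change pdx ν (S.hor.co i μ) q = hd S.N ν (S.hor.co i μ) q
    simp [hd, h0]
  have hL : ∀ q ∈ U, horLagrangian (S.N q) (S.hcoY q) = lagrangian := by
    intro q hq
    funext A B
    simp [horLagrangian, hY q hq]
  have hB : ∀ γ, pdx γ (fun q =>
      dB (horLagrangian (S.N q) (S.hcoY q)) j β γ (S.hor.coMat q) (S.hcoX q)) p
      = pd γ (fun x => dB lagrangian j β γ (G.coMat x) (G.dco x)) p.1 := by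
    intro γ
    refine pdx_comp_fst ?_ γ
    filter_upwards [hS.isOpen.mem_nhds hp] with q hq
    rw [hL q hq, hX q hq, hpr.coMat q hq]
  simp only [horEL, hB, FrameCalculus.eulerLagrange, hd']
  rw [hL p hp, hX p hp, hpr.coMat p hp]

end IsCartanBerwaldOn
end LocalEAP

/-! ### Induced coordinates on the tangent bundle -/

section Charts

variable {n : ℕ} {M : Type*} [TopologicalSpace M] [ChartedSpace (Co n) M]
  {e : OpenPartialHomeomorph M (Co n)}

theorem mdifferentiable_chart (he : e ∈ charts n M) : e.MDifferentiable (𝓡 n) (𝓡 n) :=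
  ⟨(contMDiffOn_of_mem_maximalAtlas he).mdifferentiableOn (by simp),
    (contMDiffOn_symm_of_mem_maximalAtlas he).mdifferentiableOn (by simp)⟩

theorem tmCoord_tmPoint (he : e ∈ charts n M) {p : Co n × Co n} (hp : p.1 ∈ e.target) :
    tmCoord e (tmPoint e p) = p := by
  have h := (mdifferentiable_chart he).comp_symm_deriv hp
  refine Prod.ext (e.right_inv hp) ?_
  exact congrArg (fun L : Co n →L[ℝ] Co n => L p.2) h

theorem tmPoint_tmCoord (he : e ∈ charts n M) {u : TangentBundle (𝓡 n) M}
    (hu : u.proj ∈ e.source) : tmPoint e (tmCoord e u) = u := by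
  obtain ⟨x, v⟩ := u
  have h := (mdifferentiable_chart he).symm_comp_deriv hu
  have h2 : mfderiv (𝓡 n) (𝓡 n) e.symm (e x) (mfderiv (𝓡 n) (𝓡 n) e x v) = v :=
    congrArg (fun L : Co n →L[ℝ] Co n => L v) h
  have h3 : e.symm (e x) = x := e.left_inv hu
  simp only [tmPoint, tmCoord]
  rw [Bundle.TotalSpace.mk.injEq]
  exact ⟨h3, heq_of_eq h2⟩

theorem tmPoint_proj_mem {p : Co n × Co n} (hp : p.1 ∈ e.target) :
    (tmPoint e p).proj ∈ e.source := e.map_target hp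

variable [IsManifold (𝓡 n) ∞ M]

theorem contMDiffOn_tmCoord (he : e ∈ charts n M) :
    ContMDiffOn (𝓡 n).tangent 𝓘(ℝ, Co n × Co n) ∞ (tmCoord e)
      (Bundle.TotalSpace.proj ⁻¹' e.source) := by
  have h0 := contMDiffOn_of_mem_maximalAtlas he
  have h1 : ContMDiffOn (𝓡 n).tangent 𝓘(ℝ, Co n) ∞
      (fun u : TangentBundle (𝓡 n) M => e u.proj) (Bundle.TotalSpace.proj ⁻¹' e.source) :=
    h0.comp (Bundle.contMDiff_proj (TangentSpace (𝓡 n))).contMDiffOn fun _ h => h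
  have h2 : ContMDiffOn (𝓡 n).tangent (𝓡 n).tangent ∞
      (tangentMapWithin (𝓡 n) (𝓡 n) e e.source) (Bundle.TotalSpace.proj ⁻¹' e.source) :=
    h0.contMDiffOn_tangentMapWithin (by simp) e.open_source.uniqueMDiffOn
  have h3 : ContMDiffOn (𝓡 n).tangent 𝓘(ℝ, Co n) ∞
      (fun u : TangentBundle (𝓡 n) M => (tangentMapWithin (𝓡 n) (𝓡 n) e e.source u).2)
      (Bundle.TotalSpace.proj ⁻¹' e.source) :=
    (contMDiff_snd_tangentBundle_modelSpace (Co n) (𝓡 n)).comp_contMDiffOn h2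
  refine h1.prodMk_space (h3.congr fun u hu => ?_)
  rw [tangentMapWithin, mfderivWithin_of_isOpen e.open_source hu]

theorem contMDiffOn_tmPoint (he : e ∈ charts n M) :
    ContMDiffOn 𝓘(ℝ, Co n × Co n) (𝓡 n).tangent ∞ (tmPoint e) (Prod.fst ⁻¹' e.target) := by
  have h0 := contMDiffOn_symm_of_mem_maximalAtlas he
  have h1 : ContMDiffOn (𝓡 n).tangent (𝓡 n).tangent ∞
      (tangentMapWithin (𝓡 n) (𝓡 n) e.symm e.target) (Bundle.TotalSpace.proj ⁻¹' e.target) :=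
    h0.contMDiffOn_tangentMapWithin (by simp) e.open_target.uniqueMDiffOn
  -- The tangent bundle of the model space is identified with the product; the two charted space
  -- structures on the product must be matched first.
  have h2 : ContMDiff 𝓘(ℝ, Co n × Co n) (𝓡 n).tangent ∞
      (fun p : Co n × Co n => (⟨p.1, p.2⟩ : TangentBundle (𝓡 n) (Co n))) := by
    have h4 := (contDiff_fst (𝕜 := ℝ) (E := Co n) (F := Co n) (n := ∞)).contMDiff.prodMk
      (contDiff_snd (𝕜 := ℝ) (E := Co n) (F := Co n) (n := ∞)).contMDiff
    rw [chartedSpaceSelf_prod] at h4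
    exact contMDiff_tangentBundleModelSpaceHomeomorph_symm.comp h4
  refine (h1.comp h2.contMDiffOn fun _ h => h).congr fun p hp => ?_
  simp only [Function.comp_apply, tangentMapWithin]
  rw [mfderivWithin_of_isOpen e.open_target hp]
  rfl

theorem isOpen_coordDom (he : e ∈ charts n M) {dom : Set (TangentBundle (𝓡 n) M)}
    (hdom : IsOpen dom) : IsOpen (coordDom dom e) :=
  (contMDiffOn_tmPoint he).continuousOn.isOpen_inter_preimage
    (e.open_target.preimage continuous_fst) hdom

/-- The base part of the coordinates of a vector tangent to `TM`. -/
theorem fst_mfderiv_tmCoord (he : e ∈ charts n M) {u : TangentBundle (𝓡 n) M}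
    (hu : u.proj ∈ e.source) (w : TangentSpace (𝓡 n).tangent u) :
    (mfderiv (𝓡 n).tangent 𝓘(ℝ, Co n × Co n) (tmCoord e) u w : Co n × Co n).1
      = mfderiv (𝓡 n) (𝓡 n) e u.proj (mfderiv (𝓡 n).tangent (𝓡 n)
        (Bundle.TotalSpace.proj : TangentBundle (𝓡 n) M → M) u w) := by
  have hopen : IsOpen ((Bundle.TotalSpace.proj : TangentBundle (𝓡 n) M → M) ⁻¹' e.source) :=
    e.open_source.preimage (FiberBundle.continuous_proj (Co n) (TangentSpace (𝓡 n)))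
  have h1 : MDifferentiableAt (𝓡 n).tangent 𝓘(ℝ, Co n × Co n) (tmCoord e) u :=
    ((contMDiffOn_tmCoord he).contMDiffAt (hopen.mem_nhds hu)).mdifferentiableAt (by simp)
  have h2 : MDifferentiableAt (𝓡 n).tangent (𝓡 n)
      (Bundle.TotalSpace.proj : TangentBundle (𝓡 n) M → M) u :=
    (Bundle.contMDiff_proj (n := ∞) (TangentSpace (𝓡 n))).mdifferentiableAt (by simp)
  have h3 : MDifferentiableAt (𝓡 n) (𝓡 n) e u.proj := (mdifferentiable_chart he).mdifferentiableAt hu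
  have h4 : MDifferentiableAt 𝓘(ℝ, Co n × Co n) 𝓘(ℝ, Co n) (Prod.fst : Co n × Co n → Co n)
      (tmCoord e u) := contDiff_fst.contMDiff.mdifferentiableAt (n := 1) (by simp)
  have h5 := mfderiv_comp u h4 h1
  have h6 := mfderiv_comp u h3 h2
  have h7 : mfderiv 𝓘(ℝ, Co n × Co n) 𝓘(ℝ, Co n) (Prod.fst : Co n × Co n → Co n) (tmCoord e u)
      = ContinuousLinearMap.fst ℝ (Co n) (Co n) := by
    rw [mfderiv_eq_fderiv]
    exact fderiv_fst
  rw [h7] at h5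
  have h8 : (Prod.fst : Co n × Co n → Co n) ∘ tmCoord e
      = e ∘ (Bundle.TotalSpace.proj : TangentBundle (𝓡 n) M → M) := rfl
  rw [h8] at h5
  exact congrArg (fun L : (Co n × Co n) →L[ℝ] Co n => L w) (h5.symm.trans h6)

end Charts

/-! ### Smooth components of an EAP-space in a chart -/

namespace EAPSpace

variable {n : ℕ} {M : Type*} [TopologicalSpace M] [ChartedSpace (Co n) M]
  [IsManifold (𝓡 n) ∞ M] (S : EAPSpace n M) {e : OpenPartialHomeomorph M (Co n)}

/-- The coordinate components of `λ_i` are smooth. -/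
theorem contDiffOn_components (he : e ∈ charts n M) (i : Fin n) :
    ContDiffOn ℝ ∞ (fun p => (mfderiv (𝓡 n).tangent 𝓘(ℝ, Co n × Co n) (tmCoord e) (tmPoint e p)
      (S.lam i (tmPoint e p)) : Co n × Co n)) (coordDom S.dom e) := by
  have hopen : IsOpen ((Bundle.TotalSpace.proj : TangentBundle (𝓡 n) M → M) ⁻¹' e.source) :=
    e.open_source.preimage (FiberBundle.continuous_proj (Co n) (TangentSpace (𝓡 n)))
  refine contMDiffOn_iff_contDiffOn.1 ?_
  have h1 := (contMDiffOn_tmCoord he).contMDiffOn_tangentMapWithin (m := ∞) (by simp)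
    hopen.uniqueMDiffOn
  have h2 : ContMDiffOn 𝓘(ℝ, Co n × Co n) (𝓡 n).tangent.tangent ∞
      (fun p => (⟨tmPoint e p, S.lam i (tmPoint e p)⟩ :
        TangentBundle (𝓡 n).tangent (TangentBundle (𝓡 n) M))) (coordDom S.dom e) :=
    (S.smooth_lam i).comp ((contMDiffOn_tmPoint he).mono fun p hp => hp.1) fun p hp => hp.2
  have h3 := (contMDiff_snd_tangentBundle_modelSpace (n := ∞) (Co n × Co n)
    𝓘(ℝ, Co n × Co n)).comp_contMDiffOn
      (h1.comp h2 fun p hp => tmPoint_proj_mem hp.1)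
  refine h3.congr fun p hp => ?_
  exact congrArg (fun L : TangentSpace (𝓡 n).tangent (tmPoint e p) →L[ℝ] (Co n × Co n) =>
    L (S.lam i (tmPoint e p)))
    (mfderivWithin_of_isOpen (f := tmCoord e) hopen (tmPoint_proj_mem hp.1)).symm

theorem isCartanBerwaldOn (hC : S.IsCartanType) (hB : S.IsBerwaldType) (he : e ∈ charts n M) :
    (S.loc e).IsCartanBerwaldOn (coordDom S.dom e) := by
  have hh : ∀ i α, ContDiffOn ℝ ∞ (fun p => hComp S.lam e p i α) (coordDom S.dom e) := by
    intro i α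
    have h1 := (S.contDiffOn_components he i).fst
    exact (EuclideanSpace.proj α : Co n →L[ℝ] ℝ).contDiff.comp_contDiffOn h1
  refine ⟨isOpen_coordDom he S.isOpen_dom, S.nlc.smooth e he, hh, ?_, ?_, ?_, hC e he, hB e he⟩
  · intro i a
    have h1 := (S.contDiffOn_components he i).snd
    exact ((EuclideanSpace.proj a : Co n →L[ℝ] ℝ).contDiff.comp_contDiffOn h1).add
      (ContDiffOn.sum fun α _ => (S.nlc.smooth e he a α).mul (hh i α))
  · intro p hp
    have := Matrix.linearIndependent_rows_iff_isUnit.1 (S.indep_hor e he p hp)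
    exact ((Matrix.isUnit_iff_isUnit_det _).1 this).ne_zero
  · intro p hp
    have := Matrix.linearIndependent_rows_iff_isUnit.1 (S.indep_ver e he p hp)
    exact ((Matrix.isUnit_iff_isUnit_det _).1 this).ne_zero

end EAPSpace
-- Descent of the horizontal frame to $M$
namespace EAPSpace

variable {n : ℕ} {M : Type*} [TopologicalSpace M] [ChartedSpace (Co n) M]
  [IsManifold (𝓡 n) ∞ M] (S : EAPSpace n M) {e : OpenPartialHomeomorph M (Co n)}

omit S in
/-- The horizontal components of `λ_i` are the components of `dπ(λ_i)`. -/
theorem hComp_eq (he : e ∈ charts n M)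
    (lam : Fin n → (u : TangentBundle (𝓡 n) M) → TangentSpace (𝓡 n).tangent u)
    {p : Co n × Co n} {u : TangentBundle (𝓡 n) M} (hu : u.proj ∈ e.source)
    (hp : tmPoint e p = u) (i α : Fin n) :
    hComp lam e p i α = vec (mfderiv (𝓡 n) (𝓡 n) e u.proj (mfderiv (𝓡 n).tangent (𝓡 n)
      (Bundle.TotalSpace.proj : TangentBundle (𝓡 n) M → M) u (lam i u))) α := by
  subst hp
  exact congrArg (fun w : Co n => w α) (fst_mfderiv_tmCoord he hu (lam i (tmPoint e p)))

theorem tmCoord_mem (he : e ∈ charts n M) {u : TangentBundle (𝓡 n) M} (hu : u ∈ S.dom)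
    (hue : u.proj ∈ e.source) : tmCoord e u ∈ coordDom S.dom e :=
  ⟨e.map_source hue, by rwa [tmPoint_tmCoord he hue]⟩

/-- The coordinate fibre is the image of the connected fibre of $\mathcal D$ under the differential
of the chart. -/
theorem isPreconnected_coordFibre (he : e ∈ charts n M) {x : Co n} (hx : x ∈ e.target) :
    IsPreconnected {y : Co n | (x, y) ∈ coordDom S.dom e} := by
  let L : Co n → Co n := fun v => mfderiv (𝓡 n) (𝓡 n) e (e.symm x) v
  have h1 : IsPreconnected
      (L '' {v : Co n | (⟨e.symm x, v⟩ : TangentBundle (𝓡 n) M) ∈ S.dom}) :=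
    (S.isConnected_fibre (e.symm x)).isPreconnected.image _
      (mfderiv (𝓡 n) (𝓡 n) e (e.symm x)).continuous.continuousOn
  have h2 : {y : Co n | (x, y) ∈ coordDom S.dom e}
      = L '' {v : Co n | (⟨e.symm x, v⟩ : TangentBundle (𝓡 n) M) ∈ S.dom} := by
    ext y
    constructor
    · intro hy
      refine ⟨mfderiv (𝓡 n) (𝓡 n) e.symm x y, hy.2, ?_⟩
      exact congrArg Prod.snd (tmCoord_tmPoint he (p := (x, y)) hx)
    · rintro ⟨v, hv, rfl⟩
      have h3 := S.tmCoord_mem he hv (e.map_target hx)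
      simp only [tmCoord, e.right_inv hx] at h3
      exact h3
  rw [h2]
  exact h1

/-- The coframe has zero $y$-derivative on an open connected fibre, hence is constant there, and so
is its inverse. This is where connectedness of the fibres enters. -/
theorem hComp_fibre (hC : S.IsCartanType) (hB : S.IsBerwaldType) (he : e ∈ charts n M)
    {p q : Co n × Co n} (hp : p ∈ coordDom S.dom e) (hq : q ∈ coordDom S.dom e)
    (hpq : p.1 = q.1) : hComp S.lam e p = hComp S.lam e q := by
  have hS := S.isCartanBerwaldOn hC hB he
  obtain ⟨x, y⟩ := p
  obtain ⟨x', z⟩ := q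
  obtain rfl : x = x' := hpq
  have hco : ∀ i μ, (S.loc e).hor.co i μ (x, y) = (S.loc e).hor.co i μ (x, z) := by
    intro i μ
    have hopen : IsOpen {y : Co n | (x, y) ∈ coordDom S.dom e} :=
      hS.isOpen.preimage (by fun_prop : Continuous fun y : Co n => (x, y))
    have hd : ∀ w ∈ {y : Co n | (x, y) ∈ coordDom S.dom e},
        HasFDerivAt (fun y => (S.loc e).hor.co i μ (x, y)) (0 : Co n →L[ℝ] ℝ) w := by
      intro w hw
      have h1 := (hS.diffAt (hS.smooth_hco i μ) hw).hasFDerivAt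
      have h2 := HasFDerivAt.comp w h1 (hasFDerivAt_prodMk_right x w)
      refine h2.congr_fderiv ?_
      refine ContinuousLinearMap.coe_injective
        ((EuclideanSpace.basisFun (Fin n) ℝ).toBasis.ext fun c => ?_)
      simpa [pdy] using hS.pdy_hco i μ c hw
    exact hopen.is_const_of_fderiv_eq_zero (S.isPreconnected_coordFibre he hp.1)
      (fun w hw => (hd w hw).differentiableAt.differentiableWithinAt)
      (fun w hw => (hd w hw).fderiv) hp hq
  have hinv : (hComp S.lam e (x, y))⁻¹ = (hComp S.lam e (x, z))⁻¹ := by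
    ext μ i
    exact hco i μ
  have h1 := Matrix.nonsing_inv_nonsing_inv _ (isUnit_iff_ne_zero.2 (hS.det_h _ hp))
  have h2 := Matrix.nonsing_inv_nonsing_inv _ (isUnit_iff_ne_zero.2 (hS.det_h _ hq))
  exact h1.symm.trans ((congrArg _ hinv).trans h2)

/-- The projections of the `λ_i` to `M`. -/
def baseFrame (i : Fin n) (x : M) : TangentSpace (𝓡 n) x :=
  mfderiv (𝓡 n).tangent (𝓡 n) (Bundle.TotalSpace.proj : TangentBundle (𝓡 n) M → M)
    ⟨x, (S.isConnected_fibre x).nonempty.choose⟩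
    (S.lam i ⟨x, (S.isConnected_fibre x).nonempty.choose⟩)

/-- The point chosen in the definition of `baseFrame` is immaterial: in a chart, both sides have the
components `hComp` at two points of one fibre, and the differential of the chart is injective. -/
theorem mfderiv_proj_lam (hC : S.IsCartanType) (hB : S.IsBerwaldType) (i : Fin n)
    {u : TangentBundle (𝓡 n) M} (hu : u ∈ S.dom) :
    mfderiv (𝓡 n).tangent (𝓡 n) (Bundle.TotalSpace.proj : TangentBundle (𝓡 n) M → M) u
      (S.lam i u) = S.baseFrame i u.proj := by
  obtain ⟨x, v⟩ := u
  have hu' := (S.isConnected_fibre x).nonempty.choose_spec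
  set w := (S.isConnected_fibre x).nonempty.choose with hw
  have he : chartAt (Co n) x ∈ charts n M := IsManifold.chart_mem_maximalAtlas x
  have hx : x ∈ (chartAt (Co n) x).source := mem_chart_source _ x
  have h := S.hComp_fibre hC hB he (S.tmCoord_mem he hu hx) (S.tmCoord_mem he hu' hx) rfl
  refine (mdifferentiable_chart he).mfderiv_injective hx ?_
  refine PiLp.ext fun α => ?_
  have h1 := hComp_eq he S.lam hx (tmPoint_tmCoord he (u := ⟨x, v⟩) hx) i α
  have h2 := hComp_eq he S.lam hx (tmPoint_tmCoord he (u := ⟨x, w⟩) hx) i α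
  rw [h] at h1
  exact h1.symm.trans h2

theorem exists_coordDom (he : e ∈ charts n M) {x : Co n} (hx : x ∈ e.target) :
    ∃ y, (x, y) ∈ coordDom S.dom e := by
  obtain ⟨v, hv⟩ := (S.isConnected_fibre (e.symm x)).nonempty
  have h3 := S.tmCoord_mem he hv (e.map_target hx)
  simp only [tmCoord, e.right_inv hx] at h3
  exact ⟨_, h3⟩

/-- The points chosen in the fibres need not vary smoothly. Near $x_0$ they are replaced by the
section $s$ with constant fibre coordinate $y$, which stays in the open set $\mathcal D$; then the
base frame is $d\pi\circ\lambda_i\circ s$. -/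
theorem contMDiff_baseFrame (hC : S.IsCartanType) (hB : S.IsBerwaldType) (i : Fin n) :
    ContMDiff (𝓡 n) (𝓡 n).tangent ∞
      (fun x => (⟨x, S.baseFrame i x⟩ : TangentBundle (𝓡 n) M)) := by
  intro x₀
  have he : chartAt (Co n) x₀ ∈ charts n M := IsManifold.chart_mem_maximalAtlas x₀
  set e := chartAt (Co n) x₀ with he'
  have hx₀ : x₀ ∈ e.source := mem_chart_source _ x₀
  obtain ⟨y, hy⟩ := S.exists_coordDom he (e.map_source hx₀)
  let s : M → TangentBundle (𝓡 n) M := fun x => tmPoint e (e x, y)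
  have hs : ContMDiffOn (𝓡 n) (𝓡 n).tangent ∞ s e.source := by
    refine (contMDiffOn_tmPoint he).comp
      ((contMDiffOn_of_mem_maximalAtlas he).prodMk_space contMDiffOn_const) ?_
    exact fun x hx => e.map_source hx
  have hev : ∀ᶠ x in nhds x₀, x ∈ e.source ∧ s x ∈ S.dom := by
    have h1 : ContinuousAt s x₀ := (hs.contMDiffAt (e.open_source.mem_nhds hx₀)).continuousAt
    filter_upwards [e.open_source.mem_nhds hx₀, h1 (S.isOpen_dom.mem_nhds hy.2)] with x h2 h3
      using ⟨h2, h3⟩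
  have h2 : ContMDiffAt (𝓡 n) (𝓡 n).tangent ∞ (fun x => tangentMap (𝓡 n).tangent (𝓡 n)
      (Bundle.TotalSpace.proj : TangentBundle (𝓡 n) M → M) ⟨s x, S.lam i (s x)⟩) x₀ := by
    have h3 : ContMDiffAt (𝓡 n).tangent (𝓡 n).tangent.tangent ∞
        (fun u => (⟨u, S.lam i u⟩ :
          TangentBundle (𝓡 n).tangent (TangentBundle (𝓡 n) M))) (s x₀) :=
      (S.smooth_lam i).contMDiffAt (S.isOpen_dom.mem_nhds hy.2)
    have h4 : ContMDiff (𝓡 n).tangent.tangent (𝓡 n).tangent ∞ (tangentMap (𝓡 n).tangent (𝓡 n)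
        (Bundle.TotalSpace.proj : TangentBundle (𝓡 n) M → M)) :=
      (Bundle.contMDiff_proj (n := ∞) (TangentSpace (𝓡 n))).contMDiff_tangentMap (by simp)
    exact (h4.contMDiffAt.comp (s x₀) h3).comp x₀ (hs.contMDiffAt (e.open_source.mem_nhds hx₀))
  refine h2.congr_of_eventuallyEq ?_
  filter_upwards [hev] with x hx
  have h5 : (s x).proj = x := e.left_inv hx.1
  -- The base point of $s(x)$ equals $x$ only propositionally, so vectors are compared in the total
  -- space.
  have h6 : ∀ z, z = x → (⟨x, S.baseFrame i x⟩ : TangentBundle (𝓡 n) M) = ⟨z, S.baseFrame i z⟩ := by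
    rintro z rfl
    rfl
  rw [h6 _ h5, tangentMap, S.mfderiv_proj_lam hC hB i hx.2]

/-- The differential of a chart sends these vectors to the rows of `hComp` at the chosen point, and
independence of the images suffices. -/
theorem linearIndependent_baseFrame (x : M) : LinearIndependent ℝ fun i => S.baseFrame i x := by
  have hu := (S.isConnected_fibre x).nonempty.choose_spec
  set w := (S.isConnected_fibre x).nonempty.choose with hw
  have he : chartAt (Co n) x ∈ charts n M := IsManifold.chart_mem_maximalAtlas x
  have hx : x ∈ (chartAt (Co n) x).source := mem_chart_source _ x
  have h := S.indep_hor _ he _ (S.tmCoord_mem he hu hx)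
  refine LinearIndependent.of_comp ((EuclideanSpace.equiv (Fin n) ℝ).toLinearMap ∘ₗ
    (mfderiv (𝓡 n) (𝓡 n) (chartAt (Co n) x) x).toLinearMap) ?_
  convert h using 1
  funext i α
  exact (hComp_eq he S.lam hx (tmPoint_tmCoord he (u := ⟨x, w⟩) hx) i α).symm

/-- The AP-space underlying an EAP-space of Cartan and Berwald type. -/
def base (hC : S.IsCartanType) (hB : S.IsBerwaldType) : APSpace n M where
  lam := S.baseFrame
  smooth_lam := S.contMDiff_baseFrame hC hB
  indep := S.linearIndependent_baseFrame

theorem hFrame_eq_base (hC : S.IsCartanType) (hB : S.IsBerwaldType) (he : e ∈ charts n M)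
    {p : Co n × Co n} (hp : p ∈ coordDom S.dom e) :
    (S.loc e).hFrame p = ((S.base hC hB).loc e).frame p.1 := by
  ext i α
  have h1 := hComp_eq he S.lam (tmPoint_proj_mem hp.1) rfl i α
  rw [S.mfderiv_proj_lam hC hB i hp.2] at h1
  exact h1

theorem base_isSmoothOn (hC : S.IsCartanType) (hB : S.IsBerwaldType) (he : e ∈ charts n M) :
    ((S.base hC hB).loc e).IsSmoothOn e.target where
  isOpen := e.open_target
  d_eq := rfl
  det_ne x hx := by
    obtain ⟨y, hy⟩ := S.exists_coordDom he hx
    rw [← S.hFrame_eq_base hC hB he hy]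
    exact (S.isCartanBerwaldOn hC hB he).det_h _ hy
  smooth i α x hx := by
    obtain ⟨y, hy⟩ := S.exists_coordDom he hx
    have hS := S.isCartanBerwaldOn hC hB he
    -- Locally the frame on $M$ is the horizontal frame restricted to the slice of constant $y$.
    have h1 : ContDiffAt ℝ ∞ (fun p => (S.loc e).hFrame p i α) (x, y) :=
      (hS.smooth_h i α).contDiffAt (hS.isOpen.mem_nhds hy)
    have h2 : ContDiffAt ℝ ∞ (fun z : Co n => (z, y)) x := by fun_prop
    have h3 : ContinuousAt (fun z : Co n => (z, y)) x := h2.continuousAt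
    refine ((h1.comp (f := fun z : Co n => (z, y)) x h2).congr_of_eventuallyEq
      ?_).contDiffWithinAt
    filter_upwards [h3 (hS.isOpen.mem_nhds hy)] with z hz
    simp only [Function.comp_apply]
    rw [S.hFrame_eq_base hC hB he hz]

end EAPSpace
end EAP

end

/-! ### The theorem -/

theorem mainTheorem8 (n : ℕ) (M : Type*) [TopologicalSpace M]
    [ChartedSpace (EuclideanSpace ℝ (Fin n)) M] [IsManifold (𝓡 n) ∞ M]
    (S : EAP.EAPSpace n M) (hC : S.IsCartanType) (hB : S.IsBerwaldType) :
    -- the vertical field equations disappear: all their terms vanish identically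
    (∀ e ∈ EAP.charts n M, ∀ p ∈ EAP.coordDom S.dom e,
      (∀ j b, (S.loc e).verEL j b p = 0) ∧
      (∀ a b, (S.loc e).ver.E a b p = 0) ∧
      (∀ a, (S.loc e).ver.C a p = 0) ∧
      (∀ k a b, (S.loc e).ver.table k a b p = 0)) ∧
    -- the horizontal parts of the fundamental vector fields come from an AP-space on `M` ...
    ∃ A : EAP.APSpace n M,
      (∀ u ∈ S.dom, ∀ i,
        mfderiv (𝓡 n).tangent (𝓡 n) (Bundle.TotalSpace.proj : TangentBundle (𝓡 n) M → M) u
          (S.lam i u) = A.lam i u.proj) ∧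
      (∀ e ∈ EAP.charts n M, ∀ p ∈ EAP.coordDom S.dom e,
        -- ... whose connections are the `hh`-parts of those of the EAP-space,
        (∀ α μ ν, (S.loc e).canonical.hh α μ ν p = (A.loc e).Gam α μ ν p.1) ∧
        (∀ α μ ν, (S.loc e).natural.hh α μ ν p = (A.loc e).Gam0 α μ ν p.1) ∧
        -- whose torsion is that of the EAP-space,
        (∀ α μ ν, (S.loc e).canonical.torHH α μ ν p = (A.loc e).Tor α μ ν p.1) ∧
        (∀ a μ ν, EAP.nlCurv (S.loc e).N a μ ν p = 0) ∧
        (∀ α μ c, (S.loc e).canonical.hv α μ c p = 0) ∧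
        (∀ a μ c, (S.loc e).canonical.torP (S.loc e).N a μ c p = 0) ∧
        (∀ a b c, (S.loc e).canonical.torVV a b c p = 0) ∧
        -- whose contortion is that of the EAP-space,
        (∀ α μ ν, (S.loc e).canonical.hh α μ ν p - (S.loc e).natural.hh α μ ν p =
          (A.loc e).gam α μ ν p.1) ∧
        (∀ a b μ, (S.loc e).canonical.vh a b μ p - (S.loc e).natural.vh a b μ p = 0) ∧
        (∀ α μ c, (S.loc e).canonical.hv α μ c p - (S.loc e).natural.hv α μ c p = 0) ∧
        (∀ a b c, (S.loc e).canonical.vv a b c p - (S.loc e).natural.vv a b c p = 0) ∧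
        -- and whose metric, fundamental tensors, energy-momentum tensor and electromagnetic
        -- field are the horizontal ones of the EAP-space
        (∀ μ ν, (S.loc e).hor.g μ ν p = (A.loc e).g μ ν p.1) ∧
        (∀ μ, (S.loc e).hor.C μ p = (A.loc e).C μ p.1) ∧
        (∀ k μ ν, (S.loc e).hor.table k μ ν p = (A.loc e).table k μ ν p.1) ∧
        (∀ μ ν, (S.loc e).hor.energyMomentum μ ν p = (A.loc e).energyMomentum μ ν p.1) ∧
        (∀ μ ν, (S.loc e).hor.emField μ ν p = (A.loc e).emField μ ν p.1) ∧
        -- the horizontal field equations are those of the GFT, in variational form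
        (∀ j β, (S.loc e).horEL j β p = (A.loc e).eulerLagrange j β p.1) ∧
        -- and in explicit form
        (∀ μ ν, (S.loc e).hor.lowerEL (S.loc e).horEL μ ν p = (S.loc e).hor.E μ ν p) ∧
        (∀ μ ν, (A.loc e).lowerEL (A.loc e).eulerLagrange μ ν p.1 = (A.loc e).E μ ν p.1) ∧
        (∀ μ ν, (S.loc e).hor.E μ ν p = (A.loc e).E μ ν p.1)) ∧
      (S.HorizontalFieldEquations ↔ A.GFTFieldEquations) := by
  have hloc := fun e (he : e ∈ EAP.charts n M) => S.isCartanBerwaldOn hC hB he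
  have hfr := fun e (he : e ∈ EAP.charts n M) p (hp : p ∈ EAP.coordDom S.dom e) =>
    S.hFrame_eq_base hC hB he hp
  have hEL := fun e (he : e ∈ EAP.charts n M) =>
    (hloc e he).horEL_eq ((S.base hC hB).loc e) rfl (hfr e he)
  refine ⟨fun e he p hp => ?_, S.base hC hB, fun u hu i => S.mfderiv_proj_lam hC hB i hu,
    fun e he p hp => ?_, ?_⟩
  · have hv := (hloc e he).ver_isClosedOn
    exact ⟨fun j b => hv.eulerLagrange j b p hp, fun a b => hv.E a b p hp,
      fun a => hv.C a p hp, fun k a b => hv.table k a b p hp⟩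
  · have hS := hloc e he
    have hv := hS.ver_isClosedOn
    have hpr := hS.hor_projectsTo ((S.base hC hB).loc e) rfl (hfr e he)
    have hA := fun μ ν => (S.base_isSmoothOn hC hB he).lowerEL_eulerLagrange μ ν hp.1
    exact ⟨fun α μ ν => hpr.Gam α μ ν p hp, fun α μ ν => hpr.Gam0 α μ ν p hp,
      fun α μ ν => hpr.Tor α μ ν p hp, fun a μ ν => hS.nlCurv_eq_zero a μ ν hp,
      (hB e he p hp).2, fun a μ c => sub_eq_zero.2 ((hB e he p hp).1 a c μ),
      fun a b c => hv.Tor a b c p hp, fun α μ ν => hpr.gam α μ ν p hp,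
      fun a b μ => hS.vh_sub_natural a b μ hp,
      fun α μ c => hS.hv_sub_natural ((S.base hC hB).loc e) (hfr e he) α μ c hp,
      fun a b c => hv.gam a b c p hp, fun μ ν => hpr.g μ ν p hp, fun μ => hpr.C μ p hp,
      fun k μ ν => hpr.table k μ ν p hp, fun μ ν => hpr.energyMomentum μ ν p hp,
      fun μ ν => hpr.emField μ ν p hp, fun j β => hEL e he j β p hp,
      fun μ ν => by rw [hpr.lowerEL (hEL e he) μ ν p hp, hpr.E μ ν p hp, hA], hA,
      fun μ ν => hpr.E μ ν p hp⟩
  · constructor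
    · intro h e he x hx j β
      -- The fibres of $\mathcal D$ are non-empty, so the horizontal equations reach every point of
      -- $M$.
      obtain ⟨y, hy⟩ := S.exists_coordDom he hx
      rw [← hEL e he j β (x, y) hy]
      exact h e he (x, y) hy j β
    · intro h e he p hp j β
      rw [hEL e he j β p hp]
      exact h e he p.1 hp.1 j β
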